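/- Let $1/4<p\le 1$ and let $m$ be any probability measure on $(0,\infty)$. Consider the full-line three-speed ballistic annihilation process: particles $\bullet_n$, $n\in\mathbb Z$, start at $x_n$, where $x_0=0$ and the gaps $x_n-x_{n-1}$ are i.i.d. with law $m$; their velocities $v_n$ are i.i.d. with $P(v_n=0)=p$, $P(v_n=\pm1)=\frac{1-p}2$; their spins $s_n$ are i.i.d. uniform on $\{-1,+1\}$; gaps, velocities and spins are independent. Each particle moves at its velocity until it collides. Two particles that collide annihilate each other. When three particles (one left-moving, one static, one right-moving) collide, the static one and one of the moving ones annihilate each other, and the other continues unperturbed: the right-moving one if the spin of the static particle is $+1$, the left-moving one if it is $-1$. Write $\bullet_i\sim\bullet_j$ if $\bullet_i$ and $\bullet_j$ annihilate each other. Let $S$ be the event that $\bullet_0$ is static and never annihilated. On $S$, put $L_0=R_0=0$, $\Sigma_0=\uparrow$, and for $k\ge0$ let $L_{k+1}=R_k+1$; if $\bullet_{L_{k+1}}$ is static and not annihilated by a particle from its right, let $R_{k+1}=L_{k+1}$ and $\Sigma_{k+1}=\uparrow$; otherwise let $R_{k+1}$ be the index with $\bullet_{L_{k+1}}\sim\bullet_{R_{k+1}}$,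 and let $\Sigma_{k+1}=\nearrow\uparrow$, $\uparrow\nwarrow$ or $\nearrow\nwarrow$ according to whether $(v_{L_{k+1}},v_{R_{k+1}})=(1,0)$, $(0,-1)$ or $(1,-1)$. Define $(L_k,R_k,\Sigma_k)$ for $k<0$ symmetrically, from right to left, with $R_{k-1}=L_k-1$ and $L_k\le R_k$, the shape being still read off from $(v_{L_k},v_{R_k})$. Consider also the process on $(0,\infty)$, in which only the particles $\bullet_n$, $n\ge1$, are present. In it, let $A\in\{1,2,\dots\}\cup\{\infty\}$ be the smallest index of a left-moving particle that reaches $0$ ($A=\infty$ if there is none), and let $\{\vec\bullet_1\to\leftarrow\bullet_{j}\}$ be the event that $v_1=1$, $v_j=-1$ and $\bullet_1\sim\bullet_j$, and $\{\vec\bullet_1\to\leftarrow\bullet\}$ the union of these events over $j$. Then $P(S)>0$, and: (a) Conditionally on $S$, the random variables $(R_k-L_k,\Sigma_k)$, $k\in\mathbb Z\setminus\{0\}$, are i.i.d., and their common law, that of a pair $(\Delta,\Sigma)$, depends only on $p$, not on $m$. It satisfies $$P(\Sigma=\uparrow)=p,\quad P(\Sigma=\nearrow\uparrow)=P(\Sigma=\uparrow\nwarrow)=\sqrt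 p(1-\sqrt p),\quad P(\Sigma=\nearrow\nwarrow)=(1-\sqrt p)^2,$$ and, for all $n\ge0$ (for the last two lines when $p<1$, so that the conditioning events have positive probability), $$P(\Delta=n\mid\Sigma=\uparrow)=\mathbf 1_{n=0},$$ $$P(\Delta=n\mid\Sigma=\uparrow\nwarrow)=P(\Delta=n\mid\Sigma=\nearrow\uparrow)=P(A=n\mid A<\infty),$$ $$P(\Delta=n\mid\Sigma=\nearrow\nwarrow)=P(\vec\bullet_1\to\leftarrow\bullet_{n+1}\mid\vec\bullet_1\to\leftarrow\bullet).$$ (b) Conditionally on $S$, the random variables $|v_{L_k}|$ and $|v_{R_k}|$, $k\in\mathbb Z\setminus\{0\}$, are (all together) i.i.d. Bernoulli with parameter $1-\sqrt p$. -/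

import Mathlib

open MeasureTheory ProbabilityTheory

namespace BallisticAnnihilation

/-- A configuration of particles indexed by `ℤ` (increasingly from left to right): initial
positions, velocities in `{-1, 0, 1}`, and spins in `{-1, 1}`. -/
structure Config where
  pos : ℤ → ℝ
  vel : ℤ → ℤ
  spin : ℤ → ℤ

/-- The time at which the virtual trajectories `t ↦ pos i + vel i * t` and `t ↦ pos j + vel j * t`
meet, and `⊤` if they do not (they meet at a positive time iff the particle that starts on the left
is strictly faster). The definition is symmetric in `i` and `j`. -/
noncomputable def collTime (c : Config) (i j : ℤ) : EReal :=
  if 0 < (c.pos j - c.pos i) * ((c.vel i : ℝ) - c.vel j) then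
    (((c.pos j - c.pos i) / ((c.vel i : ℝ) - c.vel j) : ℝ) : EReal)
  else ⊤

/-- The first time at which the virtual trajectory of `k` meets that of `i` or that of `j`. -/
noncomputable def hitTime (c : Config) (i j k : ℤ) : EReal :=
  min (collTime c i k) (collTime c j k)

/-- Given a relation `A` of mutual annihilations (`A k k'` is used for `k < k'`), the particle `k`
does not disturb `i` and `j`: it annihilates with a third particle of `I` before it would
meet `i` or `j`, or at that very moment (in a triple collision which `i` or `j` survives). -/
def RemovedBefore (c : Config) (I : Set ℤ) (A : ℤ → ℤ → Prop) (i j k : ℤ) : Prop :=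
  ∃ k' ∈ I, k' ≠ i ∧ k' ≠ j ∧ collTime c k k' ≤ hitTime c i j k ∧ (A k k' ∨ A k' k)

/-- The rule that decides whether `i < j` annihilate each other in the system made of the particles
with index in `I`, in terms of the annihilations `A` at earlier times. They have to collide
virtually, and
* either every other particle that would meet one of them at or before their collision time
  is removed by then;
* or a third particle `h` takes part in their collision and the spin of the static particle lets
  `h` survive (`h` is right-moving if the spin is `1`, left-moving if the spin is `-1`), and every
  particle that would meet one of them strictly before their collision time is removed by then. -/
def CollisionRule (c : Config) (I : Set ℤ) (A : ℤ → ℤ → Prop) (i j : ℤ) : Prop :=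
  i ∈ I ∧ j ∈ I ∧ i < j ∧ collTime c i j < ⊤ ∧
  ((∀ k ∈ I, k ≠ i → k ≠ j → hitTime c i j k ≤ collTime c i j → RemovedBefore c I A i j k) ∨
   ((∃ h ∈ I, collTime c i h = collTime c i j ∧ collTime c j h = collTime c i j ∧
      ((c.vel i = 0 ∧ c.vel h = 1 ∧ c.spin i = 1) ∨
       (c.vel j = 0 ∧ c.vel h = -1 ∧ c.spin j = -1))) ∧
    (∀ k ∈ I, k ≠ i → k ≠ j → hitTime c i j k < collTime c i j → RemovedBefore c I A i j k)))

/-- The mutual annihilations that are decided by at most `n` nested applications of the rule. -/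
def annihilatesUpTo (c : Config) (I : Set ℤ) : ℕ → ℤ → ℤ → Prop
  | 0 => fun _ _ => False
  | n + 1 => CollisionRule c I (annihilatesUpTo c I n)

/-- `i < j`, and `i` and `j` annihilate each other in the system in which only the particles with
index in `I` are present. In a configuration without accumulation points, only finitely many
pairs of particles can influence a given collision, so that the recursion has finite depth. -/
def Annihilates (c : Config) (I : Set ℤ) (i j : ℤ) : Prop :=
  ∃ n, annihilatesUpTo c I n i j

/-- In the system restricted to `I`, the particle `k` crosses the location `y` from the right: it
starts on the right of `y`, moves left, and is not annihilated when or before it reaches `y`. -/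
def CrossesFromRight (c : Config) (I : Set ℤ) (y : ℝ) (k : ℤ) : Prop :=
  k ∈ I ∧ c.vel k = -1 ∧ y < c.pos k ∧
    ∀ j, (Annihilates c I j k ∨ Annihilates c I k j) → ((c.pos k - y : ℝ) : EReal) < collTime c j k

/-- The indices of the particles that start from `(0, ∞)`. -/
def halfLine : Set ℤ := Set.Ioi 0

/-- `A`: the index of the first particle to cross `0` from the right in the process on `(0, ∞)`,
and `⊤` if there is none. -/
noncomputable def firstArrival (c : Config) : ℕ∞ :=
  ⨅ k ∈ {k : ℕ | 1 ≤ k ∧ CrossesFromRight c halfLine 0 (k : ℤ)}, (k : ℕ∞)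

/-- In the process on `(0, ∞)`, particle `i` moves right, particle `j` moves left and they
annihilate each other. -/
def RightLeftCollision (c : Config) (i j : ℤ) : Prop :=
  c.vel i = 1 ∧ c.vel j = -1 ∧ Annihilates c halfLine i j

/-- In the full-line process, the particle `0` is static and never annihilated. -/
def StaticSurvivor (c : Config) : Prop :=
  c.vel 0 = 0 ∧ ∀ j, ¬ Annihilates c Set.univ 0 j ∧ ¬ Annihilates c Set.univ j 0

/-- The four shapes: `up` is `↑`, `rightUp` is `↗↑`, `upLeft` is `↑↖` and `rightLeft` is `↗↖`. -/
inductive Shape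
  | up
  | rightUp
  | upLeft
  | rightLeft

instance : MeasurableSpace Shape := ⊤

/-- A block of the skyline: its first index, its last index, and its shape. -/
structure Block where
  left : ℤ
  right : ℤ
  shape : Shape

open Classical in
/-- The index of the particle that annihilates with `i` in the full-line process (and `i` if there
is none). -/
noncomputable def partner (c : Config) (i : ℤ) : ℤ :=
  if h : ∃ j, Annihilates c Set.univ i j ∨ Annihilates c Set.univ j i then h.choose else i

/-- The shape of a pair of particles that annihilate each other, in terms of their velocities:
`(1, 0)`, `(0, -1)` and `(1, -1)` are the only possible pairs. -/
def pairShape (vl vr : ℤ) : Shape :=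
  if vr = 0 then .rightUp else if vl = 0 then .upLeft else .rightLeft

open Classical in
/-- The skyline blocks on the right of particle `0`, from left to right. -/
noncomputable def rightBlock (c : Config) : ℕ → Block
  | 0 => ⟨0, 0, .up⟩
  | k + 1 =>
    let l := (rightBlock c k).right + 1
    if c.vel l = 0 ∧ ∀ j, ¬ Annihilates c Set.univ l j then ⟨l, l, .up⟩
    else ⟨l, partner c l, pairShape (c.vel l) (c.vel (partner c l))⟩

open Classical in
/-- The skyline blocks on the left of particle `0`, from right to left. -/
noncomputable def leftBlock (c : Config) : ℕ → Block
  | 0 => ⟨0, 0, .up⟩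
  | k + 1 =>
    let r := (leftBlock c k).left - 1
    if c.vel r = 0 ∧ ∀ j, ¬ Annihilates c Set.univ j r then ⟨r, r, .up⟩
    else ⟨partner c r, r, pairShape (c.vel (partner c r)) (c.vel r)⟩

/-- The block `(L_k, R_k, Σ_k)`, for `k ∈ ℤ`. -/
noncomputable def skylineBlock (c : Config) (k : ℤ) : Block :=
  if 0 ≤ k then rightBlock c k.toNat else leftBlock c (-k).toNat

/-- `(R_k - L_k, Σ_k)`. -/
noncomputable def skyline (c : Config) (k : ℤ) : ℤ × Shape :=
  ((skylineBlock c k).right - (skylineBlock c k).left, (skylineBlock c k).shape)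

/-- The absolute velocity at an end of block `k`: `|v_{L_k}|` if `e = false`, and `|v_{R_k}|` if
`e = true`. -/
noncomputable def endSpeed (c : Config) (k : ℤ) (e : Bool) : ℤ :=
  |c.vel (if e then (skylineBlock c k).right else (skylineBlock c k).left)|

/-- The law of a velocity: `0` with probability `p`, `1` and `-1` with probability `(1 - p) / 2`. -/
noncomputable def velLaw (p : ℝ) : Measure ℤ :=
  ENNReal.ofReal p • Measure.dirac 0 +
    ENNReal.ofReal ((1 - p) / 2) • (Measure.dirac 1 + Measure.dirac (-1))

/-- The law of a spin: uniform on `{-1, 1}`. -/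
noncomputable def spinLaw : Measure ℤ :=
  (2⁻¹ : ENNReal) • (Measure.dirac 1 + Measure.dirac (-1))

/-- The interdistance between particle `n - 1` and particle `n`, with the velocity and the spin of
particle `n`. -/
def Config.mark (c : Config) (n : ℤ) : ℝ × ℤ × ℤ :=
  (c.pos n - c.pos (n - 1), c.vel n, c.spin n)

/-- Under `P`, the random configuration `X` is that of the full-line process: there is a particle
at `0`, the interdistances have law `m`, velocities and spins have the above laws, and
all these variables are independent. The particles with positive index are then those
of the process on `(0, ∞)`. -/
structure IsFullLineProcess {Ω : Type*} [MeasurableSpace Ω] (p : ℝ) (m : Measure ℝ)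
    (P : Measure Ω) (X : Ω → Config) : Prop where
  pos_zero : ∀ ω, (X ω).pos 0 = 0
  measurable_mark : ∀ n, Measurable fun ω => (X ω).mark n
  indep : iIndepFun (fun n ω => (X ω).mark n) P
  law_mark : ∀ n, P.map (fun ω => (X ω).mark n) = m.prod ((velLaw p).prod spinLaw)

end BallisticAnnihilation

open BallisticAnnihilation

/-! ### Meetings, consistent records of annihilations, and the recursive rule -/

namespace BallisticAnnihilation

/-! The dynamics is handled through meetings of virtual trajectories. Speeds are at most one, so
only finitely many meetings lie in the backward cone of a given one, and induction on meetings
(`Config.Good.meet_induction`) shows that a configuration has at most one consistent record of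
annihilations (`IsMatching.iff`). The recursive rule produces such a record (`isMatching_mate`).
Restricting, gluing, translating and reflecting systems then reduces to exhibiting a consistent
record for the new system.

Everything is built on first arrivals in a half-line. The first particle moves left, survives, or
annihilates with some `j`; in the last case nothing happens across `j`, and arrivals start afresh
from `j` (`firstArr_iff`). A static first particle takes the first arrival on its right; a
right-left pair depends only on the particles between; a right-static pair depends on those, except
that it must win a race against the first arrival from the right (`mate_static_iff`,
`mate_right_left_iff`, `mate_right_static_iff`).

Let `F`, `U`, `H` be the generating series of first arrivals, of all arrivals, and of right-left
annihilations. Reversing a finite window shows that the left side wins races of a given total size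
with half of their probability. Hence `F = X((1-p)/2 + (3p/2)F² + HF)`. Moreover `U = F + FU`, and
the fate of a right-moving first particle in a finite window gives a balance equation. Eliminating
`U` and `H` leaves a fixed-point equation for `F` in which only `p` appears and which has one power
series solution (`series_fixed_point`, `eq_of_eq_X_mul`). So `F`, and then `H`, do not depend on
`m`. At `z = 1`, with `q = F(1)`, it reads `(1-q)²(p(1+q)²-1) = 0`. Continuity of `F` on `[0,1]`
rules out `q = 1` when `p > 1/4` (`firstGen_one_lt`), so `q = 1/√p - 1`, and the total mass of `H`
is `(1-√p)²`.

The static particle `0` survives iff nothing reaches it from either half-line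
(`staticSurvivor_iff`), which has probability `p(1-q)²`. On this event each half-line is cut into
blocks. "First block `b`, and nothing reaches `0`" means that `b` is realized inside its own window
and that nothing reaches its right end. These conditions concern disjoint sets of particles, so
probabilities of block sequences are products (`prob_blockChainIn`). The block weights sum to `p +
2pq + (1-√p)² = 1`; therefore the blocks exhaust the skyline almost surely (`ae_blockChainIn`), and
the weights are the common law of the blocks.

Finally the four shape weights are the products of two Bernoulli weights with parameter `1-√p`, one
for each end of the block, which gives (b) (`blockLaw_speed`). -/

/-- The configurations that occur almost surely: ordered positions without accumulation points,
velocities in `{-1, 0, 1}` and spins in `{-1, 1}`. -/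
structure Config.Good (c : Config) : Prop where
  mono : StrictMono c.pos
  vel : ∀ i, c.vel i = -1 ∨ c.vel i = 0 ∨ c.vel i = 1
  spin : ∀ i, c.spin i = 1 ∨ c.spin i = -1
  fin : ∀ r : ℝ, {k | |c.pos k| ≤ r}.Finite

/-- The virtual trajectory of particle `i`. -/
def Config.loc (c : Config) (i : ℤ) (t : ℝ) : ℝ := c.pos i + c.vel i * t

/-- The virtual trajectories of `i` and `j` meet at time `t`. -/
def Meet (c : Config) (i j : ℤ) (t : ℝ) : Prop := i ≠ j ∧ 0 < t ∧ c.loc i t = c.loc j t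

/-- `i` and `j` annihilate each other, in either order. -/
def Mate (c : Config) (I : Set ℤ) (i j : ℤ) : Prop := Annihilates c I i j ∨ Annihilates c I j i

/-- In a triple collision where `i` and `h` annihilate each other, the spin lets `k` survive. -/
def Spares (c : Config) (i h k : ℤ) : Prop :=
  (c.vel i = 0 ∧ c.spin i = c.vel k) ∨ (c.vel h = 0 ∧ c.spin h = c.vel k)

/-- Under the matching `M`, particle `i` is gone before it could annihilate with `k` at time `t`. -/
def Removed (c : Config) (M : ℤ → ℤ → Prop) (i k : ℤ) (t : ℝ) : Prop :=
  ∃ h s, M i h ∧ Meet c i h s ∧ (s < t ∨ s = t ∧ Spares c i h k)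

/-- `M` is a consistent record of mutual annihilations in the system with index set `I`. -/
structure IsMatching (c : Config) (I : Set ℤ) (M : ℤ → ℤ → Prop) : Prop where
  symm : ∀ i j, M i j → M j i
  mem : ∀ i j, M i j → i ∈ I
  meet : ∀ i j, M i j → ∃ t, Meet c i j t
  unique : ∀ i j k, M i j → M i k → j = k
  -- The dynamics is in this field: a meeting without annihilation needs one of the two particles to
  -- be gone already, or to be taken by a third one in a triple collision that spares the other.
  complete : ∀ i ∈ I, ∀ k ∈ I, ∀ t, Meet c i k t → M i k ∨ Removed c M i k t ∨ Removed c M k i t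

variable {c : Config} {I : Set ℤ} {i j k g h : ℤ} {s t : ℝ}

lemma Meet.symm (h : Meet c i j t) : Meet c j i t := ⟨h.1.symm, h.2.1, h.2.2.symm⟩

lemma Config.Good.ne (hc : c.Good) (h : i ≠ j) : c.pos i ≠ c.pos j := hc.mono.injective.ne h

lemma Config.Good.loc_inj (hc : c.Good) (h : c.loc i t = c.loc j t) (hv : c.vel i = c.vel j) :
    i = j := by
  unfold Config.loc at h
  rw [hv] at h
  exact hc.mono.injective (by linarith)

lemma Meet.vel_ne (hc : c.Good) (h : Meet c i j t) : c.vel i ≠ c.vel j :=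
  fun e => h.1 (hc.loc_inj h.2.2 e)

lemma Meet.time_unique (hc : c.Good) (h : Meet c i j t) (h' : Meet c i j s) : t = s := by
  have hv : ((c.vel i : ℝ) - c.vel j) ≠ 0 := by
    have := h.vel_ne hc
    rw [sub_ne_zero]; exact_mod_cast this
  have h1 := h.2.2
  have h2 := h'.2.2
  unfold Config.loc at h1 h2
  have : ((c.vel i : ℝ) - c.vel j) * (t - s) = 0 := by linear_combination h1 - h2
  rcases mul_eq_zero.1 this with h | h
  · exact absurd h hv
  · linarith

lemma collTime_eq_coe (hc : c.Good) : collTime c i j = (t : EReal) ↔ Meet c i j t := by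
  unfold collTime Meet Config.loc
  constructor
  · intro h
    split_ifs at h with h0
    swap
    · simp at h
    have hij : i ≠ j := by rintro rfl; simp at h0
    have hv : ((c.vel i : ℝ) - c.vel j) ≠ 0 := fun e => by rw [e] at h0; simp at h0
    have ht : (c.pos j - c.pos i) / ((c.vel i : ℝ) - c.vel j) = t := by exact_mod_cast h
    refine ⟨hij, ?_, ?_⟩
    · rw [← ht]
      exact div_pos_iff.2 ((mul_pos_iff.1 h0))
    · rw [div_eq_iff hv] at ht
      linarith
  · rintro ⟨hij, ht, h⟩
    have hx := hc.ne hij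
    have e : c.pos j - c.pos i = t * ((c.vel i : ℝ) - c.vel j) := by linear_combination -h
    have hv : ((c.vel i : ℝ) - c.vel j) ≠ 0 := fun e' => hx (by rw [e'] at e; linarith)
    rw [if_pos, e, mul_div_cancel_right₀ _ hv]
    rw [e, mul_assoc]
    exact mul_pos ht (mul_self_pos.2 hv)

lemma collTime_eq_top_or (hc : c.Good) (i j : ℤ) :
    collTime c i j = ⊤ ∨ ∃ t, Meet c i j t ∧ collTime c i j = (t : EReal) := by
  by_cases h : collTime c i j = ⊤
  · exact Or.inl h
  · right
    have h' : ∃ t : ℝ, collTime c i j = (t : EReal) := by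
      unfold collTime at h ⊢
      split_ifs at h ⊢ with h0
      · exact ⟨_, rfl⟩
      · exact absurd rfl h
    obtain ⟨t, ht⟩ := h'
    exact ⟨t, (collTime_eq_coe hc).1 ht, ht⟩

lemma collTime_le_coe (hc : c.Good) :
    collTime c i j ≤ (t : EReal) ↔ ∃ s ≤ t, Meet c i j s := by
  constructor
  · intro h
    rcases collTime_eq_top_or hc i j with h' | ⟨s, hs, h'⟩
    · rw [h'] at h; simp at h
    · rw [h'] at h
      exact ⟨s, by exact_mod_cast h, hs⟩
  · rintro ⟨s, hs, h⟩
    rw [(collTime_eq_coe hc).2 h]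
    exact_mod_cast hs

lemma hitTime_le_coe (hc : c.Good) :
    hitTime c i j k ≤ (t : EReal) ↔ ∃ s ≤ t, Meet c i k s ∨ Meet c j k s := by
  unfold hitTime
  rw [min_le_iff, collTime_le_coe hc, collTime_le_coe hc]
  constructor
  · rintro (⟨s, h1, h2⟩ | ⟨s, h1, h2⟩)
    exacts [⟨s, h1, Or.inl h2⟩, ⟨s, h1, Or.inr h2⟩]
  · rintro ⟨s, h1, h2 | h2⟩
    exacts [Or.inl ⟨s, h1, h2⟩, Or.inr ⟨s, h1, h2⟩]

lemma hitTime_of_le (hc : c.Good) (h : hitTime c i j k ≤ (t : EReal)) :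
    ∃ s ≤ t, (Meet c i k s ∨ Meet c j k s) ∧ hitTime c i j k = (s : EReal) := by
  have h0 := h
  unfold hitTime at h ⊢
  rcases min_choice (collTime c i k) (collTime c j k) with e | e <;> rw [e] at h ⊢ <;>
  obtain ⟨s, hs, hm⟩ := (collTime_le_coe hc).1 h
  · exact ⟨s, hs, Or.inl hm, (collTime_eq_coe hc).2 hm⟩
  · exact ⟨s, hs, Or.inr hm, (collTime_eq_coe hc).2 hm⟩

/-- Distinct particles at the same place at the same time have distinct velocities, and there are
only three velocities. -/
lemma eq_of_quadruple (hc : c.Good) (hij : Meet c i j t) (hih : Meet c i h t) (hjh : j ≠ h)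
    (hg : c.loc g t = c.loc i t) : g = i ∨ g = j ∨ g = h := by
  by_contra! hne
  have a1 : c.vel g ≠ c.vel i := fun e => hne.1 (hc.loc_inj hg e)
  have a2 : c.vel g ≠ c.vel j := fun e => hne.2.1 (hc.loc_inj (hg.trans hij.2.2) e)
  have a3 : c.vel g ≠ c.vel h := fun e => hne.2.2 (hc.loc_inj (hg.trans hih.2.2) e)
  have a4 := hij.vel_ne hc
  have a5 := hih.vel_ne hc
  have a6 : c.vel j ≠ c.vel h := fun e => hjh (hc.loc_inj (hij.2.2.symm.trans hih.2.2) e)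
  have := hc.vel g
  have := hc.vel i
  have := hc.vel j
  have := hc.vel h
  omega

/-- The three velocities are distinct, so exactly one particle can be static. It would have to be
`i`, whose spin cannot equal the velocities of both `j` and `h`. -/
lemma Spares.not_swap (hc : c.Good) (hij : Meet c i j t) (hih : Meet c i h t) (hjh : j ≠ h)
    (h1 : Spares c i j h) (h2 : Spares c i h j) : False := by
  have a4 := hij.vel_ne hc
  have a5 := hih.vel_ne hc
  have a6 : c.vel j ≠ c.vel h := fun e => hjh (hc.loc_inj (hij.2.2.symm.trans hih.2.2) e)
  unfold Spares at h1 h2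
  omega

lemma Spares.symm (h1 : Spares c i j h) : Spares c j i h := Or.symm h1

/-- In a triple collision, the spin selects a survivor. -/
lemma Spares.exists (hc : c.Good) (hij : Meet c i j t) (hih : Meet c i h t) (hjh : j ≠ h) :
    Spares c i j h ∨ Spares c i h j ∨ Spares c j h i := by
  have a4 := hij.vel_ne hc
  have a5 := hih.vel_ne hc
  have a6 : c.vel j ≠ c.vel h := fun e => hjh (hc.loc_inj (hij.2.2.symm.trans hih.2.2) e)
  have key : ∀ a b d : ℤ, c.vel a = 0 → c.vel b ≠ 0 → c.vel d ≠ 0 → c.vel b ≠ c.vel d →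
      Spares c a b d ∨ Spares c a d b := by
    intro a b d ha hb hd hbd
    have h1 := hc.vel b
    have h2 := hc.vel d
    rcases hc.spin a with h3 | h3
    · by_cases h4 : c.vel d = 1
      · exact Or.inl (Or.inl ⟨ha, by omega⟩)
      · exact Or.inr (Or.inl ⟨ha, by omega⟩)
    · by_cases h4 : c.vel d = -1
      · exact Or.inl (Or.inl ⟨ha, by omega⟩)
      · exact Or.inr (Or.inl ⟨ha, by omega⟩)
  by_cases hi : c.vel i = 0
  · exact (key i j h hi (by omega) (by omega) a6).imp id Or.inl
  · by_cases hj : c.vel j = 0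
    · exact (key j i h hj hi (by omega) a5).imp Spares.symm Or.inr
    · have hh : c.vel h = 0 := by
        have := hc.vel i
        have := hc.vel j
        have := hc.vel h
        omega
      exact Or.inr ((key h i j hh hi hj a4).imp Spares.symm Spares.symm)

lemma loc_sub_le (hc : c.Good) (i : ℤ) (h : s ≤ t) : |c.loc i s - c.loc i t| ≤ t - s := by
  unfold Config.loc
  rcases hc.vel i with e | e | e <;> rw [e] <;> rw [abs_le] <;> constructor <;> push_cast <;>
    linarith

lemma Config.Good.fin_near (hc : c.Good) (y r : ℝ) : {k | |c.pos k - y| ≤ r}.Finite := by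
  refine (hc.fin (r + |y|)).subset fun k hk => ?_
  simp only [Set.mem_ofPred_eq] at hk ⊢
  calc |c.pos k| = |(c.pos k - y) + y| := by ring_nf
    _ ≤ _ := abs_add_le _ _
    _ ≤ _ := by linarith

/-- Induction on meetings, along the trajectories that pass through the meeting point. -/
theorem Config.Good.meet_induction (hc : c.Good) {Q : ℤ → ℤ → ℝ → Prop}
    (step : ∀ i j t, Meet c i j t →
      (∀ g b s, c.loc g t = c.loc i t → Meet c g b s → s < t → Q g b s) → Q i j t)
    {i j : ℤ} {t : ℝ} (h : Meet c i j t) : Q i j t := by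
  set y := c.loc i t with hy
  set T := t with hT
  -- Since speeds are at most one, every trajectory passing through the backward cone of the meeting
  -- point starts in this finite window.
  set W := {k | |c.pos k - y| ≤ T} with hW
  have hWf : W.Finite := hc.fin_near y T
  set S : Set ℝ := {s | ∃ a ∈ W, ∃ b ∈ W, Meet c a b s} with hS
  have hSf : S.Finite := by
    refine ((hWf.prod hWf).image
      fun x : ℤ × ℤ => (c.pos x.2 - c.pos x.1) / ((c.vel x.1 : ℝ) - c.vel x.2)).subset ?_
    rintro s ⟨a, ha, b, hb, hm⟩
    refine ⟨(a, b), ⟨ha, hb⟩, ?_⟩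
    have hv : ((c.vel a : ℝ) - c.vel b) ≠ 0 := by
      rw [sub_ne_zero]; exact_mod_cast hm.vel_ne hc
    have := hm.2.2
    unfold Config.loc at this
    simp only
    rw [div_eq_iff hv]
    linarith
  have hmemW : ∀ a s, 0 < s → |c.loc a s - y| ≤ T - s → a ∈ W := by
    intro a s h0 h1
    have := loc_sub_le hc a h0.le
    have e : c.loc a 0 = c.pos a := by simp [Config.loc]
    rw [e] at this
    simp only [hW, Set.mem_ofPred_eq]
    calc |c.pos a - y| = |(c.pos a - c.loc a s) + (c.loc a s - y)| := by ring_nf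
      _ ≤ _ := abs_add_le _ _
      _ ≤ T := by linarith
  -- The induction runs over the finite set of meeting times of particles of the window, and is
  -- confined to meetings inside the cone.
  have key : ∀ s ∈ S, ∀ a b, Meet c a b s → |c.loc a s - y| ≤ T - s → Q a b s := by
    intro s hs
    refine (hSf.wellFoundedOn (r := (· < ·))).induction
      (P := fun s => ∀ a b, Meet c a b s → |c.loc a s - y| ≤ T - s → Q a b s) hs ?_
    intro s _ ih a b hm hy'
    refine step a b s hm fun g d r hg hm' hr => ?_
    have h1 : |c.loc g r - y| ≤ T - r := by
      have := loc_sub_le hc g hr.le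
      rw [hg] at this
      calc |c.loc g r - y| = |(c.loc g r - c.loc a s) + (c.loc a s - y)| := by ring_nf
        _ ≤ _ := abs_add_le _ _
        _ ≤ _ := by linarith
    have h2 : |c.loc d r - y| ≤ T - r := by rw [← hm'.2.2]; exact h1
    exact ih r ⟨g, hmemW g r hm'.2.1 h1, d, hmemW d r hm'.2.1 h2, hm'⟩ hr g d hm' h1
  have h1 : |c.loc i T - y| ≤ T - T := by simp [hy]
  have h2 : |c.loc j T - y| ≤ T - T := by rw [← h.2.2]; exact h1
  exact key T ⟨i, hmemW i T h.2.1 h1, j, hmemW j T h.2.1 h2, h⟩ i j h h1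

/-- A configuration admits at most one matching, first half. -/
theorem IsMatching.le (hc : c.Good) {M M' : ℤ → ℤ → Prop} (hM : IsMatching c I M)
    (hM' : IsMatching c I M') : ∀ i j, M i j → M' i j := by
  -- Each inclusion at time `t` uses the equivalence at earlier times, so both directions go through
  -- the induction together.
  suffices H : ∀ i j t, Meet c i j t → ((M i j → M' i j) ∧ (M' i j → M i j)) by
    intro i j h
    obtain ⟨t, ht⟩ := hM.meet i j h
    exact (H i j t ht).1 h
  have core : ∀ M M' : ℤ → ℤ → Prop, IsMatching c I M → IsMatching c I M' →
      ∀ i j t, Meet c i j t → (∀ g b s, c.loc g t = c.loc i t → Meet c g b s → s < t →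
        (M g b ↔ M' g b)) → M i j → M' i j := by
    intro M M' hM hM' i j t hm ih hij
    -- a particle of the pair cannot be removed in `M'`
    have aux : ∀ i j, Meet c i j t → (∀ g b s, c.loc g t = c.loc i t → Meet c g b s → s < t →
        (M g b ↔ M' g b)) → M i j → Removed c M' i j t → M' i j := by
      intro i j hm ih hij hR
      obtain ⟨h, s, hh, hms, hs⟩ := hR
      rcases hs with hs | ⟨rfl, hsp⟩
      · have := hM.unique _ _ _ hij ((ih i h s rfl hms hs).2 hh)
        subst this
        exact hh
      -- A tie: in `M'` the particle `i` is taken by `h` at the very time of its annihilation with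
      -- `j` in `M`. Completeness of `M` for `i` and `h` then requires a triple collision with the
      -- opposite choice of survivor, or a fourth particle.
      · by_cases hjh : j = h
        · exact hjh ▸ hh
        exfalso
        rcases hM.complete i (hM.mem _ _ hij) h (hM'.mem _ _ (hM'.symm _ _ hh)) s hms with
          h1 | h1 | h1
        · exact hjh (hM.unique _ _ _ hij h1)
        · obtain ⟨g, r, hg, hmr, hr⟩ := h1
          have := hM.unique _ _ _ hij hg
          subst this
          rcases hr with hr | ⟨rfl, hsp'⟩
          · exact hr.ne (hmr.time_unique hc hm)
          · exact Spares.not_swap hc hm hms hjh hsp' hsp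
        · obtain ⟨g, r, hg, hmr, hr⟩ := h1
          rcases hr with hr | ⟨rfl, hsp'⟩
          · have := hM'.unique _ _ _ (hM'.symm _ _ hh) ((ih h g r hms.2.2.symm hmr hr).1 hg)
            subst this
            exact hr.ne (hmr.symm.time_unique hc hms)
          · rcases eq_of_quadruple hc hm hms hjh (g := g) (hmr.2.2.symm.trans hms.2.2.symm) with
              e | e | e
            · subst e
              exact hjh (hM.unique _ _ _ hij (hM.symm _ _ hg))
            · subst e
              exact hms.1 (hM.unique _ _ _ (hM.symm _ _ hij) (hM.symm _ _ hg))
            · exact hmr.1 e.symm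
    rcases hM'.complete i (hM.mem _ _ hij) j (hM.mem _ _ (hM.symm _ _ hij)) t hm with h1 | h1 | h1
    · exact h1
    · exact aux i j hm ih hij h1
    · exact hM'.symm _ _ (aux j i hm.symm (fun g b s hg => ih g b s (hg.trans hm.2.2.symm))
        (hM.symm _ _ hij) h1)
  intro i j t hm
  refine hc.meet_induction (Q := fun i j t => (M i j → M' i j) ∧ (M' i j → M i j)) ?_ hm
  intro i j t hm ih
  exact ⟨core M M' hM hM' i j t hm fun g b s a1 a2 a3 => ⟨(ih g b s a1 a2 a3).1, (ih g b s a1 a2 a3).2⟩,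
    core M' M hM' hM i j t hm fun g b s a1 a2 a3 => ⟨(ih g b s a1 a2 a3).2, (ih g b s a1 a2 a3).1⟩⟩

theorem IsMatching.iff (hc : c.Good) {M M' : ℤ → ℤ → Prop} (hM : IsMatching c I M)
    (hM' : IsMatching c I M') (i j : ℤ) : M i j ↔ M' i j :=
  ⟨hM.le hc hM' i j, hM'.le hc hM i j⟩

/-- The relation of earlier annihilations enters the rule only positively, so the approximations of
finite depth increase. -/
lemma CollisionRule.mono {A B : ℤ → ℤ → Prop} (hAB : ∀ i j, A i j → B i j)
    (h : CollisionRule c I A i j) : CollisionRule c I B i j := by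
  have hr : ∀ k, RemovedBefore c I A i j k → RemovedBefore c I B i j k := by
    rintro k ⟨k', h1, h2, h3, h4, h5⟩
    exact ⟨k', h1, h2, h3, h4, h5.imp (hAB _ _) (hAB _ _)⟩
  obtain ⟨h1, h2, h3, h4, h5⟩ := h
  refine ⟨h1, h2, h3, h4, h5.imp (fun h k a b c d => hr k (h k a b c d)) ?_⟩
  rintro ⟨h6, h7⟩
  exact ⟨h6, fun k a b c d => hr k (h7 k a b c d)⟩

lemma annihilatesUpTo_succ (c : Config) (I : Set ℤ) (n : ℕ) :
    ∀ i j, annihilatesUpTo c I n i j → annihilatesUpTo c I (n + 1) i j := by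
  induction n with
  | zero => exact fun _ _ h => h.elim
  | succ n ih => exact fun _ _ h => CollisionRule.mono ih h

lemma annihilatesUpTo_mono (c : Config) (I : Set ℤ) {n m : ℕ} (h : n ≤ m) (i j : ℤ) :
    annihilatesUpTo c I n i j → annihilatesUpTo c I m i j := by
  induction h with
  | refl => exact id
  | step _ ih => exact fun h => annihilatesUpTo_succ _ _ _ _ _ (ih h)

lemma Annihilates.rule (h : Annihilates c I i j) : CollisionRule c I (Annihilates c I) i j := by
  obtain ⟨n, hn⟩ := h
  cases n with
  | zero => exact hn.elim
  | succ n => exact CollisionRule.mono (fun i j h => ⟨n, h⟩) hn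

/-- Only finitely many particles can meet the pair by its collision time, so the depths of their
removals have a common bound. This makes `Annihilates` a fixed point of the rule. -/
lemma Annihilates.of_rule (hc : c.Good) (h : CollisionRule c I (Annihilates c I) i j) :
    Annihilates c I i j := by
  obtain ⟨h1, h2, h3, h4, h5⟩ := h
  obtain ⟨t, hm, ht⟩ := (collTime_eq_top_or hc i j).resolve_left h4.ne
  have hfin : {k | hitTime c i j k ≤ (t : EReal)}.Finite := by
    refine (hc.fin_near (c.loc i t) (2 * t)).subset fun k hk => ?_
    obtain ⟨s, hs, hk⟩ := (hitTime_le_coe hc).1 hk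
    have h0 : 0 < s := by rcases hk with hk | hk <;> exact hk.2.1
    have e0 : |c.loc k s - c.loc i t| ≤ t - s := by
      rcases hk with hk | hk
      · rw [← hk.2.2]; exact loc_sub_le hc i hs
      · rw [← hk.2.2, hm.2.2]; exact loc_sub_le hc j hs
    have e1 := loc_sub_le hc k h0.le
    have e : c.loc k 0 = c.pos k := by simp [Config.loc]
    rw [e] at e1
    simp only [Set.mem_ofPred_eq]
    calc |c.pos k - c.loc i t| = |(c.pos k - c.loc k s) + (c.loc k s - c.loc i t)| := by ring_nf
      _ ≤ _ := abs_add_le _ _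
      _ ≤ _ := by linarith
  have hlift : ∀ k, ∃ n, RemovedBefore c I (Annihilates c I) i j k →
      RemovedBefore c I (annihilatesUpTo c I n) i j k := by
    intro k
    by_cases hk : RemovedBefore c I (Annihilates c I) i j k
    · obtain ⟨k', a1, a2, a3, a4, ⟨n, hn⟩ | ⟨n, hn⟩⟩ := hk
      · exact ⟨n, fun _ => ⟨k', a1, a2, a3, a4, Or.inl hn⟩⟩
      · exact ⟨n, fun _ => ⟨k', a1, a2, a3, a4, Or.inr hn⟩⟩
    · exact ⟨0, fun h => absurd h hk⟩
  choose N hN using hlift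
  obtain ⟨B, hB⟩ := (hfin.image N).bddAbove
  have hlift' : ∀ k, hitTime c i j k ≤ (t : EReal) → RemovedBefore c I (Annihilates c I) i j k →
      RemovedBefore c I (annihilatesUpTo c I B) i j k := by
    intro k hk hr
    obtain ⟨k', a1, a2, a3, a4, a5⟩ := hN k hr
    have : N k ≤ B := hB ⟨k, hk, rfl⟩
    exact ⟨k', a1, a2, a3, a4, a5.imp (annihilatesUpTo_mono c I this _ _)
      (annihilatesUpTo_mono c I this _ _)⟩
  refine ⟨B + 1, h1, h2, h3, h4, ?_⟩
  rw [ht] at h5 ⊢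
  refine h5.imp (fun h k h0 a b d => hlift' k d (h k h0 a b d)) ?_
  rintro ⟨h6, h7⟩
  exact ⟨h6, fun k h0 a b d => hlift' k d.le (h7 k h0 a b d)⟩

end BallisticAnnihilation

/-! ### The recursive rule yields a consistent record -/

namespace BallisticAnnihilation
variable {c : Config} {I : Set ℤ} {i j k g h : ℤ} {s t : ℝ}

lemma Mate.symm (h : Mate c I i j) : Mate c I j i := Or.symm h

lemma RemovedBefore.exists_mate (hc : c.Good)
    (h : RemovedBefore c I (Annihilates c I) i j k) (hs : hitTime c i j k ≤ (s : EReal)) :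
    ∃ k' r, k' ≠ i ∧ k' ≠ j ∧ r ≤ s ∧ Meet c k k' r ∧ Mate c I k k' := by
  obtain ⟨k', h1, h2, h3, h4, h5⟩ := h
  obtain ⟨r, hr, hm⟩ := (collTime_le_coe hc).1 (h4.trans hs)
  exact ⟨k', r, h2, h3, hr, hm, h5⟩

/-- The rule for a pair that annihilates, in terms of meetings. -/
lemma Mate.rule (hc : c.Good) (h : Mate c I i j) :
    i ∈ I ∧ j ∈ I ∧ ∃ t, Meet c i j t ∧
      (∀ k ∈ I, k ≠ i → k ≠ j → ∀ s < t, (Meet c i k s ∨ Meet c j k s) →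
        ∃ k' r, k' ≠ i ∧ k' ≠ j ∧ r ≤ s ∧ Meet c k k' r ∧ Mate c I k k') ∧
      (∀ k ∈ I, k ≠ i → k ≠ j → Meet c i k t →
        Spares c i j k ∨
          ∃ k' r, k' ≠ i ∧ k' ≠ j ∧ r ≤ t ∧ Meet c k k' r ∧ Mate c I k k') := by
  wlog hA : Annihilates c I i j generalizing i j
  · obtain ⟨h1, h2, t, h3, h4, h5⟩ := this h.symm (h.resolve_left hA)
    refine ⟨h2, h1, t, h3.symm, fun k a b d s e f => ?_, fun k a b d e => ?_⟩
    · obtain ⟨k', r, a1, a2, a3⟩ := h4 k a d b s e f.symm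
      exact ⟨k', r, a2, a1, a3⟩
    · rcases h5 k a d b ⟨d.symm, e.2.1, h3.2.2.trans e.2.2⟩ with h6 | ⟨k', r, a1, a2, a3⟩
      · exact Or.inl h6.symm
      · exact Or.inr ⟨k', r, a2, a1, a3⟩
  obtain ⟨h1, h2, h3, h4, h5⟩ := hA.rule
  obtain ⟨t, hm, ht⟩ := (collTime_eq_top_or hc i j).resolve_left h4.ne
  rw [ht] at h5
  refine ⟨h1, h2, t, hm, fun k hk a b s hs hks => ?_, fun k hk a b hks => ?_⟩
  · have hle : hitTime c i j k ≤ (s : EReal) := (hitTime_le_coe hc).2 ⟨s, le_rfl, hks⟩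
    have hlt : hitTime c i j k < (t : EReal) := hle.trans_lt (by exact_mod_cast hs)
    rcases h5 with h5 | ⟨-, h5⟩
    · exact (h5 k hk a b hlt.le).exists_mate hc hle
    · exact (h5 k hk a b hlt).exists_mate hc hle
  · have hle : hitTime c i j k ≤ (t : EReal) := (hitTime_le_coe hc).2 ⟨t, le_rfl, Or.inl hks⟩
    rcases h5 with h5 | ⟨⟨h, hh, e1, e2, hsp⟩, h5⟩
    · exact Or.inr ((h5 k hk a b hle).exists_mate hc hle)
    · rw [collTime_eq_coe hc] at e1 e2
      left
      rcases eq_of_quadruple hc hm hks (Ne.symm b) (g := h) e1.2.2.symm with e | e | e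
      · exact absurd e e1.1.symm
      · exact absurd e e2.1.symm
      · subst e
        unfold Spares
        omega

/-- A way to prove that a pair annihilates. -/
lemma Mate.of_rule (hc : c.Good) (hi : i ∈ I) (hj : j ∈ I) (hm : Meet c i j t)
    (h1 : ∀ k ∈ I, k ≠ i → k ≠ j → ∀ s < t, (Meet c i k s ∨ Meet c j k s) →
        ∃ k' r, k' ≠ i ∧ k' ≠ j ∧ r ≤ s ∧ Meet c k k' r ∧ Mate c I k k')
    (h2 : (∀ k ∈ I, k ≠ i → k ≠ j → Meet c i k t →
          ∃ k' r, k' ≠ i ∧ k' ≠ j ∧ r ≤ t ∧ Meet c k k' r ∧ Mate c I k k') ∨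
        ∃ k ∈ I, Meet c i k t ∧ Meet c j k t ∧ Spares c i j k) :
    Mate c I i j := by
  wlog hij : i < j generalizing i j
  · have hji : j < i := lt_of_le_of_ne (not_lt.1 hij) hm.1.symm
    refine (this hj hi hm.symm ?_ ?_ hji).symm
    · intro k a b d s e f
      obtain ⟨k', r, a1, a2, a3⟩ := h1 k a d b s e f.symm
      exact ⟨k', r, a2, a1, a3⟩
    · rcases h2 with h2 | ⟨k, hk, a1, a2, a3⟩
      · left
        intro k a b d e
        obtain ⟨k', r, a1, a2, a3⟩ := h2 k a d b ⟨d.symm, e.2.1, hm.2.2.trans e.2.2⟩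
        exact ⟨k', r, a2, a1, a3⟩
      · exact Or.inr ⟨k, hk, a2, a1, a3.symm⟩
  left
  have ht := (collTime_eq_coe hc).2 hm
  have hrem : ∀ k ∈ I, k ≠ i → k ≠ j → hitTime c i j k < (t : EReal) →
      RemovedBefore c I (Annihilates c I) i j k := by
    intro k hk a b hlt
    obtain ⟨s, hs, hks, e⟩ := hitTime_of_le hc hlt.le
    rw [e] at hlt
    obtain ⟨k', r, a1, a2, a3, a4, a5⟩ := h1 k hk a b s (by exact_mod_cast hlt) hks
    refine ⟨k', ?_, a1, a2, ?_, a5⟩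
    · exact (a5.rule hc).2.1
    · rw [e]; exact (collTime_le_coe hc).2 ⟨r, a3, a4⟩
  refine Annihilates.of_rule hc ⟨hi, hj, hij, by rw [ht]; exact EReal.coe_lt_top t, ?_⟩
  rw [ht]
  rcases h2 with h2 | ⟨k, hk, a1, a2, a3⟩
  · left
    intro k hk a b hle
    rcases hle.lt_or_eq with hlt | heq
    · exact hrem k hk a b hlt
    · obtain ⟨s, hs, hks, e⟩ := hitTime_of_le hc hle
      have : s = t := by rw [e] at heq; exact_mod_cast heq
      subst this
      have hik : Meet c i k s := by
        rcases hks with hks | hks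
        · exact hks
        · exact ⟨Ne.symm a, hm.2.1, hm.2.2.trans hks.2.2⟩
      obtain ⟨k', r, a1, a2, a3, a4, a5⟩ := h2 k hk a b hik
      refine ⟨k', (a5.rule hc).2.1, a1, a2, ?_, a5⟩
      rw [e]; exact (collTime_le_coe hc).2 ⟨r, a3, a4⟩
  · right
    refine ⟨⟨k, hk, (collTime_eq_coe hc).2 a1, (collTime_eq_coe hc).2 a2, ?_⟩, hrem⟩
    have b1 := hm.vel_ne hc
    have b2 := a1.vel_ne hc
    have b3 := a2.vel_ne hc
    have v1 := hc.vel i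
    have v2 := hc.vel j
    have v3 := hc.vel k
    -- the particle on the left is faster
    have b4 : c.vel j < c.vel i := by
      have hp := hc.mono hij
      have e := hm.2.2
      unfold Config.loc at e
      have : (0:ℝ) < ((c.vel i : ℝ) - c.vel j) * t := by linarith
      have := (pos_iff_pos_of_mul_pos this).2 hm.2.1
      have : (c.vel j : ℝ) < c.vel i := by linarith
      exact_mod_cast this
    rcases a3 with ⟨a3, a4⟩ | ⟨a3, a4⟩
    · left
      refine ⟨a3, ?_, ?_⟩ <;> omega
    · right
      refine ⟨a3, ?_, ?_⟩ <;> omega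

/-- If the second partner `d` comes strictly earlier, the rule for the first pair requires `d` to
have been annihilated by yet another particle, so that `d` would have two partners, which the
induction excludes. If both come at the same time, the rule for each pair requires the spin to spare
the other partner, which is contradictory. -/
lemma Mate.unique (hc : c.Good) (hij : Mate c I i j) (hik : Mate c I i k) : j = k := by
  -- the case of a strictly earlier second annihilation, given uniqueness at that time
  have early : ∀ {a b d : ℤ} {t s : ℝ}, Mate c I a b → Mate c I a d → Meet c a b t →
      Meet c a d s → s < t → (∀ x y, Mate c I a x → Mate c I a y → Meet c a x s →
        (∃ r ≤ s, Meet c a y r) → x = y) → (∀ x y, Mate c I d x → Mate c I d y → Meet c d x s →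
        (∃ r ≤ s, Meet c d y r) → x = y) → False := by
    intro a b d t s hab had hm hm' hst _ H
    obtain ⟨-, -, t', hm2, h1, -⟩ := hab.rule hc
    obtain rfl := hm2.time_unique hc hm
    have hdb : d ≠ b := by
      rintro rfl
      exact hst.ne (hm'.time_unique hc hm)
    obtain ⟨k', r, e1, e2, e3, e4, e5⟩ := h1 d (had.rule hc).2.1 hm'.1.symm hdb s hst (Or.inl hm')
    exact e1 (H a k' had.symm e5 hm'.symm ⟨r, e3, e4⟩).symm
  have main : ∀ i j t, Meet c i j t →
      (∀ x y, Mate c I i x → Mate c I i y → Meet c i x t → (∃ r ≤ t, Meet c i y r) → x = y) ∧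
      (∀ x y, Mate c I j x → Mate c I j y → Meet c j x t → (∃ r ≤ t, Meet c j y r) → x = y) := by
    intro i j t hm
    refine hc.meet_induction (Q := fun i j t =>
      (∀ x y, Mate c I i x → Mate c I i y → Meet c i x t → (∃ r ≤ t, Meet c i y r) → x = y) ∧
      (∀ x y, Mate c I j x → Mate c I j y → Meet c j x t → (∃ r ≤ t, Meet c j y r) → x = y)) ?_ hm
    intro i j t _ ih
    have step : ∀ i, (∀ g b s, c.loc g t = c.loc i t → Meet c g b s → s < t →
        (∀ x y, Mate c I g x → Mate c I g y → Meet c g x s → (∃ r ≤ s, Meet c g y r) → x = y) ∧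
        (∀ x y, Mate c I b x → Mate c I b y → Meet c b x s → (∃ r ≤ s, Meet c b y r) → x = y)) →
        ∀ x y, Mate c I i x → Mate c I i y → Meet c i x t → (∃ r ≤ t, Meet c i y r) → x = y := by
      intro a ih b d hab had hm ⟨s, hs, hm'⟩
      by_contra hbd
      rcases hs.lt_or_eq with hs | rfl
      · have := ih a d s rfl hm' hs
        exact early hab had hm hm' hs this.1 this.2
      -- in a triple collision, the spin decides
      have half : ∀ b d, b ≠ d → Mate c I a b → Mate c I a d → Meet c a b s → Meet c a d s →
          Spares c a b d := by
        intro b d hbd hab had hm hm'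
        obtain ⟨-, -, t', hm2, -, h2⟩ := hab.rule hc
        obtain rfl := hm2.time_unique hc hm
        rcases h2 d (had.rule hc).2.1 hm'.1.symm hbd.symm hm' with h2 | ⟨k', r, e1, e2, e3, e4, e5⟩
        · exact h2
        · exfalso
          rcases e3.lt_or_eq with e3 | rfl
          · have := ih d k' r hm'.2.2.symm e4 e3
            exact early had.symm e5 hm'.symm e4 e3 this.1 this.2
          · rcases eq_of_quadruple hc hm hm' hbd (g := k') (e4.2.2.symm.trans hm'.2.2.symm) with
              e | e | e
            · exact e1 e
            · exact e2 e
            · exact e4.1 e.symm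
      exact Spares.not_swap hc hm hm' hbd (half b d hbd hab had hm hm')
        (half d b (Ne.symm hbd) had hab hm' hm)
    rename_i hm
    exact ⟨step i ih, step j fun g b s hg => ih g b s (hg.trans hm.2.2.symm)⟩
  obtain ⟨-, -, t, hm, -⟩ := hij.rule hc
  obtain ⟨-, -, s, hm', -⟩ := hik.rule hc
  rcases le_total s t with hst | hst
  · exact (main i j t hm).1 j k hij hik hm ⟨s, hst, hm'⟩
  · exact ((main i k s hm').1 k j hik hij hm' ⟨t, hst, hm⟩).symm

/-- If both particles are still present at their meeting, then by induction all earlier intruders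
have been removed, so the rule applies: to the pair itself, or, when a third particle is present as
well, to the two particles that the spin designates. -/
lemma Mate.complete (hc : c.Good) (hi : i ∈ I) (hk : k ∈ I) (hm : Meet c i k t) :
    Mate c I i k ∨ Removed c (Mate c I) i k t ∨ Removed c (Mate c I) k i t := by
  revert hi hk
  refine hc.meet_induction (Q := fun i k t => i ∈ I → k ∈ I →
    Mate c I i k ∨ Removed c (Mate c I) i k t ∨ Removed c (Mate c I) k i t) ?_ hm
  intro i k t hm ih hi hk
  by_contra! hno
  obtain ⟨hn0, hn1, hn2⟩ := hno
  -- a particle which meets, before time `t`, a particle that stays until time `t` is removed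
  have strict : ∀ a u s, c.loc a t = c.loc i t → a ∈ I → u ∈ I → Meet c a u s → s < t →
      (∀ h r, Mate c I a h → Meet c a h r → ¬ r < t) →
      ∃ k' r, k' ≠ a ∧ r ≤ s ∧ Meet c u k' r ∧ Mate c I u k' := by
    intro a u s ha haI huI hms hs hstay
    rcases ih a u s ha hms hs haI huI with h1 | ⟨h, r, h1, h2, h3⟩ | ⟨h, r, h1, h2, h3⟩
    · exact (hstay u s h1 hms hs).elim
    · have : r < t := by rcases h3 with h3 | ⟨h3, -⟩ <;> linarith
      exact (hstay h r h1 h2 this).elim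
    · have hrs : r ≤ s := by rcases h3 with h3 | ⟨h3, -⟩ <;> linarith
      refine ⟨h, r, ?_, hrs, h2, h1⟩
      rintro rfl
      exact hstay u r h1.symm h2.symm (by linarith)
  have stay_i : ∀ h r, Mate c I i h → Meet c i h r → ¬ r < t :=
    fun h r a b d => hn1 ⟨h, r, a, b, Or.inl d⟩
  have stay_k : ∀ h r, Mate c I k h → Meet c k h r → ¬ r < t :=
    fun h r a b d => hn2 ⟨h, r, a, b, Or.inl d⟩
  -- the rule applies to two particles that stay, if it does at the time of the collision
  have rule : ∀ a b, c.loc a t = c.loc i t → c.loc b t = c.loc i t → a ∈ I → b ∈ I →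
      Meet c a b t →
      (∀ h r, Mate c I a h → Meet c a h r → ¬ r < t) →
      (∀ h r, Mate c I b h → Meet c b h r → ¬ r < t) →
      ((∀ k ∈ I, k ≠ a → k ≠ b → Meet c a k t →
          ∃ k' r, k' ≠ a ∧ k' ≠ b ∧ r ≤ t ∧ Meet c k k' r ∧ Mate c I k k') ∨
        ∃ k ∈ I, Meet c a k t ∧ Meet c b k t ∧ Spares c a b k) → Mate c I a b := by
    intro a b ha hb haI hbI hab sa sb h2
    refine Mate.of_rule hc haI hbI hab ?_ h2
    intro u hu hua hub s hs hms
    rcases hms with hms | hms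
    · obtain ⟨k', r, e1, e2, e3, e4⟩ := strict a u s ha haI hu hms hs sa
      refine ⟨k', r, e1, ?_, e2, e3, e4⟩
      rintro rfl
      exact sb u r e4.symm e3.symm (by linarith)
    · obtain ⟨k', r, e1, e2, e3, e4⟩ := strict b u s hb hbI hu hms hs sb
      refine ⟨k', r, ?_, e1, e2, e3, e4⟩
      rintro rfl
      exact sa u r e4.symm e3.symm (by linarith)
  by_cases hg : ∃ g ∈ I, g ≠ i ∧ g ≠ k ∧ Meet c i g t ∧
      ∀ h r, Mate c I g h → Meet c g h r → ¬ r < t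
  · obtain ⟨g, hgI, hgi, hgk, hmg, sg⟩ := hg
    have hkg : Meet c k g t := ⟨hgk.symm, hm.2.1, hm.2.2.symm.trans hmg.2.2⟩
    rcases Spares.exists hc hm hmg hgk.symm with hsp | hsp | hsp
    · exact hn0 (rule i k rfl hm.2.2.symm hi hk hm stay_i stay_k
        (Or.inr ⟨g, hgI, hmg, hkg, hsp⟩))
    · refine hn1 ⟨g, t, rule i g rfl hmg.2.2.symm hi hgI hmg stay_i sg
        (Or.inr ⟨k, hk, hm, hkg.symm, hsp⟩), hmg, Or.inr ⟨rfl, hsp⟩⟩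
    · refine hn2 ⟨g, t, rule k g hm.2.2.symm hmg.2.2.symm hk hgI hkg stay_k sg
        (Or.inr ⟨i, hi, hm.symm, hmg.symm, hsp⟩), hkg, Or.inr ⟨rfl, hsp⟩⟩
  · push Not at hg
    refine hn0 (rule i k rfl hm.2.2.symm hi hk hm stay_i stay_k (Or.inl ?_))
    intro g hgI hgi hgk hmg
    obtain ⟨h, r, h1, h2, h3⟩ := hg g hgI hgi hgk hmg
    refine ⟨h, r, ?_, ?_, h3.le, h2, h1⟩
    · rintro rfl
      exact stay_i g r h1.symm h2.symm h3
    · rintro rfl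
      exact stay_k g r h1.symm h2.symm h3

/-- The annihilations of the process form a consistent record. -/
theorem isMatching_mate (hc : c.Good) (I : Set ℤ) : IsMatching c I (Mate c I) where
  symm _ _ h := h.symm
  mem _ _ h := (h.rule hc).1
  meet _ _ h := by obtain ⟨-, -, t, ht, -⟩ := h.rule hc; exact ⟨t, ht⟩
  unique _ _ _ h h' := Mate.unique hc h h'
  complete _ hi _ hk _ hm := Mate.complete hc hi hk hm

theorem IsMatching.mate_iff (hc : c.Good) {M : ℤ → ℤ → Prop} (hM : IsMatching c I M) :
    Mate c I i j ↔ M i j := (isMatching_mate hc I).iff hc hM i j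

lemma annihilates_iff : Annihilates c I i j ↔ i < j ∧ Mate c I i j := by
  constructor
  · intro h
    exact ⟨h.rule.2.2.1, Or.inl h⟩
  · rintro ⟨h1, h2 | h2⟩
    · exact h2
    · exact absurd h2.rule.2.2.1 (by omega)

end BallisticAnnihilation

/-! ### Subsystems, non-crossing and arrivals -/

namespace BallisticAnnihilation
variable {c : Config} {I I' I₁ I₂ : Set ℤ} {i j k g h u w n a : ℤ} {s t : ℝ}

/-- `k` is not annihilated in the system with index set `I`. -/
def Free (c : Config) (I : Set ℤ) (k : ℤ) : Prop := ∀ j, ¬ Mate c I k j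

lemma Mate.mem (hc : c.Good) (h : Mate c I i j) : i ∈ I := (isMatching_mate hc I).mem _ _ h

lemma Mate.mem_right (hc : c.Good) (h : Mate c I i j) : j ∈ I := h.symm.mem hc

lemma Mate.meet (hc : c.Good) (h : Mate c I i j) : ∃ t, Meet c i j t :=
  (isMatching_mate hc I).meet _ _ h

lemma Removed.mono {M M' : ℤ → ℤ → Prop} (hM : ∀ i j, M i j → M' i j) (h : Removed c M i k t) :
    Removed c M' i k t := by
  obtain ⟨h, s, h1, h2⟩ := h
  exact ⟨h, s, hM _ _ h1, h2⟩

lemma Removed.le {M : ℤ → ℤ → Prop} (h : Removed c M i k s) (hst : s < t) :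
    Removed c M i g t := by
  obtain ⟨h, r, h1, h2, h3⟩ := h
  refine ⟨h, r, h1, h2, Or.inl ?_⟩
  rcases h3 with h3 | ⟨h3, -⟩ <;> linarith

/-- Two particles that meet virtually do not both survive their meeting. -/
lemma not_cross_of_tie (hc : c.Good) (hi : i ∈ I) (hk : k ∈ I) (hm : Meet c i k s)
    (h1 : ∀ h r, Mate c I i h → Meet c i h r → s < r ∨ h ≠ k ∧ ¬ Spares c i h k ∧ s = r)
    (h2 : ∀ h r, Mate c I k h → Meet c k h r → s < r ∨ h ≠ i ∧ ¬ Spares c k h i ∧ s = r) :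
    False := by
  rcases Mate.complete hc hi hk hm with h | ⟨h, r, a, b, d⟩ | ⟨h, r, a, b, d⟩
  · rcases h1 k s h hm with h' | h'
    · exact lt_irrefl _ h'
    · exact h'.1 rfl
  · rcases h1 h r a b with h' | h' <;> rcases d with d | d
    · linarith
    · linarith [d.1]
    · linarith [h'.2.2]
    · exact h'.2.1 d.2
  · rcases h2 h r a b with h' | h' <;> rcases d with d | d
    · linarith
    · linarith [d.1]
    · linarith [h'.2.2]
    · exact h'.2.1 d.2

lemma not_cross (hc : c.Good) (hi : i ∈ I) (hk : k ∈ I) (hm : Meet c i k s)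
    (h1 : ∀ h r, Mate c I i h → Meet c i h r → s < r)
    (h2 : ∀ h r, Mate c I k h → Meet c k h r → s < r) : False :=
  not_cross_of_tie hc hi hk hm (fun h r a b => Or.inl (h1 h r a b))
    (fun h r a b => Or.inl (h2 h r a b))

lemma Mate.after (hc : c.Good) (h : Mate c I i j) (hm : Meet c i j t) (hs : s < t) :
    ∀ h r, Mate c I i h → Meet c i h r → s < r := by
  intro h' r h1 h2
  obtain rfl := h.unique hc h1
  rwa [← hm.time_unique hc h2]

lemma Free.after (h : Free c I i) : ∀ h r, Mate c I i h → Meet c i h r → s < r :=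
  fun h' _ h1 _ => (h h' h1).elim

lemma exists_meet (hc : c.Good) (hij : i < j) (hv : c.vel j < c.vel i) : ∃ t, Meet c i j t := by
  have h1 : (0:ℝ) < (c.vel i : ℝ) - c.vel j := by
    have : (c.vel j : ℝ) < c.vel i := by exact_mod_cast hv
    linarith
  have h2 : 0 < c.pos j - c.pos i := by linarith [hc.mono hij]
  refine ⟨(c.pos j - c.pos i) / ((c.vel i : ℝ) - c.vel j), hij.ne, div_pos h2 h1, ?_⟩
  have := div_mul_cancel₀ (c.pos j - c.pos i) h1.ne'
  unfold Config.loc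
  linarith

lemma Meet.vel_lt (hc : c.Good) (hm : Meet c i j t) (hij : i < j) : c.vel j < c.vel i := by
  have hp := hc.mono hij
  have e := hm.2.2
  unfold Config.loc at e
  have : (0:ℝ) < ((c.vel i : ℝ) - c.vel j) * t := by linarith
  have := (pos_iff_pos_of_mul_pos this).2 hm.2.1
  have : (c.vel j : ℝ) < c.vel i := by linarith
  exact_mod_cast this

lemma Meet.pos_eq (hm : Meet c i j t) {x y : ℤ} (hi : c.vel i = x) (hj : c.vel j = y) :
    c.pos i + x * t = c.pos j + y * t := by
  have := hm.2.2
  unfold Config.loc at this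
  rwa [hi, hj] at this

/-- A subsystem in which the particles with a partner outside die too late to matter. -/
theorem mate_restrict (hc : c.Good) (hI : I' ⊆ I)
    (H : ∀ u ∈ I', ∀ w, w ∉ I' → Mate c I u w → ∀ t, Meet c u w t →
      ∀ v ∈ I', ∀ s, Meet c u v s → s < t) :
    Mate c I' i j ↔ i ∈ I' ∧ j ∈ I' ∧ Mate c I i j := by
  refine IsMatching.mate_iff hc (M := fun i j => i ∈ I' ∧ j ∈ I' ∧ Mate c I i j)
    ⟨fun i j h => ⟨h.2.1, h.1, h.2.2.symm⟩, fun i j h => h.1, fun i j h => h.2.2.meet hc,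
      fun i j k h h' => h.2.2.unique hc h'.2.2, ?_⟩
  have aux : ∀ i ∈ I', ∀ k ∈ I', ∀ t, Meet c i k t → Removed c (Mate c I) i k t →
      Removed c (fun i j => i ∈ I' ∧ j ∈ I' ∧ Mate c I i j) i k t := by
    rintro i hi k hk t hm ⟨h, r, h1, h2, h3⟩
    by_cases hh : h ∈ I'
    · exact ⟨h, r, ⟨hi, hh, h1⟩, h2, h3⟩
    · have := H i hi h hh h1 r h2 k hk t hm
      rcases h3 with h3 | ⟨h3, -⟩ <;> linarith
  intro i hi k hk t hm
  rcases Mate.complete hc (hI hi) (hI hk) hm with h | h | h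
  · exact Or.inl ⟨hi, hk, h⟩
  · exact Or.inr (Or.inl (aux i hi k hk t hm h))
  · exact Or.inr (Or.inr (aux k hk i hi t hm.symm h))

/-- A subsystem that is closed under annihilations. -/
theorem mate_restrict_of_closed (hc : c.Good) (hI : I' ⊆ I)
    (H : ∀ u ∈ I', ∀ w, w ∉ I' → ¬ Mate c I u w) :
    Mate c I' i j ↔ i ∈ I' ∧ j ∈ I' ∧ Mate c I i j :=
  mate_restrict hc hI fun u hu w hw h => (H u hu w hw h).elim

lemma free_restrict_of_closed (hc : c.Good) (hI : I' ⊆ I)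
    (H : ∀ u ∈ I', ∀ w, w ∉ I' → ¬ Mate c I u w) (hi : i ∈ I') : Free c I' i ↔ Free c I i := by
  constructor
  · intro h j hj
    by_cases hj' : j ∈ I'
    · exact h j ((mate_restrict_of_closed hc hI H).2 ⟨hi, hj', hj⟩)
    · exact H i hi j hj' hj
  · intro h j hj
    exact h j ((mate_restrict_of_closed hc hI H).1 hj).2.2

/-- The union of two systems that do not interact. -/
theorem mate_union (hc : c.Good) (hd : ∀ i ∈ I₁, i ∉ I₂)
    (H : ∀ u ∈ I₁, ∀ w ∈ I₂, ∀ r, Meet c u w r →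
      Removed c (Mate c I₁) u w r ∨ Removed c (Mate c I₂) w u r) :
    Mate c (I₁ ∪ I₂) i j ↔ Mate c I₁ i j ∨ Mate c I₂ i j := by
  refine IsMatching.mate_iff hc (M := fun i j => Mate c I₁ i j ∨ Mate c I₂ i j)
    ⟨fun i j h => h.imp Mate.symm Mate.symm, fun i j h => h.imp (Mate.mem hc) (Mate.mem hc),
      fun i j h => h.elim (Mate.meet hc) (Mate.meet hc), ?_, ?_⟩
  · rintro i j k (h | h) (h' | h')
    · exact h.unique hc h'
    · exact (hd _ (h.mem hc) (h'.mem hc)).elim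
    · exact (hd _ (h'.mem hc) (h.mem hc)).elim
    · exact h.unique hc h'
  · have m1 : ∀ i k t, Removed c (Mate c I₁) i k t →
        Removed c (fun i j => Mate c I₁ i j ∨ Mate c I₂ i j) i k t :=
      fun i k t h => h.mono fun _ _ => Or.inl
    have m2 : ∀ i k t, Removed c (Mate c I₂) i k t →
        Removed c (fun i j => Mate c I₁ i j ∨ Mate c I₂ i j) i k t :=
      fun i k t h => h.mono fun _ _ => Or.inr
    rintro i (hi | hi) k (hk | hk) t hm
    · exact (Mate.complete hc hi hk hm).imp Or.inl (Or.imp (m1 _ _ _) (m1 _ _ _))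
    · exact Or.inr ((H i hi k hk t hm).imp (m1 _ _ _) (m2 _ _ _))
    · exact Or.inr ((H k hk i hi t hm.symm).symm.imp (m2 _ _ _) (m1 _ _ _))
    · exact (Mate.complete hc hi hk hm).imp Or.inr (Or.imp (m2 _ _ _) (m2 _ _ _))

/-- Nothing happens across the trajectory of a left-moving particle that survives. -/
lemma Free.not_mate_across (hc : c.Good) (hk : k ∈ I) (hv : c.vel k = -1) (hf : Free c I k)
    (hu : u ≤ k) (hw : k < w) : ¬ Mate c I u w := by
  intro h
  rcases hu.eq_or_lt with rfl | hu
  · exact hf w h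
  obtain ⟨t, ht⟩ := h.meet hc
  have v1 := ht.vel_lt hc (hu.trans hw)
  have v2 := hc.vel w
  have v3 := hc.vel u
  obtain ⟨s, hs⟩ := exists_meet hc hu (by omega : c.vel k < c.vel u)
  refine not_cross hc (h.mem hc) hk hs (h.after hc ht ?_) hf.after
  have p1 := hc.mono hw
  have p2 := hc.mono hu
  have q1 := hs.pos_eq rfl hv
  have q2 := ht.pos_eq rfl rfl
  rcases v2 with v2 | v2 | v2 <;> rcases v3 with v3 | v3 | v3 <;> first | omega | skip
  all_goals rw [v3] at q1 q2; rw [v2] at q2; push_cast at q1 q2; linarith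

/-- A particle `u ≤ k` that would meet some `w > k` has to meet the left-moving `k` first. As `k`
survives in the system on its left, `u` is removed before that, so the two sides do not interact. -/
lemma free_iff_Iic (hc : c.Good) (hk : k ∈ I) (hv : c.vel k = -1) :
    Free c (I ∩ Set.Iic k) k ↔ Free c I k := by
  constructor
  · intro hf
    have hI : I = (I ∩ Set.Iic k) ∪ (I ∩ Set.Ioi k) := by
      rw [← Set.inter_union_distrib_left, Set.Iic_union_Ioi, Set.inter_univ]
    have key : ∀ i j, Mate c I i j ↔ Mate c (I ∩ Set.Iic k) i j ∨ Mate c (I ∩ Set.Ioi k) i j := by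
      intro i j
      conv_lhs => rw [hI]
      refine mate_union hc (fun i h h' => (not_lt.2 h.2 : ¬ k < i) h'.2) ?_
      intro u hu w hw r hr
      left
      have hkw : k < w := hw.2
      have huk : u ≤ k := hu.2
      have v1 := hr.vel_lt hc (huk.trans_lt hkw)
      have v2 := hc.vel w
      have v3 := hc.vel u
      have hu' : u < k := lt_of_le_of_ne huk (by rintro rfl; omega)
      obtain ⟨s, hs⟩ := exists_meet hc hu' (by omega : c.vel k < c.vel u)
      have hsr : s < r := by
        have p1 := hc.mono hkw
        have p2 := hc.mono hu'
        have q1 := hs.pos_eq rfl hv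
        have q2 := hr.pos_eq rfl rfl
        rcases v2 with v2 | v2 | v2 <;> rcases v3 with v3 | v3 | v3 <;> first | omega | skip
        all_goals rw [v3] at q1 q2; rw [v2] at q2; push_cast at q1 q2; linarith
      rcases Mate.complete hc hu (⟨hk, le_refl k⟩ : k ∈ I ∩ Set.Iic k) hs with h | h | h
      · exact (hf u h.symm).elim
      · exact h.le hsr
      · obtain ⟨h, _, h', _⟩ := h
        exact (hf h h').elim
    intro j hj
    rcases (key k j).1 hj with h | h
    · exact hf j h
    · exact lt_irrefl k (h.mem hc).2
  · intro hf
    refine (free_restrict_of_closed hc Set.inter_subset_left ?_ ⟨hk, le_refl k⟩).2 hf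
    intro u hu w hw h
    have : k < w := by
      by_contra hle
      exact hw ⟨h.mem_right hc, not_lt.1 hle⟩
    exact hf.not_mate_across hc hk hv hu.2 this h

/-- `k` is a left-moving particle that reaches the initial location of particle `a` in the process
on the right of `a`. -/
def Arr (c : Config) (a k : ℤ) : Prop := a < k ∧ c.vel k = -1 ∧ Free c (Set.Ioc a k) k

/-- The survival of a left-moving particle ignores what lies on its right, so it may be tested in
any system that agrees with `Ioc a k` up to `k`. -/
lemma arr_iff (hc : c.Good) (hI : I ∩ Set.Iic k = Set.Ioc a k) (hk : k ∈ I) :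
    Arr c a k ↔ c.vel k = -1 ∧ Free c I k := by
  have hak : a < k := by
    have : k ∈ Set.Ioc a k := by rw [← hI]; exact ⟨hk, le_refl k⟩
    exact this.1
  unfold Arr
  rw [← hI]
  constructor
  · rintro ⟨-, h1, h2⟩
    exact ⟨h1, (free_iff_Iic hc hk h1).1 h2⟩
  · rintro ⟨h1, h2⟩
    exact ⟨hak, h1, (free_iff_Iic hc hk h1).2 h2⟩

lemma arr_iff_Ioi (hc : c.Good) (hak : a < k) :
    Arr c a k ↔ c.vel k = -1 ∧ Free c (Set.Ioi a) k :=
  arr_iff hc Set.Ioi_inter_Iic hak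

lemma arr_iff_Ioc (hc : c.Good) (hak : a < k) (hkn : k ≤ n) :
    Arr c a k ↔ c.vel k = -1 ∧ Free c (Set.Ioc a n) k := by
  refine arr_iff hc ?_ ⟨hak, hkn⟩
  ext x
  simp only [Set.mem_inter_iff, Set.mem_Ioc, Set.mem_Iic]
  omega

/-- After a first arrival, the next ones are those of the process on the right of it. -/
lemma Arr.arr_iff (hc : c.Good) (h : Arr c a k) (hkn : k < n) : Arr c a n ↔ Arr c k n := by
  have hak := h.1
  have hf := ((arr_iff_Ioc hc hak hkn.le).1 h).2
  have hkI : k ∈ Set.Ioc a n := ⟨hak, hkn.le⟩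
  unfold Arr
  rw [free_restrict_of_closed (I := Set.Ioc a n) (I' := Set.Ioc k n) hc
    (Set.Ioc_subset_Ioc_left hak.le) ?_ ⟨hkn, le_rfl⟩]
  · exact ⟨fun ⟨_, b, d⟩ => ⟨hkn, b, d⟩, fun ⟨_, b, d⟩ => ⟨hak.trans hkn, b, d⟩⟩
  · intro u hu w hw h'
    have hwn := h'.mem_right hc
    have : w ≤ k := by
      by_contra hlt
      exact hw ⟨not_le.1 hlt, hwn.2⟩
    exact hf.not_mate_across hc hkI h.2.1 this hu.1 h'.symm

/-- The pairs of particles that annihilate with the leftmost one separate the system. -/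
lemma Mate.not_mate_across (hc : c.Good) (hmin : ∀ u ∈ I, i ≤ u)
    (hij : Mate c I i j) (hu : u ≤ j) (hw : j < w) : ¬ Mate c I u w := by
  intro huw
  have hiI := hij.mem hc
  have hjI := hij.mem_right hc
  have huI := huw.mem hc
  have hwI := huw.mem_right hc
  obtain ⟨t, ht⟩ := hij.meet hc
  obtain ⟨r, hr⟩ := huw.meet hc
  have hij' : i < j := lt_of_le_of_ne (hmin j hjI) ht.1
  have hiu : i < u := by
    refine lt_of_le_of_ne (hmin u huI) ?_
    rintro rfl
    exact hw.ne (hij.unique hc huw)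
  have huj : u < j := by
    refine lt_of_le_of_ne hu ?_
    rintro rfl
    exact (hij'.trans hw).ne (hij.symm.unique hc huw)
  have pi := hc.mono hiu
  have pu := hc.mono huj
  have pw := hc.mono hw
  have vij := ht.vel_lt hc hij'
  have vuw := hr.vel_lt hc (huj.trans hw)
  have vi := hc.vel i
  have vj := hc.vel j
  have vu := hc.vel u
  have vw := hc.vel w
  have et := ht.pos_eq rfl rfl
  have er := hr.pos_eq rfl rfl
  -- It remains to exclude interleaved pairs `i < u < j < w`. For each choice of velocities, one of
  -- the three meetings below comes while both particles involved are present. In the two cases of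
  -- equality of times, the static particle of the triple collision would have to be spared, which
  -- the rule never allows.
  have C1 : ∀ s, Meet c u j s → s < t → s < r → False := fun s hs h1 h2 =>
    not_cross hc huI hjI hs (huw.after hc hr h2) (hij.symm.after hc ht.symm h1)
  have C2 : ∀ s, Meet c i u s → s < t → s < r → False := fun s hs h1 h2 =>
    not_cross hc hiI huI hs (hij.after hc ht h1) (huw.after hc hr h2)
  have C3 : ∀ s, Meet c j w s → s < t → s < r → False := fun s hs h1 h2 =>
    not_cross hc hjI hwI hs (hij.symm.after hc ht.symm h1) (huw.symm.after hc hr.symm h2)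
  have hvj : c.vel j = -1 ∨ c.vel j = 0 := by omega
  have hvw : c.vel w = -1 ∨ c.vel w = 0 := by omega
  have hvu : c.vel u = 0 ∨ c.vel u = 1 := by omega
  rcases hvj with hvj | hvj
  · obtain ⟨s, hs⟩ := exists_meet hc huj (by omega)
    have es := hs.pos_eq rfl hvj
    have hsr : s < r := by
      rcases hvu with e | e <;> rcases hvw with e' | e' <;> first | omega | skip
      all_goals rw [e] at es er; rw [e'] at er; push_cast at es er; linarith
    rcases hvu with e | e
    · have hi' : c.vel i = 0 ∨ c.vel i = 1 := by omega
      rcases hi' with e' | e'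
      · refine C1 s hs ?_ hsr
        rw [e] at es; rw [e', hvj] at et; push_cast at es et; linarith
      · have hw' : c.vel w = -1 := by omega
        rw [e] at es er; rw [e', hvj] at et; rw [hw'] at er; push_cast at es et er
        obtain ⟨s', hs'⟩ := exists_meet hc hiu (by omega)
        have es' := hs'.pos_eq e' e
        push_cast at es'
        rcases lt_trichotomy s t with h | h | h
        · exact C1 s hs h hsr
        · subst h
          refine not_cross_of_tie hc huI hjI hs
            (fun h r a b => Or.inl (huw.after hc hr hsr h r a b)) ?_
          intro h r a b
          right
          obtain rfl := hij.symm.unique hc a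
          refine ⟨hiu.ne, ?_, ht.symm.time_unique hc b⟩
          unfold Spares
          omega
        · exact C2 s' hs' (by linarith) (by linarith)
    · refine C1 s hs ?_ hsr
      have hi' : c.vel i = 0 ∨ c.vel i = 1 := by omega
      rcases hi' with e' | e' <;> rw [e] at es <;> rw [e', hvj] at et <;>
        push_cast at es et <;> linarith
  · have hi' : c.vel i = 1 := by omega
    rw [hi', hvj] at et
    push_cast at et
    rcases hvu with e | e
    · have hw' : c.vel w = -1 := by omega
      rw [e, hw'] at er
      push_cast at er
      obtain ⟨s, hs⟩ := exists_meet hc hiu (by omega)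
      have es := hs.pos_eq hi' e
      obtain ⟨s', hs'⟩ := exists_meet hc hw (by omega)
      have es' := hs'.pos_eq hvj hw'
      push_cast at es es'
      by_cases hsr : s < r
      · exact C2 s hs (by linarith) hsr
      · exact C3 s' hs' (by linarith) (by linarith)
    · obtain ⟨s, hs⟩ := exists_meet hc huj (by omega)
      have es := hs.pos_eq e hvj
      push_cast at es
      rcases hvw with hw' | hw'
      · rw [e, hw'] at er
        push_cast at er
        obtain ⟨s', hs'⟩ := exists_meet hc hw (by omega)
        have es' := hs'.pos_eq hvj hw'
        push_cast at es'
        rcases lt_trichotomy s r with h | h | h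
        · exact C1 s hs (by linarith) h
        · subst h
          refine not_cross_of_tie hc huI hjI hs ?_
            (fun h r a b => Or.inl (hij.symm.after hc ht.symm (by linarith) h r a b))
          intro h r a b
          right
          obtain rfl := huw.unique hc a
          refine ⟨hw.ne', ?_, hr.time_unique hc b⟩
          unfold Spares
          omega
        · exact C3 s' hs' (by linarith) (by linarith)
      · rw [e, hw'] at er
        push_cast at er
        exact C1 s hs (by linarith) (by linarith)

/-- A left-moving survivor that starts before `j` would meet `i` before `i` annihilates with `j`. -/
lemma Mate.not_free_between (hc : c.Good) (hmin : ∀ u ∈ I, i ≤ u) (hv : c.vel i ≠ -1)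
    (hij : Mate c I i j) (huI : u ∈ I) (hu : u ≤ j) (hvu : c.vel u = -1) : ¬ Free c I u := by
  intro hf
  obtain ⟨t, ht⟩ := hij.meet hc
  have hij' : i < j := lt_of_le_of_ne (hmin j (hij.mem_right hc)) ht.1
  have hiu : i < u := lt_of_le_of_ne (hmin u huI) (by rintro rfl; exact hv hvu)
  have huj : u < j := lt_of_le_of_ne hu (by rintro rfl; exact hf i hij.symm)
  have pi := hc.mono hiu
  have pu := hc.mono huj
  have vij := ht.vel_lt hc hij'
  have vi := hc.vel i
  have vj := hc.vel j
  obtain ⟨s, hs⟩ := exists_meet hc hiu (by omega)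
  refine not_cross hc (hij.mem hc) huI hs (hij.after hc ht ?_) hf.after
  have es := hs.pos_eq rfl hvu
  have et := ht.pos_eq rfl rfl
  rcases vi with vi | vi | vi <;> rcases vj with vj | vj | vj <;> first | omega | skip
  all_goals rw [vi] at es et; rw [vj] at et; push_cast at es et; linarith

lemma Free.not_free (hc : c.Good) (hi : i ∈ I) (hv : c.vel i ≠ -1) (hf : Free c I i)
    (hu : u ∈ I) (hiu : i < u) (hvu : c.vel u = -1) : ¬ Free c I u := by
  intro hf'
  have vi := hc.vel i
  obtain ⟨s, hs⟩ := exists_meet hc hiu (by omega)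
  exact not_cross hc hi hu hs hf.after hf'.after

end BallisticAnnihilation

/-! ### First arrivals and the fate of the first particle of a half-line -/

namespace BallisticAnnihilation
variable {c c' : Config} {I I' I₁ I₂ : Set ℤ} {i j k g h u w n a : ℤ} {s t : ℝ}

/-- `I` is an interval of integers that starts right after `a`. -/
def StartsAfter (I : Set ℤ) (a : ℤ) : Prop := ∀ k ∈ I, a < k ∧ Set.Ioc a k ⊆ I

lemma startsAfter_Ioi (a : ℤ) : StartsAfter (Set.Ioi a) a :=
  fun _ hk => ⟨hk, fun _ hx => hx.1⟩

lemma startsAfter_Ioc (a n : ℤ) : StartsAfter (Set.Ioc a n) a :=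
  fun _ hk => ⟨hk.1, fun _ hx => ⟨hx.1, hx.2.trans hk.2⟩⟩

lemma StartsAfter.inter_Iic (hI : StartsAfter I a) (hk : k ∈ I) : I ∩ Set.Iic k = Set.Ioc a k := by
  ext x
  exact ⟨fun h => ⟨(hI x h.1).1, h.2⟩, fun h => ⟨(hI k hk).2 h, h.2⟩⟩

lemma StartsAfter.le (hI : StartsAfter I a) : ∀ u ∈ I, a + 1 ≤ u := fun u hu => by
  have := (hI u hu).1
  omega

lemma StartsAfter.inter_Ioi (hI : StartsAfter I a) (ha : a ≤ j) :
    StartsAfter (I ∩ Set.Ioi j) j :=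
  fun k hk => ⟨hk.2, fun _ hx => ⟨(hI k hk.1).2 ⟨ha.trans_lt hx.1, hx.2⟩, hx.1⟩⟩

lemma StartsAfter.arr_iff (hc : c.Good) (hI : StartsAfter I a) (hk : k ∈ I) :
    Arr c a k ↔ c.vel k = -1 ∧ Free c I k :=
  BallisticAnnihilation.arr_iff hc (hI.inter_Iic hk) hk

/-- `n` is the first particle to reach the initial location of `a`, in the process on its right. -/
def FirstArr (c : Config) (a n : ℤ) : Prop := Arr c a n ∧ ∀ k, Arr c a k → n ≤ k

/-- No particle reaches the initial location of `a`, in the process on its right. -/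
def NoArr (c : Config) (a : ℤ) : Prop := ∀ k, ¬ Arr c a k

lemma firstArr_or_noArr (c : Config) (a : ℤ) : NoArr c a ∨ ∃ n, FirstArr c a n := by
  classical
  by_cases h : NoArr c a
  · exact Or.inl h
  · right
    unfold NoArr at h
    push Not at h
    obtain ⟨n, hn, hmin⟩ := Int.exists_least_of_bdd (P := Arr c a) ⟨a, fun z hz => hz.1.le⟩ h
    exact ⟨n, hn, hmin⟩

lemma FirstArr.unique {n m : ℤ} (h : FirstArr c a n) (h' : FirstArr c a m) : n = m :=
  le_antisymm (h.2 _ h'.1) (h'.2 _ h.1)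

lemma mate_inter_Iic (hc : c.Good) (hI : StartsAfter I a)
    (h : Mate c I (a + 1) j) (hi : i ≤ j) (hk : k ≤ j) : Mate c (Set.Ioc a j) i k ↔ Mate c I i k := by
  rw [← hI.inter_Iic (h.mem_right hc), mate_restrict_of_closed hc Set.inter_subset_left]
  · exact ⟨fun h => h.2.2, fun h => ⟨⟨h.mem hc, hi⟩, ⟨h.mem_right hc, hk⟩, h⟩⟩
  · intro u hu w hw h'
    refine h.not_mate_across hc hI.le hu.2 ?_ h'
    by_contra hle
    exact hw ⟨h'.mem_right hc, not_lt.1 hle⟩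

lemma free_inter_Ioi (hc : c.Good) (hI : StartsAfter I a)
    (h : Mate c I (a + 1) j) (hk : j < k) (hkI : k ∈ I) :
    Free c (I ∩ Set.Ioi j) k ↔ Free c I k := by
  refine free_restrict_of_closed hc Set.inter_subset_left ?_ ⟨hkI, hk⟩
  intro u hu w hw h'
  refine h.not_mate_across hc hI.le ?_ hu.2 h'.symm
  by_contra hle
  exact hw ⟨h'.mem_right hc, not_le.1 hle⟩

/-- The renewal property: no annihilation occurs across `j`, and no left-moving particle up to `j`
survives, so the system beyond `j` provides all the arrivals. -/
lemma Mate.arr_iff (hc : c.Good) (h : Mate c (Set.Ioi a) (a + 1) j) (hv : c.vel (a + 1) ≠ -1) :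
    Arr c a n ↔ Arr c j n := by
  have hI := startsAfter_Ioi a
  have haj : a < j := h.mem_right hc
  by_cases hn : j < n
  · have hnI : n ∈ Set.Ioi a := haj.trans hn
    rw [hI.arr_iff hc hnI, (hI.inter_Ioi haj.le).arr_iff hc ⟨hnI, hn⟩,
      free_inter_Ioi hc hI h hn hnI]
  · refine ⟨fun h' => ?_, fun h' => absurd h'.1 hn⟩
    have h'' := (hI.arr_iff hc h'.1).1 h'
    exact (h.not_free_between hc hI.le hv h'.1 (not_lt.1 hn) h''.1 h''.2).elim

lemma Free.noArr (hc : c.Good) (h : Free c (Set.Ioi a) (a + 1)) (hv : c.vel (a + 1) ≠ -1) :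
    NoArr c a := by
  intro k hk
  have hI := startsAfter_Ioi a
  have h' := (hI.arr_iff hc hk.1).1 hk
  have h1 : a + 1 ≤ k := hI.le k hk.1
  have h2 : a + 1 < k := lt_of_le_of_ne h1 (by rintro rfl; exact hv h'.1)
  exact h.not_free hc (by simp) hv hk.1 h2 h'.1 h'.2

lemma firstArr_of_vel (hc : c.Good) (hv : c.vel (a + 1) = -1) : FirstArr c a n ↔ n = a + 1 := by
  have h1 : FirstArr c a (a + 1) := by
    refine ⟨⟨by omega, hv, fun j hj => ?_⟩, fun k hk => ?_⟩
    · have h1 := hj.mem_right hc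
      have h2 := hj.mem hc
      obtain ⟨t, ht⟩ := hj.meet hc
      have := ht.1
      simp only [Set.mem_Ioc] at h1 h2
      omega
    · have := hk.1
      omega
  exact ⟨fun h => h.unique h1, fun h => h ▸ h1⟩

/-- The first arrival, according to the fate of the first particle. -/
lemma firstArr_iff (hc : c.Good) (hv : c.vel (a + 1) ≠ -1) :
    FirstArr c a n ↔ ∃ j, Mate c (Set.Ioi a) (a + 1) j ∧ FirstArr c j n := by
  by_cases hf : Free c (Set.Ioi a) (a + 1)
  · exact ⟨fun h => (hf.noArr hc hv _ h.1).elim, fun ⟨j, hj, _⟩ => (hf j hj).elim⟩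
  · unfold Free at hf
    push Not at hf
    obtain ⟨j, hj⟩ := hf
    have key : FirstArr c a n ↔ FirstArr c j n := by
      unfold FirstArr
      simp only [hj.arr_iff hc hv]
    rw [key]
    exact ⟨fun h => ⟨j, hj, h⟩, fun ⟨j', hj', h⟩ => by rwa [hj.unique hc hj']⟩

lemma Mate.noArr_iff (hc : c.Good) (h : Mate c (Set.Ioi a) (a + 1) j) (hv : c.vel (a + 1) ≠ -1) :
    NoArr c a ↔ NoArr c j := by
  unfold NoArr
  simp only [h.arr_iff hc hv]

/-- A static particle annihilates with the first particle that reaches it. -/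
lemma mate_static_iff (hc : c.Good) (hI : StartsAfter I a) (hv : c.vel (a + 1) = 0) (hk : k ∈ I) :
    Mate c I (a + 1) k ↔ FirstArr c (a + 1) k := by
  have hmate : ∀ j, Mate c I (a + 1) j → FirstArr c (a + 1) j := by
    intro j hj
    have hjI := hj.mem_right hc
    have haI := hj.mem hc
    obtain ⟨t, ht⟩ := hj.meet hc
    have haj : a + 1 < j := lt_of_le_of_ne (hI.le j hjI) ht.1
    have hvj : c.vel j = -1 := by
      have := ht.vel_lt hc haj
      have := hc.vel j
      omega
    -- Removing the static particle only affects its partner `j`, and only after `j` has already met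
    -- virtually all the particles in between that it can meet.
    have hr : ∀ x y, Mate c (Set.Ioc (a + 1) j) x y ↔
        x ∈ Set.Ioc (a + 1) j ∧ y ∈ Set.Ioc (a + 1) j ∧ Mate c I x y := by
      intro x y
      refine mate_restrict hc (fun x hx => (hI j hjI).2 ⟨by have := hx.1; omega, hx.2⟩) ?_
      intro u hu w hw huw r hr v hvI s hs
      have hwI := huw.mem_right hc
      have hwj : w ≤ j := by
        by_contra hlt
        exact hj.not_mate_across hc hI.le hu.2 (not_le.1 hlt) huw
      have hwa : w = a + 1 := by
        have := hI.le w hwI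
        simp only [Set.mem_Ioc] at hw
        omega
      subst hwa
      obtain rfl := hj.unique hc huw.symm
      have hvj' : v < j := lt_of_le_of_ne hvI.2 hs.1.symm
      have p1 := hc.mono hvI.1
      have p2 := hc.mono hvj'
      have e1 := hr.pos_eq hvj hv
      have e2 := hs.pos_eq hvj rfl
      have := hs.symm.vel_lt hc hvj'
      rcases hc.vel v with e | e | e
      · omega
      all_goals rw [e] at e2; push_cast at e1 e2; linarith
    refine ⟨⟨haj, hvj, fun x hx => ?_⟩, fun k hk => ?_⟩
    · have h' := (hr _ _).1 hx
      obtain rfl := hj.symm.unique hc h'.2.2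
      exact lt_irrefl _ h'.2.1.1
    · by_contra hlt
      have hkj : k < j := not_le.1 hlt
      have hkI : k ∈ I := (hI j hjI).2 ⟨by have := hk.1; omega, hkj.le⟩
      have hf := ((arr_iff_Ioc hc hk.1 hkj.le).1 hk).2
      have hf' : Free c I k := by
        intro x hx
        have hxI := hx.mem_right hc
        by_cases hxj : x ≤ j
        · by_cases hxa : x = a + 1
          · subst hxa
            have := hj.unique hc hx.symm
            omega
          · have := hI.le x hxI
            exact hf x ((hr _ _).2 ⟨⟨hk.1, hkj.le⟩, ⟨by omega, hxj⟩, hx⟩)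
        · exact hj.not_mate_across hc hI.le hkj.le (not_le.1 hxj) hx
      obtain ⟨s, hs⟩ := exists_meet hc hk.1 (by have := hk.2.1; omega : c.vel k < c.vel (a + 1))
      refine not_cross hc haI hkI hs (hj.after hc ht ?_) hf'.after
      have e1 := hs.pos_eq hv hk.2.1
      have e2 := ht.pos_eq hv hvj
      have p := hc.mono hkj
      push_cast at e1 e2
      linarith
  refine ⟨hmate k, fun h => ?_⟩
  have haI : a + 1 ∈ I := (hI k hk).2 ⟨by omega, hI.le k hk⟩
  -- An arrival at a static particle forces the latter to be annihilated, and its partner is then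
  -- the first arrival by the implication already proved.
  by_cases hf : Free c I (a + 1)
  · exfalso
    have hf1 := ((hI.inter_Ioi (by omega : a ≤ a + 1)).arr_iff hc ⟨hk, h.1.1⟩).1 h.1
    refine hf.not_free hc haI (by omega) hk h.1.1 h.1.2.1 ?_
    refine (free_restrict_of_closed hc Set.inter_subset_left ?_ ⟨hk, h.1.1⟩).1 hf1.2
    intro u hu w hw h'
    have hwI := h'.mem_right hc
    have : w = a + 1 := by
      have := hI.le w hwI
      by_contra hne
      exact hw ⟨hwI, lt_of_le_of_ne this (Ne.symm hne)⟩
    subst this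
    exact hf u h'.symm
  · unfold Free at hf
    push Not at hf
    obtain ⟨j, hj⟩ := hf
    rwa [h.unique (hmate j hj)]

/-- The annihilation of two moving particles only depends on the particles between them. -/
lemma mate_right_left_iff (hc : c.Good) (hI : StartsAfter I a) (hv : c.vel (a + 1) = 1)
    (hj : j ∈ I) (hvj : c.vel j = -1) :
    Mate c I (a + 1) j ↔ Mate c (Set.Ioc a j) (a + 1) j := by
  refine ⟨fun h => (mate_inter_Iic hc hI h (hI.le j hj) le_rfl).2 h, fun h => ?_⟩
  have haj : a + 1 < j := lt_of_le_of_ne (hI.le j hj) (by rintro rfl; omega)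
  -- Conversely, the annihilation in the window persists if the window does not interact with its
  -- right: a particle of the window that would meet `w > j` is removed earlier, inside the window.
  have hU : I = Set.Ioc a j ∪ (I ∩ Set.Ioi j) := by
    rw [← hI.inter_Iic hj, ← Set.inter_union_distrib_left, Set.Iic_union_Ioi, Set.inter_univ]
  rw [hU, mate_union hc (fun i h h' => (not_lt.2 h.2 : ¬ j < i) h'.2)]
  · exact Or.inl h
  intro u hu w hw r hr
  left
  have hjw : j < w := hw.2
  obtain ⟨t, ht⟩ := h.meet hc
  have et := ht.pos_eq hv hvj
  have vuw := hr.vel_lt hc (hu.2.trans_lt hjw)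
  have hvu := hc.vel u
  have hvw := hc.vel w
  have huj : u < j := lt_of_le_of_ne hu.2 (by rintro rfl; omega)
  have p1 := hc.mono hjw
  have p2 := hc.mono huj
  have er := hr.pos_eq rfl rfl
  push_cast at et
  rcases eq_or_lt_of_le (by have := hu.1; omega : a + 1 ≤ u) with rfl | hau
  · refine ⟨j, t, h, ht, Or.inl ?_⟩
    rw [hv] at er
    rcases hvw with e | e | e <;> rw [e] at er <;> push_cast at er <;> linarith
  have p3 := hc.mono hau
  -- `u` is removed if it meets a particle of the pair in time
  have R : ∀ b ∈ Set.Ioc a j, ∀ s h' t', Meet c u b s → Mate c (Set.Ioc a j) b h' →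
      Meet c b h' t' → u ≠ h' → s < r → s ≤ t' → (s < t' ∨ ¬ Spares c b h' u) →
      Removed c (Mate c (Set.Ioc a j)) u w r := by
    intro b hb s h' t' hs hb' ht' hne hsr hst hsp
    rcases Mate.complete hc hu hb hs with q | q | ⟨x, y, q1, q2, q3⟩
    · exact (hne (hb'.unique hc q.symm).symm).elim
    · exact q.le hsr
    · exfalso
      obtain rfl := hb'.unique hc q1
      obtain rfl := ht'.time_unique hc q2
      rcases q3 with q3 | ⟨rfl, q3⟩
      · linarith
      · rcases hsp with hsp | hsp
        · exact lt_irrefl _ hsp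
        · exact hsp q3
  have haI : a + 1 ∈ Set.Ioc a j := ⟨by omega, haj.le⟩
  have hjI : j ∈ Set.Ioc a j := ⟨by omega, le_rfl⟩
  obtain ⟨s, hs⟩ := exists_meet hc huj (by omega)
  have es := hs.pos_eq rfl hvj
  have hsr : s < r := by
    rcases hvu with e | e | e <;> rw [e] at es er <;> rcases hvw with e' | e' | e' <;>
      rw [e'] at er <;> push_cast at es er <;> linarith
  rcases hvu with e | e | e
  · omega
  · rw [e] at es er
    have e' : c.vel w = -1 := by omega
    rw [e'] at er
    obtain ⟨s', hs'⟩ := exists_meet hc hau (by omega)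
    have es' := hs'.pos_eq hv e
    push_cast at es er es'
    rcases le_or_gt s t with hst | hst
    · refine R j hjI s (a + 1) t hs h.symm ht.symm hau.ne' hsr hst (Or.inr ?_)
      unfold Spares
      omega
    · refine R (a + 1) haI s' j t hs'.symm h ht huj.ne ?_ ?_ (Or.inl ?_) <;> linarith
  · rw [e] at es
    push_cast at es
    refine R j hjI s (a + 1) t hs h.symm ht.symm hau.ne' hsr ?_ (Or.inl ?_) <;> linarith

/-- The annihilation of a right-moving particle with a static one: it has to happen in the absence
of the particles on the right, and before another one reaches the static particle. -/
lemma mate_right_static_iff (hc : c.Good) (hI : StartsAfter I a) (hv : c.vel (a + 1) = 1)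
    (hj : j ∈ I) (hvj : c.vel j = 0) :
    Mate c I (a + 1) j ↔ Mate c (Set.Ioc a j) (a + 1) j ∧
      ∀ k ∈ I, Arr c j k → c.pos j - c.pos (a + 1) < c.pos k - c.pos j ∨
        (c.pos j - c.pos (a + 1) = c.pos k - c.pos j ∧ c.spin j = -1) := by
  have haj : a + 1 < j := lt_of_le_of_ne (hI.le j hj) (by rintro rfl; omega)
  constructor
  · intro h
    refine ⟨(mate_inter_Iic hc hI h (hI.le j hj) le_rfl).2 h, fun k hk harr => ?_⟩
    have hjk := harr.1
    have hf := ((hI.inter_Ioi (by omega : a ≤ j)).arr_iff hc ⟨hk, hjk⟩).1 harr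
    rw [free_inter_Ioi hc hI h hjk hk] at hf
    obtain ⟨t, ht⟩ := h.meet hc
    have et := ht.pos_eq hv hvj
    obtain ⟨s, hs⟩ := exists_meet hc hjk (by omega)
    have es := hs.pos_eq hvj hf.1
    push_cast at et es
    by_contra! hcon
    refine not_cross_of_tie hc hj hk hs ?_
      (fun x y q1 q2 => Or.inl (hf.2.after x y q1 q2))
    intro x y q1 q2
    obtain rfl := h.symm.unique hc q1
    obtain rfl := ht.symm.time_unique hc q2
    rcases lt_or_eq_of_le (by linarith [hcon.1] : s ≤ t) with hst | hst
    · exact Or.inl hst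
    · right
      refine ⟨by omega, ?_, hst⟩
      have := hcon.2 (by linarith)
      unfold Spares
      omega
  rintro ⟨h, hcond⟩
  have hU : I = Set.Ioc a j ∪ (I ∩ Set.Ioi j) := by
    rw [← hI.inter_Iic hj, ← Set.inter_union_distrib_left, Set.Iic_union_Ioi, Set.inter_univ]
  rw [hU, mate_union hc (fun i h h' => (not_lt.2 h.2 : ¬ j < i) h'.2)]
  · exact Or.inl h
  obtain ⟨t, ht⟩ := h.meet hc
  have et := ht.pos_eq hv hvj
  push_cast at et
  have haI : a + 1 ∈ Set.Ioc a j := ⟨by omega, haj.le⟩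
  have hjI : j ∈ Set.Ioc a j := ⟨by omega, le_rfl⟩
  -- the particles between the two are removed in time
  have early : ∀ u ∈ Set.Ioc a j, u ≠ j → c.vel u ≠ -1 → ∀ w r, t < r →
      Removed c (Mate c (Set.Ioc a j)) u w r := by
    intro u hu huj hvu w r hr
    rcases eq_or_lt_of_le (by have := hu.1; omega : a + 1 ≤ u) with rfl | hau
    · exact ⟨j, t, h, ht, Or.inl hr⟩
    have huj' : u < j := lt_of_le_of_ne hu.2 huj
    have p2 := hc.mono huj'
    have p3 := hc.mono hau
    have hvu' : c.vel u = 0 ∨ c.vel u = 1 := by have := hc.vel u; omega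
    rcases hvu' with e | e
    · obtain ⟨s, hs⟩ := exists_meet hc hau (by omega)
      have es := hs.pos_eq hv e
      push_cast at es
      rcases Mate.complete hc hu haI hs.symm with q | q | ⟨x, y, q1, q2, q3⟩
      · exact (huj (h.unique hc q.symm).symm).elim
      · exact q.le (by linarith)
      · exfalso
        have := h.after hc ht (by linarith : s < t) x y q1 q2
        rcases q3 with q3 | ⟨q3, -⟩ <;> linarith
    · obtain ⟨s, hs⟩ := exists_meet hc huj' (by omega)
      have es := hs.pos_eq e hvj
      push_cast at es
      rcases Mate.complete hc hu hjI hs with q | q | ⟨x, y, q1, q2, q3⟩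
      · exact (hau.ne (h.symm.unique hc q.symm)).elim
      · exact q.le (by linarith)
      · exfalso
        have := h.symm.after hc ht.symm (by linarith : s < t) x y q1 q2
        rcases q3 with q3 | ⟨q3, -⟩ <;> linarith
  intro u hu w hw r hr
  have hjw : j < w := hw.2
  have p1 := hc.mono hjw
  have vuw := hr.vel_lt hc (hu.2.trans_lt hjw)
  have hvw := hc.vel w
  have hvu := hc.vel u
  have er := hr.pos_eq rfl rfl
  have hI' := hI.inter_Ioi (by omega : a ≤ j)
  -- right-moving particles that pass `j`
  have passing : c.vel u = 1 → c.pos j < c.pos u + r → Removed c (Mate c (Set.Ioc a j)) u w r := by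
    intro e hpos
    have huj' : u < j := lt_of_le_of_ne hu.2 (by rintro rfl; omega)
    obtain ⟨s, hs⟩ := exists_meet hc huj' (by omega)
    have es := hs.pos_eq e hvj
    push_cast at es
    rcases eq_or_lt_of_le (by have := hu.1; omega : a + 1 ≤ u) with rfl | hau
    · exact ⟨j, t, h, ht, Or.inl (by linarith)⟩
    have p3 := hc.mono hau
    rcases Mate.complete hc hu hjI hs with q | q | ⟨x, y, q1, q2, q3⟩
    · exact (hau.ne (h.symm.unique hc q.symm)).elim
    · exact q.le (by linarith)
    · exfalso
      have := h.symm.after hc ht.symm (by linarith : s < t) x y q1 q2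
      rcases q3 with q3 | ⟨q3, -⟩ <;> linarith
  have hvw' : c.vel w = -1 ∨ c.vel w = 0 := by omega
  rcases hvw' with e' | e'
  swap
  · left
    have e : c.vel u = 1 := by omega
    refine passing e ?_
    rw [e, e'] at er
    push_cast at er
    linarith
  by_cases hpass : c.vel u = 1 ∧ c.pos j < c.pos u + r
  · exact Or.inl (passing hpass.1 hpass.2)
  -- the meeting takes place on the left of `j`
  have hleft : c.pos w - c.pos j ≤ r := by
    rw [e'] at er
    push_cast at er
    by_cases e : c.vel u = 1
    · have : ¬ c.pos j < c.pos u + r := fun h' => hpass ⟨e, h'⟩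
      rw [e] at er
      push_cast at er
      linarith
    · have e0 : c.vel u = 0 := by omega
      rw [e0] at er
      have := hc.mono.monotone hu.2
      push_cast at er
      linarith
  -- By time `r` the left-moving `w` has had time to reach `j`. If it survives on the right of `j`,
  -- it is an arrival and `hcond` makes it late for the race; otherwise its partner there removes it
  -- in time.
  by_cases hf : Free c (I ∩ Set.Ioi j) w
  · left
    have harr : Arr c j w := (hI'.arr_iff hc hw).2 ⟨e', hf⟩
    have hcw := hcond w hw.1 harr
    have hjr : u = j → c.pos w - c.pos j = r := by
      rintro rfl
      rw [hvj, e'] at er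
      push_cast at er
      linarith
    rcases eq_or_lt_of_le (by rcases hcw with q | ⟨q, -⟩ <;> linarith : t ≤ r) with htr | htr
    · have hq : c.spin j = -1 := by
        rcases hcw with q | q
        · linarith
        · exact q.2
      have hsp : Spares c (a + 1) j w := by
        unfold Spares
        omega
      -- a triple collision
      have hwr : c.pos w - c.pos j = r := by
        rcases hcw with q | ⟨q, -⟩ <;> linarith
      subst htr
      have hloc : c.loc u t = c.loc j t := by
        rw [hr.2.2]
        unfold Config.loc
        rw [e', hvj]
        push_cast
        linarith
      by_cases huj : u = j
      · subst huj
        exact ⟨a + 1, t, h.symm, ht.symm, Or.inr ⟨rfl, hsp.symm⟩⟩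
      · have hua : u = a + 1 := by
          have hjw' : Meet c j w t := ⟨hjw.ne, ht.2.1, hloc.symm.trans hr.2.2⟩
          rcases eq_of_quadruple hc ht.symm hjw' (by omega : a + 1 ≠ w) hloc with q | q | q
          · exact (huj q).elim
          · exact q
          · exact (hr.1 q).elim
        subst hua
        exact ⟨j, t, h, ht, Or.inr ⟨rfl, hsp⟩⟩
    · by_cases huj : u = j
      · subst huj
        exact ⟨a + 1, t, h.symm, ht.symm, Or.inl htr⟩
      · exact early u hu huj (by omega) w r htr
  · right
    unfold Free at hf
    push Not at hf
    obtain ⟨x, hx⟩ := hf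
    obtain ⟨y, hy⟩ := hx.meet hc
    refine ⟨x, y, hx, hy, Or.inl ?_⟩
    have hjx : j < x := (hx.mem_right hc).2
    have p4 := hc.mono hjx
    have hxw : x < w := by
      by_contra hle
      have := hy.vel_lt hc (lt_of_le_of_ne (not_lt.1 hle) hy.1)
      have := hc.vel x
      omega
    have := hy.symm.vel_lt hc hxw
    have ey := hy.pos_eq e' rfl
    have y0 := hy.2.1
    rcases hc.vel x with q | q | q <;> rw [q] at ey <;> push_cast at ey <;> linarith

end BallisticAnnihilation

/-! ### Symmetries, locality, and survival of a static particle -/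

namespace BallisticAnnihilation
variable {c c' : Config} {I I' I₁ I₂ : Set ℤ} {i j k g h u w n a : ℤ} {s t : ℝ}

/-- Annihilations are transported by maps of indices that preserve meetings and spins. -/
theorem mate_transport (hc : c.Good) (hc' : c'.Good) (e : ℤ ≃ ℤ)
    (hm : ∀ i j t, Meet c' i j t ↔ Meet c (e i) (e j) t)
    (hs : ∀ i j k, Spares c' i j k ↔ Spares c (e i) (e j) (e k)) :
    Mate c' (e ⁻¹' I) i j ↔ Mate c I (e i) (e j) := by
  have hM := isMatching_mate hc I
  refine IsMatching.mate_iff hc' (M := fun i j => Mate c I (e i) (e j))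
    ⟨fun i j h => hM.symm _ _ h, fun i j h => hM.mem _ _ h, fun i j h => ?_,
      fun i j k h h' => e.injective (hM.unique _ _ _ h h'), ?_⟩
  · obtain ⟨t, ht⟩ := hM.meet _ _ h
    exact ⟨t, (hm _ _ _).2 ht⟩
  · have aux : ∀ i k t, Removed c (Mate c I) (e i) (e k) t →
        Removed c' (fun i j => Mate c I (e i) (e j)) i k t := by
      rintro i k t ⟨h, s, h1, h2, h3⟩
      obtain ⟨h, rfl⟩ := e.surjective h
      exact ⟨h, s, h1, (hm _ _ _).2 h2, h3.imp id (And.imp id (hs _ _ _).2)⟩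
    intro i hi k hk t h
    exact (hM.complete _ hi _ hk t ((hm _ _ _).1 h)).imp id (Or.imp (aux _ _ _) (aux _ _ _))

/-- The configuration seen from particle `a`. -/
def Config.shift (c : Config) (a : ℤ) : Config where
  pos n := c.pos (n + a) - c.pos a
  vel n := c.vel (n + a)
  spin n := c.spin (n + a)

/-- The reflected configuration. -/
def Config.refl (c : Config) : Config where
  pos n := -c.pos (-n)
  vel n := -c.vel (-n)
  spin n := -c.spin (-n)

lemma Config.Good.shift (hc : c.Good) (a : ℤ) : (c.shift a).Good where
  mono i j h := by
    have := hc.mono (by omega : i + a < j + a)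
    simp only [Config.shift]
    linarith
  vel i := hc.vel _
  spin i := hc.spin _
  fin r := by
    refine ((hc.fin_near (c.pos a) r).preimage (f := fun k => k + a) ?_).subset ?_
    · exact (add_left_injective a).injOn
    · exact fun k hk => hk

lemma Config.Good.refl (hc : c.Good) : c.refl.Good where
  mono i j h := by
    have := hc.mono (by omega : -j < -i)
    simp only [Config.refl]
    linarith
  vel i := by
    have := hc.vel (-i)
    simp only [Config.refl]
    omega
  spin i := by
    have := hc.spin (-i)
    simp only [Config.refl]
    omega
  fin r := by
    refine ((hc.fin r).preimage (f := fun k => -k) neg_injective.injOn).subset ?_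
    intro k hk
    simpa [Config.refl] using hk

lemma mate_shift (hc : c.Good) (a : ℤ) :
    Mate (c.shift a) ((· + a) ⁻¹' I) i j ↔ Mate c I (i + a) (j + a) := by
  refine mate_transport hc (hc.shift a) (Equiv.addRight a) ?_ ?_
  · intro i j t
    simp only [Meet, Config.loc, Config.shift, Equiv.coe_addRight, ne_eq, add_left_inj]
    refine and_congr_right fun _ => and_congr_right fun _ => ?_
    constructor <;> intro h <;> linarith
  · intro i j k
    simp only [Spares, Config.shift, Equiv.coe_addRight]

/-- Spins are negated together with velocities, so the equality of a spin with a velocity, which is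
all that `Spares` asks of spins, is preserved. -/
lemma mate_refl (hc : c.Good) :
    Mate c.refl ((fun n => -n) ⁻¹' I) i j ↔ Mate c I (-i) (-j) := by
  refine mate_transport hc hc.refl (Equiv.neg ℤ) ?_ ?_
  · intro i j t
    simp only [Meet, Config.loc, Config.refl, Equiv.neg_apply, ne_eq, neg_inj]
    refine and_congr_right fun _ => and_congr_right fun _ => ?_
    push_cast
    constructor <;> intro h <;> linarith
  · intro i j k
    simp only [Spares, Config.refl, Equiv.neg_apply, neg_inj, neg_eq_zero]

lemma arr_shift (hc : c.Good) (a : ℤ) : Arr (c.shift a) k n ↔ Arr c (k + a) (n + a) := by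
  have h1 : ((· + a) ⁻¹' Set.Ioc (k + a) (n + a)) = Set.Ioc k n := by
    ext x
    simp
  unfold Arr Free
  refine and_congr (by omega) (and_congr Iff.rfl ?_)
  constructor
  · intro h j hj
    refine h (j - a) ?_
    rw [← h1, mate_shift hc]
    simpa using hj
  · intro h j hj
    refine h (j + a) ?_
    rwa [← h1, mate_shift hc] at hj

lemma firstArr_shift (hc : c.Good) (a : ℤ) :
    FirstArr (c.shift a) k n ↔ FirstArr c (k + a) (n + a) := by
  unfold FirstArr
  rw [arr_shift hc]
  refine and_congr Iff.rfl ⟨fun h m hm => ?_, fun h m hm => ?_⟩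
  · have := h (m - a) (by rw [arr_shift hc]; simpa using hm)
    omega
  · have := h (m + a) ((arr_shift hc a).1 hm)
    omega

/-- The annihilations in a system only depend on the particles in this system. -/
lemma annihilates_congr (hp : ∀ i ∈ I, ∀ j ∈ I, c.pos j - c.pos i = c'.pos j - c'.pos i)
    (hv : ∀ i ∈ I, c.vel i = c'.vel i) (hs : ∀ i ∈ I, c.spin i = c'.spin i) :
    Annihilates c I i j ↔ Annihilates c' I i j := by
  have ht : ∀ i ∈ I, ∀ j ∈ I, collTime c i j = collTime c' i j := by
    intro i hi j hj
    unfold collTime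
    rw [hp i hi j hj, hv i hi, hv j hj]
  have key : ∀ n, ∀ i j, annihilatesUpTo c I n i j ↔ annihilatesUpTo c' I n i j := by
    intro n
    induction n with
    | zero => exact fun _ _ => Iff.rfl
    | succ n ih =>
      intro i j
      have e : annihilatesUpTo c I n = annihilatesUpTo c' I n := by
        ext a b; exact ih a b
      change CollisionRule c I _ i j ↔ CollisionRule c' I _ i j
      rw [e]
      unfold CollisionRule
      refine and_congr_right fun hi => and_congr_right fun hj => and_congr_right fun _ => ?_
      have hr : ∀ k ∈ I, RemovedBefore c I (annihilatesUpTo c' I n) i j k ↔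
          RemovedBefore c' I (annihilatesUpTo c' I n) i j k := by
        intro k hk
        unfold RemovedBefore hitTime
        refine exists_congr fun k' => and_congr_right fun hk' => ?_
        rw [ht k hk k' hk', ht i hi k hk, ht j hj k hk]
      have hh : ∀ k ∈ I, hitTime c i j k = hitTime c' i j k := by
        intro k hk
        unfold hitTime
        rw [ht i hi k hk, ht j hj k hk]
      rw [ht i hi j hj]
      refine and_congr_right fun _ => or_congr ?_ (and_congr ?_ ?_)
      · refine forall_congr' fun k => forall_congr' fun hk => ?_
        rw [hh k hk, hr k hk]
      · refine exists_congr fun k => and_congr_right fun hk => ?_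
        rw [ht i hi k hk, ht j hj k hk, hv i hi, hv j hj, hv k hk, hs i hi, hs j hj]
      · refine forall_congr' fun k => forall_congr' fun hk => ?_
        rw [hh k hk, hr k hk]
  exact exists_congr fun n => key n i j

/-- The configurations `c` and `c'` coincide on `I`, up to a translation. -/
structure SameOn (c c' : Config) (I : Set ℤ) : Prop where
  pos : ∀ i ∈ I, ∀ j ∈ I, c.pos j - c.pos i = c'.pos j - c'.pos i
  vel : ∀ i ∈ I, c.vel i = c'.vel i
  spin : ∀ i ∈ I, c.spin i = c'.spin i

lemma SameOn.mono (h : SameOn c c' I) (hI : I' ⊆ I) : SameOn c c' I' :=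
  ⟨fun i hi j hj => h.pos i (hI hi) j (hI hj), fun i hi => h.vel i (hI hi),
    fun i hi => h.spin i (hI hi)⟩

lemma SameOn.mate (h : SameOn c c' I) : Mate c I i j ↔ Mate c' I i j :=
  or_congr (annihilates_congr h.pos h.vel h.spin) (annihilates_congr h.pos h.vel h.spin)

lemma SameOn.arr (h : SameOn c c' (Set.Ioc a k)) : Arr c a k ↔ Arr c' a k := by
  unfold Arr Free
  refine and_congr_right fun hak => ?_
  rw [h.vel k ⟨hak, le_rfl⟩]
  simp only [h.mate]

/-- Minimality only has to be checked on candidates below `n`, so the event depends on a finite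
window although its definition ranges over all particles. -/
lemma SameOn.firstArr (h : SameOn c c' (Set.Ioc a n)) : FirstArr c a n ↔ FirstArr c' a n := by
  unfold FirstArr
  rw [h.arr]
  refine and_congr_right fun _ => forall_congr' fun k => ?_
  by_cases hk : n ≤ k
  · simp [hk]
  · rw [(h.mono (Set.Ioc_subset_Ioc_right (not_le.1 hk).le)).arr]

lemma SameOn.noArr (h : SameOn c c' (Set.Ioi a)) : NoArr c a ↔ NoArr c' a := by
  unfold NoArr
  refine forall_congr' fun k => ?_
  rw [(h.mono Set.Ioc_subset_Ioi_self).arr]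

lemma noArr_iff_Ioi (hc : c.Good) : NoArr c a ↔ ∀ k > a, c.vel k = -1 → ¬ Free c (Set.Ioi a) k := by
  unfold NoArr
  refine forall_congr' fun k => ?_
  by_cases hk : a < k
  · rw [arr_iff_Ioi hc hk]
    simp [hk]
  · simp [hk, Arr]

lemma noArr_refl_iff (hc : c.Good) :
    NoArr c.refl 0 ↔ ∀ k < 0, c.vel k = 1 → ¬ Free c (Set.Iio 0) k := by
  rw [noArr_iff_Ioi hc.refl]
  have h1 : ((fun n : ℤ => -n) ⁻¹' Set.Iio 0) = Set.Ioi 0 := by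
    ext x
    simp
  have h2 : ∀ k, Free c.refl (Set.Ioi 0) k ↔ Free c (Set.Iio 0) (-k) := by
    intro k
    unfold Free
    constructor
    · intro h j hj
      refine h (-j) ?_
      rw [← h1, mate_refl hc]
      simpa using hj
    · intro h j hj
      rw [← h1, mate_refl hc] at hj
      exact h _ hj
  constructor
  · intro h k hk hv hf
    refine h (-k) (by simpa using hk) (by simp [Config.refl, hv]) ?_
    rw [h2]; simpa using hf
  · intro h k hk hv hf
    refine h (-k) (by simpa using hk) ?_ ((h2 k).1 hf)
    simp only [Config.refl] at hv
    omega

lemma staticSurvivor_iff_free : StaticSurvivor c ↔ c.vel 0 = 0 ∧ Free c Set.univ 0 := by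
  unfold StaticSurvivor Free Mate
  simp only [not_or]

/-- Nothing happens across a static particle that survives. -/
lemma Free.not_mate_across_static (hc : c.Good) (hv : c.vel 0 = 0) (hf : Free c Set.univ 0)
    (hu : u ≤ 0) (hw : 0 ≤ w) : ¬ Mate c Set.univ u w := by
  intro h
  have hu' : u < 0 := lt_of_le_of_ne hu (by rintro rfl; exact hf w h)
  have hw' : 0 < w := lt_of_le_of_ne hw (by rintro rfl; exact hf u h.symm)
  obtain ⟨t, ht⟩ := h.meet hc
  have v := ht.vel_lt hc (hu'.trans hw')
  have vu := hc.vel u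
  have vw := hc.vel w
  have p1 := hc.mono hu'
  have p2 := hc.mono hw'
  have et := ht.pos_eq rfl rfl
  have U : ∀ s, Meet c u 0 s → s < t → False := fun s hs hst =>
    not_cross hc (Set.mem_univ _) (Set.mem_univ _) hs (h.after hc ht hst) hf.after
  have W : ∀ s, Meet c 0 w s → s < t → False := fun s hs hst =>
    not_cross hc (Set.mem_univ _) (Set.mem_univ _) hs hf.after (h.symm.after hc ht.symm hst)
  by_cases e : c.vel u = 1
  · obtain ⟨s, hs⟩ := exists_meet hc hu' (by omega)
    have es := hs.pos_eq e hv
    by_cases e' : c.vel w = -1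
    · obtain ⟨s', hs'⟩ := exists_meet hc hw' (by omega)
      have es' := hs'.pos_eq hv e'
      rw [e, e'] at et
      push_cast at es es' et
      rcases lt_trichotomy s t with q | q | q
      · exact U s hs q
      · subst q
        refine not_cross_of_tie hc (Set.mem_univ _) (Set.mem_univ _) hs ?_
          (fun h r a b => Or.inl (hf.after h r a b))
        intro x y q1 q2
        right
        obtain rfl := h.unique hc q1
        refine ⟨hw'.ne', ?_, ht.time_unique hc q2⟩
        unfold Spares
        omega
      · exact W s' hs' (by linarith)
    · have e0 : c.vel w = 0 := by omega
      refine U s hs ?_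
      rw [e, e0] at et
      push_cast at es et
      linarith
  · have e0 : c.vel u = 0 := by omega
    have e' : c.vel w = -1 := by omega
    obtain ⟨s', hs'⟩ := exists_meet hc hw' (by omega)
    have es' := hs'.pos_eq hv e'
    refine W s' hs' ?_
    rw [e0, e'] at et
    push_cast at es' et
    linarith

lemma StaticSurvivor.mate_Ioi (hc : c.Good) (hS : StaticSurvivor c) (hi : 0 < i) :
    Mate c Set.univ i j ↔ Mate c (Set.Ioi 0) i j := by
  obtain ⟨hv, hf⟩ := staticSurvivor_iff_free.1 hS
  have H : ∀ u ∈ Set.Ioi (0 : ℤ), ∀ w, w ∉ Set.Ioi (0 : ℤ) → ¬ Mate c Set.univ u w :=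
    fun u hu w hw h => hf.not_mate_across_static hc hv (not_lt.1 hw) (le_of_lt hu) h.symm
  rw [mate_restrict_of_closed hc (Set.subset_univ _) H]
  refine ⟨fun h => ⟨hi, ?_, h⟩, fun h => h.2.2⟩
  by_contra hj
  exact H i hi j hj h

/-- The static particle `0` survives if and only if no particle reaches it from either side. -/
theorem staticSurvivor_iff (hc : c.Good) :
    StaticSurvivor c ↔ c.vel 0 = 0 ∧ NoArr c 0 ∧ NoArr c.refl 0 := by
  rw [noArr_iff_Ioi hc, noArr_refl_iff hc]
  constructor
  · intro hS
    obtain ⟨hv, hf⟩ := staticSurvivor_iff_free.1 hS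
    refine ⟨hv, fun k hk hvk hfk => ?_, fun k hk hvk hfk => ?_⟩
    · have hf' : Free c Set.univ k := fun j hj => hfk j ((hS.mate_Ioi hc hk).1 hj)
      obtain ⟨s, hs⟩ := exists_meet hc hk (by omega)
      exact not_cross hc (Set.mem_univ _) (Set.mem_univ _) hs hf.after hf'.after
    · have hf' : Free c Set.univ k := by
        refine (free_restrict_of_closed (I' := Set.Iio 0) hc (Set.subset_univ _) ?_ hk).1 hfk
        intro u hu w hw h
        exact hf.not_mate_across_static hc hv (le_of_lt hu) (not_lt.1 hw) h
      obtain ⟨s, hs⟩ := exists_meet hc hk (by omega)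
      exact not_cross hc (Set.mem_univ _) (Set.mem_univ _) hs hf'.after hf.after
  · rintro ⟨hv, hR, hL⟩
    rw [staticSurvivor_iff_free]
    refine ⟨hv, ?_⟩
    -- moving particles are removed before they reach `0`
    have remR : ∀ w > 0, c.vel w = -1 → ∀ u r, c.pos w - c.pos 0 ≤ r →
        Removed c (Mate c (Set.Ioi 0)) w u r := by
      intro w hw hvw u r hr
      have := hR w hw hvw
      unfold Free at this
      push Not at this
      obtain ⟨h, hh⟩ := this
      obtain ⟨t, ht⟩ := hh.meet hc
      refine ⟨h, t, hh, ht, Or.inl ?_⟩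
      have hpos : 0 < h := hh.mem_right hc
      have hlt : h < w := by
        by_contra hle
        have := ht.vel_lt hc (lt_of_le_of_ne (not_lt.1 hle) ht.1)
        have := hc.vel h
        omega
      have p := hc.mono hpos
      have := ht.symm.vel_lt hc hlt
      have et := ht.pos_eq hvw rfl
      have t0 := ht.2.1
      rcases hc.vel h with q | q | q <;> rw [q] at et <;> push_cast at et <;> linarith
    have remL : ∀ u < 0, c.vel u = 1 → ∀ w r, c.pos 0 - c.pos u ≤ r →
        Removed c (Mate c (Set.Iio 0)) u w r := by
      intro u hu hvu w r hr
      have := hL u hu hvu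
      unfold Free at this
      push Not at this
      obtain ⟨h, hh⟩ := this
      obtain ⟨t, ht⟩ := hh.meet hc
      refine ⟨h, t, hh, ht, Or.inl ?_⟩
      have hneg : h < 0 := Set.mem_Iio.1 (hh.mem_right hc)
      have hlt : u < h := by
        by_contra hle
        have := ht.symm.vel_lt hc (lt_of_le_of_ne (not_lt.1 hle) ht.1.symm)
        have := hc.vel h
        omega
      have p := hc.mono hneg
      have := ht.vel_lt hc hlt
      have et := ht.pos_eq hvu rfl
      have t0 := ht.2.1
      rcases hc.vel h with q | q | q <;> rw [q] at et <;> push_cast at et <;> linarith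
    -- The half-lines do not interact without particle `0`: when two particles from opposite sides
    -- meet, one of them has already reached the starting point of `0`, and it was removed within
    -- its own half-line before that.
    have hJ : ∀ x y, Mate c (Set.Iio 0 ∪ Set.Ioi 0) x y ↔
        Mate c (Set.Iio 0) x y ∨ Mate c (Set.Ioi 0) x y := by
      intro x y
      refine mate_union hc (fun i hi hi' => lt_asymm (Set.mem_Iio.1 hi) hi') ?_
      intro u hu w hw r hr
      have hu : u < 0 := hu
      have hw : 0 < w := hw
      have vuw := hr.vel_lt hc (hu.trans hw)
      have vu := hc.vel u
      have vw := hc.vel w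
      have p1 := hc.mono hu
      have p2 := hc.mono hw
      have er := hr.pos_eq rfl rfl
      by_cases e : c.vel u = 1
      · by_cases hle : c.pos 0 - c.pos u ≤ r
        · exact Or.inl (remL u hu e w r hle)
        · have e' : c.vel w = -1 := by
            by_contra hne
            have e0 : c.vel w = 0 := by omega
            rw [e, e0] at er
            push_cast at er
            linarith
          refine Or.inr (remR w hw e' u r ?_)
          rw [e, e'] at er
          push_cast at er
          linarith
      · have e0 : c.vel u = 0 := by omega
        have e' : c.vel w = -1 := by omega
        refine Or.inr (remR w hw e' u r ?_)
        rw [e0, e'] at er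
        push_cast at er
        linarith
    have hU : (Set.univ : Set ℤ) = {0} ∪ (Set.Iio 0 ∪ Set.Ioi 0) := by
      ext x
      simp only [Set.mem_univ, Set.mem_union, Set.mem_singleton_iff, Set.mem_Iio, Set.mem_Ioi,
        true_iff]
      omega
    intro j hj
    rw [hU, mate_union hc] at hj
    · rcases hj with hj | hj
      · have := hj.mem_right hc
        obtain ⟨t, ht⟩ := hj.meet hc
        exact ht.1 this.symm
      · have := hj.mem hc
        simp at this
    · intro i hi
      simp only [Set.mem_singleton_iff] at hi
      subst hi
      simp
    · intro u hu w hw r hr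
      simp only [Set.mem_singleton_iff] at hu
      subst hu
      right
      rcases hw with hw | hw
      · have hw : w < 0 := hw
        have := hr.symm.vel_lt hc hw
        have := hc.vel w
        have e : c.vel w = 1 := by omega
        have er := hr.symm.pos_eq e hv
        push_cast at er
        exact (remL w hw e 0 r (by linarith)).mono fun i j h => (hJ i j).2 (Or.inl h)
      · have hw : 0 < w := hw
        have := hr.vel_lt hc hw
        have := hc.vel w
        have e : c.vel w = -1 := by omega
        have er := hr.symm.pos_eq e hv
        push_cast at er
        exact (remR w hw e 0 r (by linarith)).mono fun i j h => (hJ i j).2 (Or.inr h)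

end BallisticAnnihilation

/-! ### Blocks of the skyline -/

namespace BallisticAnnihilation
variable {c c' : Config} {I I' I₁ I₂ : Set ℤ} {i j k g h u w a : ℤ} {s t : ℝ}

/-- The particles `a + 1, …, a + 1 + n` form the first block of the skyline on the right of `a`,
provided that no particle comes from the right of `a + 1 + n`. -/
def IsBlock (c : Config) (a : ℤ) (n : ℕ) : Shape → Prop
  | .up => n = 0 ∧ c.vel (a + 1) = 0
  | .upLeft => c.vel (a + 1) = 0 ∧ FirstArr c (a + 1) (a + 1 + n)
  | .rightUp => c.vel (a + 1) = 1 ∧ c.vel (a + 1 + n) = 0 ∧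
      Mate c (Set.Ioc a (a + 1 + n)) (a + 1) (a + 1 + n)
  | .rightLeft => c.vel (a + 1) = 1 ∧ c.vel (a + 1 + n) = -1 ∧
      Mate c (Set.Ioc a (a + 1 + n)) (a + 1) (a + 1 + n)

/-- No particle reaches `a` from the right, and the skyline on the right of `a` starts with the
given blocks. -/
def BlockChain (c : Config) : ℤ → List (ℕ × Shape) → Prop
  | a, [] => NoArr c a
  | a, b :: l => IsBlock c a b.1 b.2 ∧ BlockChain c (a + 1 + b.1) l

/-- No particle reaches `a` from the right, and the first blocks of the skyline on the right of `a`
belong to the given sets. -/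
def BlockChainIn (c : Config) : ℤ → List (Set (ℕ × Shape)) → Prop
  | a, [] => NoArr c a
  | a, s :: l => ∃ b ∈ s, IsBlock c a b.1 b.2 ∧ BlockChainIn c (a + 1 + b.1) l

lemma blockChainIn_iff (l : List (Set (ℕ × Shape))) :
    ∀ a, BlockChainIn c a l ↔ ∃ bs, List.Forall₂ (· ∈ ·) bs l ∧ BlockChain c a bs := by
  induction l with
  | nil => intro a; simp [BlockChainIn, BlockChain]
  | cons s l ih =>
    intro a
    simp only [BlockChainIn, ih]
    constructor
    · rintro ⟨b, hb, h1, bs, h2, h3⟩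
      exact ⟨b :: bs, List.Forall₂.cons hb h2, h1, h3⟩
    · rintro ⟨_, h1, h2⟩
      cases h1 with
      | cons hb h1 => exact ⟨_, hb, h2.1, _, h1, h2.2⟩

/-- The fate of the first particle of a block with nothing coming from its right. -/
lemma IsBlock.fate (hc : c.Good) {n : ℕ} {σ : Shape} (hb : IsBlock c a n σ)
    (hn : NoArr c (a + 1 + n)) :
    c.vel (a + 1) ≠ -1 ∧ ((σ = .up ∧ n = 0 ∧ Free c (Set.Ioi a) (a + 1)) ∨
      (σ ≠ .up ∧ Mate c (Set.Ioi a) (a + 1) (a + 1 + n))) := by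
  have hI := startsAfter_Ioi a
  have hm : a + 1 + n ∈ Set.Ioi a := by simp only [Set.mem_Ioi]; omega
  cases σ with
  | up =>
    obtain ⟨rfl, hv⟩ := hb
    refine ⟨by omega, Or.inl ⟨rfl, rfl, fun j hj => ?_⟩⟩
    have := (mate_static_iff hc hI hv (hj.mem_right hc)).1 hj
    exact hn j (by simpa using this.1)
  | upLeft =>
    obtain ⟨hv, hb⟩ := hb
    exact ⟨by omega, Or.inr ⟨by simp, (mate_static_iff hc hI hv hm).2 hb⟩⟩
  | rightUp =>
    obtain ⟨hv, hv', hb⟩ := hb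
    -- Without arrivals from the right of the static end, the race condition is void. This is why
    -- the blocks can be described by conditions on their own windows.
    exact ⟨by omega, Or.inr ⟨by simp, (mate_right_static_iff hc hI hv hm hv').2
      ⟨hb, fun k _ hk => (hn k hk).elim⟩⟩⟩
  | rightLeft =>
    obtain ⟨hv, hv', hb⟩ := hb
    exact ⟨by omega, Or.inr ⟨by simp, (mate_right_left_iff hc hI hv hm hv').2 hb⟩⟩

lemma IsBlock.noArr (hc : c.Good) {n : ℕ} {σ : Shape} (hb : IsBlock c a n σ)
    (hn : NoArr c (a + 1 + n)) : NoArr c a := by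
  obtain ⟨hv, ⟨-, -, hf⟩ | ⟨-, hm⟩⟩ := hb.fate hc hn
  · exact hf.noArr hc hv
  · exact (hm.noArr_iff hc hv).2 hn

lemma BlockChain.noArr (hc : c.Good) (l : List (ℕ × Shape)) :
    ∀ a, BlockChain c a l → NoArr c a := by
  induction l with
  | nil => exact fun _ h => h
  | cons b l ih => exact fun a h => h.1.noArr hc (ih _ h.2)

lemma BlockChainIn.noArr (hc : c.Good) {l : List (Set (ℕ × Shape))} (h : BlockChainIn c a l) :
    NoArr c a := by
  obtain ⟨bs, -, h⟩ := (blockChainIn_iff l a).1 h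
  exact h.noArr hc

/-- The fate of the first particle determines the length, and the velocities at the two ends then
determine the shape. -/
lemma IsBlock.unique (hc : c.Good) {n n' : ℕ} {σ σ' : Shape} (hb : IsBlock c a n σ)
    (hn : NoArr c (a + 1 + n)) (hb' : IsBlock c a n' σ') (hn' : NoArr c (a + 1 + n')) :
    n = n' ∧ σ = σ' := by
  obtain ⟨hv, h⟩ := hb.fate hc hn
  obtain ⟨-, h'⟩ := hb'.fate hc hn'
  rcases h with ⟨h1, h2, h3⟩ | ⟨h1, h3⟩ <;> rcases h' with ⟨h1', h2', h3'⟩ | ⟨h1', h3'⟩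
  · exact ⟨h2.trans h2'.symm, h1.trans h1'.symm⟩
  · exact (h3 _ h3').elim
  · exact (h3' _ h3).elim
  · have e := h3.unique hc h3'
    have e : n = n' := by omega
    subst e
    refine ⟨rfl, ?_⟩
    cases σ <;> cases σ' <;> simp only [ne_eq, not_true, reduceCtorEq] at h1 h1' ⊢ <;>
      simp only [IsBlock, FirstArr, Arr] at hb hb' <;> omega

lemma IsBlock.mate_Ioi (hc : c.Good) {n : ℕ} {σ : Shape} (hb : IsBlock c a n σ)
    (hn : NoArr c (a + 1 + n)) (hi : a + 1 + n < i) :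
    Mate c (Set.Ioi a) i j ↔ Mate c (Set.Ioi (a + 1 + n)) i j := by
  have hI := startsAfter_Ioi a
  have hs : Set.Ioi (a + 1 + n) ⊆ Set.Ioi a := fun x hx => by
    simp only [Set.mem_Ioi] at hx ⊢
    omega
  have H : ∀ u ∈ Set.Ioi (a + 1 + n), ∀ w, w ∉ Set.Ioi (a + 1 + n) →
      ¬ Mate c (Set.Ioi a) u w := by
    intro u hu w hw h
    obtain ⟨hv, ⟨-, rfl, hf⟩ | ⟨-, hm⟩⟩ := hb.fate hc hn
    · have := h.mem_right hc
      have e : w = a + 1 := by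
        simp only [Set.mem_Ioi] at this hw
        omega
      subst e
      exact hf _ h.symm
    · exact hm.not_mate_across hc hI.le (not_lt.1 hw) hu h.symm
  rw [mate_restrict_of_closed hc hs H]
  refine ⟨fun h => ⟨hi, ?_, h⟩, fun h => h.2.2⟩
  by_contra hj
  exact H i hi j hj h

lemma partner_eq (hc : c.Good) (h : Mate c Set.univ i j) : partner c i = j := by
  have hex : ∃ j, Annihilates c Set.univ i j ∨ Annihilates c Set.univ j i := ⟨j, h⟩
  unfold partner
  rw [dif_pos hex]
  exact Mate.unique hc hex.choose_spec h

/-- The absolute velocity at the left end of a block. -/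
def Shape.leftSpeed : Shape → ℤ
  | .up => 0
  | .rightUp => 1
  | .upLeft => 0
  | .rightLeft => 1

/-- The absolute velocity at the right end of a block. -/
def Shape.rightSpeed : Shape → ℤ
  | .up => 0
  | .rightUp => 0
  | .upLeft => 1
  | .rightLeft => 1

/-- The shape of the reflected block. -/
def Shape.mirror : Shape → Shape
  | .up => .up
  | .rightUp => .upLeft
  | .upLeft => .rightUp
  | .rightLeft => .rightLeft

/-- The block `B` has length `b.1 + 1`, shape `b.2` and the corresponding velocities. -/
def Block.Fits (c : Config) (B : Block) (b : ℕ × Shape) : Prop :=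
  B.right - B.left = b.1 ∧ B.shape = b.2 ∧ |c.vel B.left| = b.2.leftSpeed ∧
    |c.vel B.right| = b.2.rightSpeed

open Classical in
-- The hypothesis `hcl` is the invariant along the skyline: on the right of the last block, the
-- full-line process coincides with the half-line process.
lemma rightBlock_succ_of_isBlock (hc : c.Good) {K n : ℕ} {σ : Shape}
    (ha : (rightBlock c K).right = a)
    (hcl : ∀ i j, a < i → (Mate c Set.univ i j ↔ Mate c (Set.Ioi a) i j))
    (hb : IsBlock c a n σ) (hn : NoArr c (a + 1 + n)) :
    rightBlock c (K + 1) = ⟨a + 1, a + 1 + n, σ⟩ := by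
  have hr : rightBlock c (K + 1) = (if c.vel (a + 1) = 0 ∧
      ∀ j, ¬ Annihilates c Set.univ (a + 1) j then ⟨a + 1, a + 1, .up⟩
    else ⟨a + 1, partner c (a + 1), pairShape (c.vel (a + 1)) (c.vel (partner c (a + 1)))⟩) := by
    rw [rightBlock, ha]
  rw [hr]
  obtain ⟨hv, ⟨rfl, rfl, hf⟩ | ⟨hσ, hm⟩⟩ := hb.fate hc hn
  · rw [if_pos]
    · simp
    · exact ⟨hb.2, fun j hj => hf j ((hcl _ _ (by omega)).1 (Or.inl hj))⟩
  · have hm' := (hcl _ _ (by omega)).2 hm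
    obtain ⟨t, ht⟩ := hm'.meet hc
    have hlt : a + 1 < a + 1 + n := by
      have := ht.1
      omega
    have hA := annihilates_iff.2 ⟨hlt, hm'⟩
    rw [if_neg (fun h => h.2 _ hA), partner_eq hc hm']
    congr 1
    unfold pairShape
    cases σ with
    | up => exact absurd rfl hσ
    | upLeft => rw [if_neg, if_pos hb.1]; rw [hb.2.1.2.1]; decide
    | rightUp => rw [if_pos hb.2.1]
    | rightLeft => rw [if_neg, if_neg]; · rw [hb.1]; decide
                   · rw [hb.2.1]; decide

lemma IsBlock.fits {n : ℕ} {σ : Shape} (hb : IsBlock c a n σ) :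
    Block.Fits c ⟨a + 1, a + 1 + n, σ⟩ (n, σ) := by
  refine ⟨by simp, rfl, ?_, ?_⟩ <;> cases σ <;> simp only [IsBlock, FirstArr, Arr] at hb <;>
    simp [Shape.leftSpeed, Shape.rightSpeed, hb]

/-- The blocks of the skyline on the right of a surviving static particle. -/
theorem BlockChain.rightBlock_fits (hc : c.Good) (hS : StaticSurvivor c) (bs : List (ℕ × Shape))
    (h : BlockChain c 0 bs) (k : ℕ) (hk : k < bs.length) :
    (rightBlock c (k + 1)).Fits c bs[k] := by
  -- The induction needs an arbitrary starting particle `a`, with the knowledge that nothing on its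
  -- right annihilates across it.
  suffices H : ∀ (bs : List (ℕ × Shape)) (a : ℤ) (K : ℕ), (rightBlock c K).right = a →
      (∀ i j, a < i → (Mate c Set.univ i j ↔ Mate c (Set.Ioi a) i j)) → BlockChain c a bs →
      ∀ k (hk : k < bs.length), (rightBlock c (K + k + 1)).Fits c bs[k] by
    have := H bs 0 0 rfl (fun i j hi => hS.mate_Ioi hc hi) h k hk
    rwa [Nat.zero_add] at this
  intro bs
  induction bs with
  | nil => intro a K _ _ _ k hk; simp at hk
  | cons b bs ih =>
    intro a K ha hcl h k hk
    have hn := h.2.noArr hc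
    have hB := rightBlock_succ_of_isBlock hc ha hcl h.1 hn
    cases k with
    | zero =>
      rw [Nat.add_zero, hB]
      exact h.1.fits
    | succ k =>
      have := ih (a + 1 + b.1) (K + 1) (by rw [hB])
        (fun i j hi => (hcl i j (by omega)).trans (h.1.mate_Ioi hc hn hi)) h.2 k
        (by simpa using hk)
      have e : K + (k + 1) + 1 = K + 1 + k + 1 := by omega
      rw [e]
      exact this

lemma mate_univ_refl (hc : c.Good) : Mate c.refl Set.univ i j ↔ Mate c Set.univ (-i) (-j) :=
  mate_refl (I := Set.univ) hc

lemma annihilates_univ_refl (hc : c.Good) :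
    Annihilates c.refl Set.univ i j ↔ Annihilates c Set.univ (-j) (-i) := by
  rw [annihilates_iff, annihilates_iff, mate_univ_refl hc]
  exact and_congr (by omega) ⟨Mate.symm, Mate.symm⟩

lemma partner_refl (hc : c.Good) (i : ℤ) : partner c.refl i = -partner c (-i) := by
  by_cases h : ∃ j, Mate c.refl Set.univ i j
  · obtain ⟨j, hj⟩ := h
    rw [partner_eq hc.refl hj, partner_eq hc ((mate_univ_refl hc).1 hj), neg_neg]
  · have h' : ¬ ∃ j, Mate c Set.univ (-i) j := by
      rintro ⟨j, hj⟩
      exact h ⟨-j, (mate_univ_refl hc).2 (by rwa [neg_neg])⟩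
    simp only [Mate] at h h'
    unfold partner
    rw [dif_neg h, dif_neg h', neg_neg]

/-- The reflected block. -/
def Block.mirror (B : Block) : Block := ⟨-B.right, -B.left, B.shape.mirror⟩

lemma leftBlock_eq (hc : c.Good) (k : ℕ) : leftBlock c k = (rightBlock c.refl k).mirror := by
  induction k with
  | zero => simp [leftBlock, rightBlock, Block.mirror, Shape.mirror]
  | succ k ih =>
    rw [leftBlock, rightBlock]
    set l := (rightBlock c.refl k).right + 1 with hl
    have hr : (leftBlock c k).left - 1 = -l := by
      rw [ih, hl]
      simp only [Block.mirror]
      ring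
    rw [hr]
    have hcond : (c.refl.vel l = 0 ∧ ∀ j, ¬ Annihilates c.refl Set.univ l j) ↔
        (c.vel (-l) = 0 ∧ ∀ j, ¬ Annihilates c Set.univ j (-l)) := by
      refine and_congr (by simp [Config.refl]) ?_
      constructor
      · intro h j hj
        refine h (-j) ?_
        rwa [annihilates_univ_refl hc, neg_neg]
      · intro h j hj
        exact h _ ((annihilates_univ_refl hc).1 hj)
    by_cases h : c.vel (-l) = 0 ∧ ∀ j, ¬ Annihilates c Set.univ j (-l)
    · rw [if_pos h, if_pos (hcond.2 h)]
      rfl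
    · rw [if_neg h, if_neg (fun h' => h (hcond.1 h')), partner_refl hc]
      simp only [Block.mirror, neg_neg, Block.mk.injEq, true_and]
      -- `pairShape` looks at the right end first, so it commutes with reflection only if the two
      -- ends are not both static.
      have hnot : ¬ (c.vel (-l) = 0 ∧ c.vel (partner c (-l)) = 0) := by
        rintro ⟨h1, h2⟩
        have : ∃ j, Annihilates c Set.univ j (-l) := by
          by_contra hno
          exact h ⟨h1, fun j hj => hno ⟨j, hj⟩⟩
        obtain ⟨j, hj⟩ := this
        have hm : Mate c Set.univ (-l) j := Or.inr hj
        rw [partner_eq hc hm] at h2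
        obtain ⟨t, ht⟩ := hm.meet hc
        exact ht.vel_ne hc (h1.trans h2.symm)
      simp only [pairShape, Config.refl, neg_neg, neg_eq_zero]
      by_cases h1 : c.vel (-l) = 0 <;> by_cases h2 : c.vel (partner c (-l)) = 0
      · exact (hnot ⟨h1, h2⟩).elim
      all_goals simp [h1, h2, Shape.mirror]

lemma Block.Fits.mirror {B : Block} {b : ℕ × Shape} (h : B.Fits c.refl b) :
    B.mirror.Fits c (b.1, b.2.mirror) := by
  obtain ⟨h1, h2, h3, h4⟩ := h
  simp only [Config.refl, abs_neg] at h3 h4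
  refine ⟨?_, ?_, ?_, ?_⟩
  · simp only [Block.mirror]
    rw [← h1]
    ring
  · simp only [Block.mirror, h2]
  · simp only [Block.mirror, h4]
    cases b.2 <;> rfl
  · simp only [Block.mirror, h3]
    cases b.2 <;> rfl

lemma BlockChain.leftBlock_fits (hc : c.Good) (hS : StaticSurvivor c.refl) (bs : List (ℕ × Shape))
    (h : BlockChain c.refl 0 bs) (k : ℕ) (hk : k < bs.length) :
    (leftBlock c (k + 1)).Fits c (bs[k].1, bs[k].2.mirror) := by
  rw [leftBlock_eq hc]
  exact (h.rightBlock_fits hc.refl hS bs k hk).mirror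

lemma StaticSurvivor.refl (hc : c.Good) (hS : StaticSurvivor c) : StaticSurvivor c.refl := by
  rw [staticSurvivor_iff_free] at hS ⊢
  refine ⟨by simp [Config.refl, hS.1], fun j hj => hS.2 (-j) ?_⟩
  simpa using (mate_univ_refl hc).1 hj

lemma Block.Fits.skyline_eq {k : ℤ} {b : ℕ × Shape} (h : (skylineBlock c k).Fits c b) :
    skyline c k = ((b.1 : ℤ), b.2) ∧ endSpeed c k false = b.2.leftSpeed ∧
      endSpeed c k true = b.2.rightSpeed := by
  obtain ⟨h1, h2, h3, h4⟩ := h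
  exact ⟨by rw [skyline, h1, h2], by simpa [endSpeed] using h3,
    by simpa [endSpeed] using h4⟩

end BallisticAnnihilation

/-! ### Configurations as functions of the marks, and measurability -/

namespace BallisticAnnihilation
variable {c c' : Config} {I I' : Set ℤ} {i j k n a : ℤ}

/-- The configuration with particle `0` at `0` and with the given interdistances, velocities and
spins. -/
noncomputable def cfg (ξ : ℤ → ℝ × ℤ × ℤ) : Config where
  pos n := ∑ i ∈ Finset.Ioc 0 n, (ξ i).1 - ∑ i ∈ Finset.Ioc n 0, (ξ i).1
  vel n := (ξ n).2.1
  spin n := (ξ n).2.2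

lemma cfg_pos_zero (ξ : ℤ → ℝ × ℤ × ℤ) : (cfg ξ).pos 0 = 0 := by simp [cfg]

lemma cfg_pos_sub (ξ : ℤ → ℝ × ℤ × ℤ) (n : ℤ) :
    (cfg ξ).pos n - (cfg ξ).pos (n - 1) = (ξ n).1 := by
  simp only [cfg]
  rcases le_or_gt n 0 with h | h
  · have h1 : Finset.Ioc 0 n = ∅ := Finset.Ioc_eq_empty (by omega)
    have h2 : Finset.Ioc 0 (n - 1) = ∅ := Finset.Ioc_eq_empty (by omega)
    have h3 : Finset.Ioc (n - 1) 0 = insert n (Finset.Ioc n 0) := by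
      ext x
      simp only [Finset.mem_Ioc, Finset.mem_insert]
      omega
    rw [h1, h2, h3, Finset.sum_insert (by simp)]
    ring
  · have h1 : Finset.Ioc n 0 = ∅ := Finset.Ioc_eq_empty (by omega)
    have h2 : Finset.Ioc (n - 1) 0 = ∅ := Finset.Ioc_eq_empty (by omega)
    have h3 : Finset.Ioc 0 n = insert n (Finset.Ioc 0 (n - 1)) := by
      ext x
      simp only [Finset.mem_Ioc, Finset.mem_insert]
      omega
    rw [h1, h2, h3, Finset.sum_insert (by simp)]
    ring

/-- Any realization of the process is a function of its marks, so that probabilities can be computed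
on the product space of marks. -/
lemma eq_cfg_of_mark {ξ : ℤ → ℝ × ℤ × ℤ} (h0 : c.pos 0 = 0) (h : ∀ n, c.mark n = ξ n) :
    c = cfg ξ := by
  have hg : ∀ n, c.pos n - c.pos (n - 1) = (ξ n).1 := fun n => by rw [← h n]; rfl
  have hv : c.vel = (cfg ξ).vel := by
    ext n
    have := h n
    simp only [cfg, ← this]
    rfl
  have hs : c.spin = (cfg ξ).spin := by
    ext n
    have := h n
    simp only [cfg, ← this]
    rfl
  have hp : c.pos = (cfg ξ).pos := by
    ext n
    induction n using Int.induction_on with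
    | zero => rw [h0, cfg_pos_zero]
    | succ n ih =>
      have h1 := hg (n + 1)
      have h2 := cfg_pos_sub ξ (n + 1)
      rw [add_sub_cancel_right] at h1 h2
      linarith
    | pred n ih =>
      have h1 := hg (-n)
      have h2 := cfg_pos_sub ξ (-n)
      linarith
  cases c
  simp only at hv hs hp
  rw [hv, hs, hp]

lemma cfg_pos_sub_of_le (ξ : ℤ → ℝ × ℤ × ℤ) {i j : ℤ} (hij : i ≤ j) :
    (cfg ξ).pos j - (cfg ξ).pos i = ∑ k ∈ Finset.Ioc i j, (ξ k).1 := by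
  induction j, hij using Int.leInduction with
  | base => simp
  | succ j hij ih =>
    have h3 : Finset.Ioc i (j + 1) = insert (j + 1) (Finset.Ioc i j) := by
      ext x
      simp only [Finset.mem_Ioc, Finset.mem_insert]
      omega
    have h1 := cfg_pos_sub ξ (j + 1)
    rw [add_sub_cancel_right] at h1
    rw [h3, Finset.sum_insert (by simp)]
    linarith

lemma sameOn_cfg {ξ ξ' : ℤ → ℝ × ℤ × ℤ} (hI : I.OrdConnected) (h : ∀ i ∈ I, ξ i = ξ' i) :
    SameOn (cfg ξ) (cfg ξ') I where
  pos := by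
    have key : ∀ i ∈ I, ∀ j ∈ I, i ≤ j →
        (cfg ξ).pos j - (cfg ξ).pos i = (cfg ξ').pos j - (cfg ξ').pos i := by
      intro i hi j hj hij
      rw [cfg_pos_sub_of_le ξ hij, cfg_pos_sub_of_le ξ' hij]
      refine Finset.sum_congr rfl fun k hk => ?_
      rw [Finset.mem_Ioc] at hk
      rw [h k (hI.out hi hj ⟨hk.1.le, hk.2⟩)]
    intro i hi j hj
    rcases le_total i j with hij | hij
    · exact key i hi j hj hij
    · have := key j hj i hi hij
      linarith
  vel i hi := by simp only [cfg, h i hi]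
  spin i hi := by simp only [cfg, h i hi]

/-- The marks seen from particle `a`. -/
def shiftMarks (a : ℤ) (ξ : ℤ → ℝ × ℤ × ℤ) : ℤ → ℝ × ℤ × ℤ := fun n => ξ (n + a)

/-- The marks of the reflected configuration. -/
def reflMarks (ξ : ℤ → ℝ × ℤ × ℤ) : ℤ → ℝ × ℤ × ℤ :=
  -- Mark `n` holds the gap between `n - 1` and `n`. After reflection this is the gap between `-n`
  -- and `1 - n`, hence an index that differs by one from that of the velocity and the spin.
  fun n => ((ξ (1 - n)).1, -(ξ (-n)).2.1, -(ξ (-n)).2.2)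

lemma cfg_shiftMarks (a : ℤ) (ξ : ℤ → ℝ × ℤ × ℤ) : cfg (shiftMarks a ξ) = (cfg ξ).shift a := by
  refine (eq_cfg_of_mark (by simp [Config.shift]) fun n => ?_).symm
  have := cfg_pos_sub ξ (n + a)
  simp only [Config.mark, Config.shift, shiftMarks]
  rw [Prod.ext_iff]
  refine ⟨?_, rfl⟩
  have e : n - 1 + a = n + a - 1 := by ring
  simp only [e]
  linarith

lemma cfg_reflMarks (ξ : ℤ → ℝ × ℤ × ℤ) : cfg (reflMarks ξ) = (cfg ξ).refl := by
  refine (eq_cfg_of_mark (by simp [Config.refl, cfg_pos_zero]) fun n => ?_).symm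
  have := cfg_pos_sub ξ (1 - n)
  simp only [Config.mark, Config.refl, reflMarks]
  rw [Prod.ext_iff]
  refine ⟨?_, rfl⟩
  have e : 1 - n - 1 = -n := by ring
  have e' : -(n - 1) = 1 - n := by ring
  rw [e] at this
  simp only [e']
  linarith

section Measurability

lemma measurable_cfg_pos (n : ℤ) : Measurable fun ξ => (cfg ξ).pos n := by
  simp only [cfg]
  fun_prop

lemma measurable_cfg_vel (n : ℤ) : Measurable fun ξ => (cfg ξ).vel n := by
  simp only [cfg]
  fun_prop

lemma measurable_cfg_spin (n : ℤ) : Measurable fun ξ => (cfg ξ).spin n := by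
  simp only [cfg]
  fun_prop

lemma measurable_cfg_vel_eq (n x : ℤ) : Measurable fun ξ => (cfg ξ).vel n = x :=
  (Measurable.of_discrete (f := fun y : ℤ => y = x)).comp (measurable_cfg_vel n)

lemma measurable_cfg_spin_eq (n x : ℤ) : Measurable fun ξ => (cfg ξ).spin n = x :=
  (Measurable.of_discrete (f := fun y : ℤ => y = x)).comp (measurable_cfg_spin n)

lemma measurable_collTime (i j : ℤ) : Measurable fun ξ => collTime (cfg ξ) i j := by
  unfold collTime
  have h1 := measurable_cfg_pos i
  have h2 := measurable_cfg_pos j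
  have h3 : Measurable fun ξ => ((cfg ξ).vel i : ℝ) :=
    (Measurable.of_discrete (f := fun y : ℤ => (y : ℝ))).comp (measurable_cfg_vel i)
  have h4 : Measurable fun ξ => ((cfg ξ).vel j : ℝ) :=
    (Measurable.of_discrete (f := fun y : ℤ => (y : ℝ))).comp (measurable_cfg_vel j)
  refine Measurable.ite ?_ ?_ measurable_const
  · exact measurableSet_lt measurable_const ((h2.sub h1).mul (h3.sub h4))
  · exact ((h2.sub h1).div (h3.sub h4)).coe_real_ereal

lemma Measurable.le_prop {α β : Type*} [MeasurableSpace α] [TopologicalSpace β]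
    [MeasurableSpace β] [OpensMeasurableSpace β] [LinearOrder β] [OrderClosedTopology β]
    [SecondCountableTopology β] {f g : α → β} (hf : Measurable f) (hg : Measurable g) :
    Measurable fun x => f x ≤ g x :=
  measurableSet_setOfPred.1 (measurableSet_le hf hg)

lemma Measurable.lt_prop {α β : Type*} [MeasurableSpace α] [TopologicalSpace β]
    [MeasurableSpace β] [OpensMeasurableSpace β] [LinearOrder β] [OrderClosedTopology β]
    [SecondCountableTopology β] {f g : α → β} (hf : Measurable f) (hg : Measurable g) :
    Measurable fun x => f x < g x :=
  measurableSet_setOfPred.1 (measurableSet_lt hf hg)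

lemma Measurable.eq_prop {α β : Type*} [MeasurableSpace α] [TopologicalSpace β]
    [MeasurableSpace β] [OpensMeasurableSpace β] [LinearOrder β] [OrderClosedTopology β]
    [SecondCountableTopology β] {f g : α → β} (hf : Measurable f) (hg : Measurable g) :
    Measurable fun x => f x = g x := by
  simp only [le_antisymm_iff]
  exact (Measurable.le_prop hf hg).and (Measurable.le_prop hg hf)

/-- At each depth the rule is a countable combination of comparisons between collision times and of
conditions on velocities and spins. -/
lemma measurable_annihilates (I : Set ℤ) (i j : ℤ) :
    Measurable fun ξ => Annihilates (cfg ξ) I i j := by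
  refine Measurable.exists fun n => ?_
  induction n generalizing i j with
  | zero => exact measurable_const
  | succ n ih =>
    have hT := measurable_collTime
    have hH : ∀ i j k, Measurable fun ξ => hitTime (cfg ξ) i j k := fun i j k =>
      (hT i k).min (hT j k)
    have hR : ∀ i j k, Measurable fun ξ =>
        RemovedBefore (cfg ξ) I (annihilatesUpTo (cfg ξ) I n) i j k := fun i j k =>
      Measurable.exists fun k' => measurable_const.and <| measurable_const.and <|
        measurable_const.and <| (Measurable.le_prop (hT _ _) (hH _ _ _)).and <|
          (ih _ _).or (ih _ _)
    change Measurable fun ξ => CollisionRule (cfg ξ) I (annihilatesUpTo (cfg ξ) I n) i j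
    unfold CollisionRule
    refine measurable_const.and <| measurable_const.and <| measurable_const.and <|
      (Measurable.lt_prop (hT _ _) measurable_const).and <| Measurable.or ?_ (Measurable.and ?_ ?_)
    · exact Measurable.forall fun k => measurable_const.imp <| measurable_const.imp <|
        measurable_const.imp <| (Measurable.le_prop (hH _ _ _) (hT _ _)).imp (hR _ _ _)
    · exact Measurable.exists fun k => measurable_const.and <|
        (Measurable.eq_prop (hT _ _) (hT _ _)).and <|
        (Measurable.eq_prop (hT _ _) (hT _ _)).and <|
        ((measurable_cfg_vel_eq _ _).and <| (measurable_cfg_vel_eq _ _).and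
          (measurable_cfg_spin_eq _ _)).or ((measurable_cfg_vel_eq _ _).and <|
          (measurable_cfg_vel_eq _ _).and (measurable_cfg_spin_eq _ _))
    · exact Measurable.forall fun k => measurable_const.imp <| measurable_const.imp <|
        measurable_const.imp <| (Measurable.lt_prop (hH _ _ _) (hT _ _)).imp (hR _ _ _)

lemma measurable_mate (I : Set ℤ) (i j : ℤ) : Measurable fun ξ => Mate (cfg ξ) I i j :=
  (measurable_annihilates I i j).or (measurable_annihilates I j i)

lemma measurable_arr (a k : ℤ) : Measurable fun ξ => Arr (cfg ξ) a k :=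
  measurable_const.and <| (measurable_cfg_vel_eq _ _).and <|
    Measurable.forall fun _ => (measurable_mate _ _ _).not

lemma measurable_firstArr (a k : ℤ) : Measurable fun ξ => FirstArr (cfg ξ) a k :=
  (measurable_arr a k).and <| Measurable.forall fun _ => (measurable_arr _ _).imp measurable_const

lemma measurable_noArr (a : ℤ) : Measurable fun ξ => NoArr (cfg ξ) a :=
  Measurable.forall fun _ => (measurable_arr _ _).not

lemma measurable_isBlock (a : ℤ) (n : ℕ) (σ : Shape) :
    Measurable fun ξ => IsBlock (cfg ξ) a n σ := by
  cases σ
  · exact measurable_const.and (measurable_cfg_vel_eq _ _)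
  · exact (measurable_cfg_vel_eq _ _).and <| (measurable_cfg_vel_eq _ _).and (measurable_mate _ _ _)
  · exact (measurable_cfg_vel_eq _ _).and (measurable_firstArr _ _)
  · exact (measurable_cfg_vel_eq _ _).and <| (measurable_cfg_vel_eq _ _).and (measurable_mate _ _ _)

instance : Countable Shape := by
  refine Function.Injective.countable (f := fun σ : Shape => (σ.leftSpeed, σ.rightSpeed)) ?_
  intro a b h
  cases a <;> cases b <;> simp_all [Shape.leftSpeed, Shape.rightSpeed]

instance : DiscreteMeasurableSpace Shape := ⟨fun _ => trivial⟩

lemma measurable_blockChainIn (l : List (Set (ℕ × Shape))) :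
    ∀ a, Measurable fun ξ => BlockChainIn (cfg ξ) a l := by
  induction l with
  | nil => exact fun a => measurable_noArr a
  | cons s l ih =>
    exact fun a => Measurable.exists fun b => measurable_const.and <|
      (measurable_isBlock _ _ _).and (ih _)

lemma measurable_staticSurvivor : Measurable fun ξ => StaticSurvivor (cfg ξ) :=
  (measurable_cfg_vel_eq _ _).and <| Measurable.forall fun _ =>
    (measurable_annihilates _ _ _).not.and (measurable_annihilates _ _ _).not

end Measurability

end BallisticAnnihilation

/-! ### Law of the marks: invariance, independence and regularity -/

namespace BallisticAnnihilation
variable {c c' : Config} {I I' : Set ℤ} {i j k n a : ℤ}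

instance : IsProbabilityMeasure spinLaw := by
  constructor
  simp only [spinLaw, Measure.smul_apply, Measure.add_apply, measure_univ, smul_eq_mul]
  rw [one_add_one_eq_two, ENNReal.inv_mul_cancel (by simp) (by simp)]

lemma isProbabilityMeasure_velLaw {p : ℝ} (hp : 0 ≤ p) (hp1 : p ≤ 1) :
    IsProbabilityMeasure (velLaw p) := by
  constructor
  simp only [velLaw, Measure.smul_apply, Measure.add_apply, measure_univ, smul_eq_mul, mul_one]
  rw [one_add_one_eq_two, ← ENNReal.ofReal_ofNat 2, ← ENNReal.ofReal_mul (by linarith),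
    ← ENNReal.ofReal_add hp (by linarith)]
  simp

lemma velLaw_map_neg (p : ℝ) : (velLaw p).map (fun x => -x) = velLaw p := by
  unfold velLaw
  rw [Measure.map_add _ _ (by fun_prop), Measure.map_smul, Measure.map_smul,
    Measure.map_add _ _ (by fun_prop), Measure.map_dirac' (by fun_prop),
    Measure.map_dirac' (by fun_prop), Measure.map_dirac' (by fun_prop)]
  simp only [neg_zero, neg_neg]
  rw [add_comm (Measure.dirac (-1 : ℤ))]

lemma spinLaw_map_neg : spinLaw.map (fun x => -x) = spinLaw := by
  unfold spinLaw
  rw [Measure.map_smul,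
    Measure.map_add _ _ (by fun_prop), Measure.map_dirac' (by fun_prop),
    Measure.map_dirac' (by fun_prop)]
  simp only [neg_neg]
  rw [add_comm (Measure.dirac (-1 : ℤ))]

/-- The law of a velocity and a spin. -/
noncomputable def velSpinLaw (p : ℝ) : Measure (ℤ × ℤ) := (velLaw p).prod spinLaw

lemma velSpinLaw_map_neg (p : ℝ) : (velSpinLaw p).map (fun x => (-x.1, -x.2)) = velSpinLaw p := by
  have h : (fun x : ℤ × ℤ => (-x.1, -x.2)) = Prod.map (fun x => -x) (fun x => -x) := rfl
  unfold velSpinLaw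
  rw [h, ← Measure.map_prod_map _ _ (by fun_prop) (by fun_prop), velLaw_map_neg, spinLaw_map_neg]

/-- The law of the marks of the full-line process. -/
noncomputable def processLaw (p : ℝ) (m : Measure ℝ) [IsProbabilityMeasure m]
    [IsProbabilityMeasure (velLaw p)] : Measure (ℤ → ℝ × ℤ × ℤ) :=
  Measure.infinitePi fun _ : ℤ => m.prod ((velLaw p).prod spinLaw)

variable {p : ℝ} {m : Measure ℝ} [IsProbabilityMeasure m] [IsProbabilityMeasure (velLaw p)]

instance : IsProbabilityMeasure (velSpinLaw p) := by
  unfold velSpinLaw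
  infer_instance

instance : IsProbabilityMeasure (processLaw p m) := by
  unfold processLaw
  infer_instance

/-- The interdistances on one hand, the velocities and spins on the other hand, can be sampled
independently. -/
lemma processLaw_eq_map_zip : processLaw p m =
    ((Measure.infinitePi fun _ : ℤ => m).prod (Measure.infinitePi fun _ : ℤ => velSpinLaw p)).map
      (fun x n => (x.1 n, x.2 n)) := by
  set ν := (Measure.infinitePi fun _ : ℤ => m).prod (Measure.infinitePi fun _ : ℤ => velSpinLaw p)
  have hm : ∀ n : ℤ, Measurable fun x : (ℤ → ℝ) × (ℤ → ℤ × ℤ) => (x.1 n, x.2 n) := by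
    intro n
    fun_prop
  have hlaw : ∀ n : ℤ, ν.map (fun x => (x.1 n, x.2 n)) = m.prod ((velLaw p).prod spinLaw) := by
    intro n
    have h : (fun x : (ℤ → ℝ) × (ℤ → ℤ × ℤ) => (x.1 n, x.2 n)) =
        Prod.map (fun γ => γ n) (fun w => w n) := rfl
    rw [h, ← Measure.map_prod_map _ _ (by fun_prop) (by fun_prop), Measure.infinitePi_map_eval,
      Measure.infinitePi_map_eval]
    rfl
  have hind : iIndepFun (fun (n : ℤ) (x : (ℤ → ℝ) × (ℤ → ℤ × ℤ)) => (x.1 n, x.2 n)) ν := by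
    set R : Set (Set (ℝ × ℤ × ℤ)) :=
      Set.image2 (fun x y => x ×ˢ y) {s : Set ℝ | MeasurableSet s}
        {t : Set (ℤ × ℤ) | MeasurableSet t} with hR
    refine iIndepSets.iIndep (fun n => (hm n).comap_le)
      (fun n => (fun s => (fun x : (ℤ → ℝ) × (ℤ → ℤ × ℤ) => (x.1 n, x.2 n)) ⁻¹' s) '' R) ?_ ?_ ?_
    · rintro n _ ⟨_, ⟨A, hA, B, hB, rfl⟩, rfl⟩ _ ⟨_, ⟨A', hA', B', hB', rfl⟩, rfl⟩ -
      refine ⟨_, ⟨A ∩ A', (show MeasurableSet A from hA).inter hA', B ∩ B',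
        (show MeasurableSet B from hB).inter hB', rfl⟩, ?_⟩
      ext x
      simp only [Set.mem_preimage, Set.mem_prod, Set.mem_inter_iff]
      tauto
    · intro n
      rw [← generateFrom_prod, MeasurableSpace.comap_generateFrom]
    · rw [iIndepSets_iff]
      intro S f hf
      have hf' : ∀ n : ℤ, ∃ A : Set ℝ, ∃ B : Set (ℤ × ℤ), MeasurableSet A ∧ MeasurableSet B ∧
          (n ∈ S → f n = {x | x.1 n ∈ A ∧ x.2 n ∈ B}) := by
        intro n
        by_cases hn : n ∈ S
        · obtain ⟨_, ⟨A, hA, B, hB, rfl⟩, h⟩ := hf n hn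
          exact ⟨A, B, hA, hB, fun _ => h.symm⟩
        · exact ⟨∅, ∅, .empty, .empty, fun h => absurd h hn⟩
      choose A B hA hB hAB using hf'
      have h1 : ∀ n ∈ S, ν (f n) = m (A n) * velSpinLaw p (B n) := by
        intro n hn
        have e : f n = (fun x => (x.1 n, x.2 n)) ⁻¹' (A n ×ˢ B n) := by
          rw [hAB n hn]
          rfl
        rw [e, ← Measure.map_apply (hm n) ((hA n).prod (hB n)), hlaw, Measure.prod_prod]
        rfl
      have h2 : (⋂ n ∈ S, f n) = (Set.pi S A) ×ˢ (Set.pi S B) := by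
        ext x
        simp only [Set.mem_iInter, Set.mem_prod, Set.mem_pi]
        constructor
        · intro h
          refine ⟨fun n hn => ?_, fun n hn => ?_⟩ <;> have := h n hn <;> rw [hAB n hn] at this
          · exact this.1
          · exact this.2
        · intro h n hn
          rw [hAB n hn]
          exact ⟨h.1 n hn, h.2 n hn⟩
      rw [h2, Measure.prod_prod, Measure.infinitePi_pi _ fun n _ => hA n,
        Measure.infinitePi_pi _ fun n _ => hB n, ← Finset.prod_mul_distrib]
      exact (Finset.prod_congr rfl h1).symm
  rw [(iIndepFun_iff_map_fun_eq_infinitePi_map hm).1 hind]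
  simp only [hlaw]
  rfl

lemma measurePreserving_shiftMarks (a : ℤ) :
    MeasurePreserving (shiftMarks a) (processLaw p m) (processLaw p m) where
  measurable := by
    unfold shiftMarks
    fun_prop
  map_eq := Measure.map_infinitePi_infinitePi_of_inj (add_left_injective a)

lemma measurable_reflMarks : Measurable reflMarks := by
  unfold reflMarks
  fun_prop

lemma measurePreserving_reflMarks :
    MeasurePreserving reflMarks (processLaw p m) (processLaw p m) where
  measurable := measurable_reflMarks
  map_eq := by
    have h1 : (Measure.infinitePi fun _ : ℤ => m).map (fun γ (n : ℤ) => γ (1 - n)) =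
        Measure.infinitePi fun _ : ℤ => m :=
      Measure.map_infinitePi_infinitePi_of_inj (P := fun _ => m) sub_right_injective
    have h2 : (Measure.infinitePi fun _ : ℤ => velSpinLaw p).map
        (fun w (n : ℤ) => (-(w (-n)).1, -(w (-n)).2)) =
        Measure.infinitePi fun _ : ℤ => velSpinLaw p := by
      have e : (fun (w : ℤ → ℤ × ℤ) (n : ℤ) => (-(w (-n)).1, -(w (-n)).2)) =
          (fun (w : ℤ → ℤ × ℤ) (n : ℤ) => (-(w n).1, -(w n).2)) ∘ (fun w n => w (-n)) := rfl
      rw [e, ← Measure.map_map (by fun_prop) (by fun_prop),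
        Measure.map_infinitePi_infinitePi_of_inj (P := fun _ => velSpinLaw p) neg_injective,
        Measure.infinitePi_map_pi (μ := fun _ => velSpinLaw p)
          (f := fun _ x => (-x.1, -x.2)) (fun _ => by fun_prop)]
      simp only [velSpinLaw_map_neg]
    -- Reflection permutes the gaps and the velocity-spin pairs by different index maps, so the two
    -- families are separated and each is shown to be invariant.
    rw [processLaw_eq_map_zip, Measure.map_map measurable_reflMarks (by fun_prop)]
    have e : reflMarks ∘ (fun (x : (ℤ → ℝ) × (ℤ → ℤ × ℤ)) (n : ℤ) => (x.1 n, x.2 n)) =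
        (fun (x : (ℤ → ℝ) × (ℤ → ℤ × ℤ)) (n : ℤ) => (x.1 n, x.2 n)) ∘ (Prod.map (fun γ (n : ℤ) => γ (1 - n))
          (fun w (n : ℤ) => (-(w (-n)).1, -(w (-n)).2))) := rfl
    rw [e, ← Measure.map_map (by fun_prop) (by fun_prop),
      ← Measure.map_prod_map _ _ (by fun_prop) (by fun_prop), h1, h2]

/-- The marks in `W`, completed by fixed marks outside. -/
noncomputable def keepMarks (W : Set ℤ) (ξ : ℤ → ℝ × ℤ × ℤ) : ℤ → ℝ × ℤ × ℤ := by
  classical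
  exact fun n => if n ∈ W then ξ n else (1, 0, 1)

lemma keepMarks_of_mem {W : Set ℤ} (ξ : ℤ → ℝ × ℤ × ℤ) (h : n ∈ W) :
    keepMarks W ξ n = ξ n := by
  simp [keepMarks, h]

lemma measurable_keepMarks {W : Set ℤ} {Ω : Type*} [MeasurableSpace Ω]
    {f : Ω → ℤ → ℝ × ℤ × ℤ} (hf : ∀ n ∈ W, Measurable fun ω => f ω n) :
    Measurable fun ω => keepMarks W (f ω) := by
  rw [measurable_pi_iff]
  intro n
  by_cases hn : n ∈ W
  · simpa only [keepMarks, hn, if_true] using hf n hn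
  · simp only [keepMarks, hn, if_false, measurable_const]

/-- Events that depend on disjoint sets of marks are independent. -/
theorem processLaw_inter {E E' : (ℤ → ℝ × ℤ × ℤ) → Prop} {W W' : Set ℤ} (hE : Measurable E)
    (hE' : Measurable E') (hW : ∀ ξ, E ξ ↔ E (keepMarks W ξ))
    (hW' : ∀ ξ, E' ξ ↔ E' (keepMarks W' ξ)) (hd : Disjoint W W') :
    processLaw p m {ξ | E ξ ∧ E' ξ} = processLaw p m {ξ | E ξ} * processLaw p m {ξ | E' ξ} := by
  have hind : iIndepFun (fun (n : ℤ) (ξ : ℤ → ℝ × ℤ × ℤ) => ξ n) (processLaw p m) :=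
    iIndepFun_infinitePi (X := fun _ x => x) (fun _ => measurable_id)
  have key := indep_iSup_of_disjoint (fun n => (measurable_pi_apply n).comap_le) hind hd
  have hmeas : ∀ (W : Set ℤ) (E : (ℤ → ℝ × ℤ × ℤ) → Prop), Measurable E →
      (∀ ξ, E ξ ↔ E (keepMarks W ξ)) →
      MeasurableSet[⨆ n ∈ W, MeasurableSpace.comap (fun ξ : ℤ → ℝ × ℤ × ℤ => ξ n) inferInstance]
        {ξ | E ξ} := by
    intro W E hE hW
    have e : {ξ | E ξ} = keepMarks W ⁻¹' {ξ | E ξ} := by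
      ext ξ
      exact hW ξ
    rw [e]
    suffices hk : Measurable[⨆ n ∈ W,
        MeasurableSpace.comap (fun ξ : ℤ → ℝ × ℤ × ℤ => ξ n) inferInstance] (keepMarks W) from
      hk (measurableSet_setOfPred.2 hE)
    refine @measurable_keepMarks W _ (_) id fun n hn => ?_
    refine Measurable.mono (comap_measurable _) ?_ le_rfl
    exact le_iSup₂_of_le n hn le_rfl
  exact (Indep_iff _ _ _).1 key _ _ (hmeas W E hE hW) (hmeas W' E' hE' hW')

lemma processLaw_mark (n : ℤ) {B : Set (ℝ × ℤ × ℤ)} (hB : MeasurableSet B) :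
    processLaw p m {ξ | ξ n ∈ B} = m.prod ((velLaw p).prod spinLaw) B := by
  have := Measure.infinitePi_map_eval (fun _ : ℤ => m.prod ((velLaw p).prod spinLaw)) n
  rw [← this, Measure.map_apply (by fun_prop) hB]
  rfl

lemma processLaw_vel (n x : ℤ) : processLaw p m {ξ | (cfg ξ).vel n = x} = velLaw p {x} := by
  have h := processLaw_mark (p := p) (m := m) n
    (B := Set.univ ×ˢ ({x} ×ˢ Set.univ)) (MeasurableSet.univ.prod ((measurableSet_singleton _).prod .univ))
  rw [Measure.prod_prod, Measure.prod_prod] at h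
  simp only [measure_univ, one_mul, mul_one] at h
  rw [← h]
  congr 1
  ext ξ
  simp [cfg]

/-- Some `ε > 0` is exceeded by a gap with positive probability; by the second Borel-Cantelli lemma
this happens for infinitely many independent gaps on the right. With reflection, it excludes
accumulation points. -/
lemma processLaw_pos_unbounded (hm : m (Set.Iic 0) = 0) :
    ∀ᵐ ξ ∂processLaw p m, (∀ n, 0 < (ξ n).1) → ∀ r : ℝ, ∃ N : ℤ, r < (cfg ξ).pos N := by
  obtain ⟨ε, hε, hmε⟩ : ∃ ε : ℝ, 0 < ε ∧ m (Set.Ioi ε) ≠ 0 := by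
    by_contra! hcon
    have h1 : m (Set.Ioi 0) = 0 := by
      have e : Set.Ioi (0 : ℝ) = ⋃ n : ℕ, Set.Ioi (1 / ((n : ℝ) + 1)) := by
        ext x
        simp only [Set.mem_Ioi, Set.mem_iUnion]
        refine ⟨fun hx => exists_nat_one_div_lt hx, fun ⟨n, hn⟩ => lt_trans (by positivity) hn⟩
      rw [e, measure_iUnion_null_iff]
      exact fun n => hcon _ (by positivity)
    have h2 : m Set.univ = 0 := by
      rw [← Set.Iic_union_Ioi (a := (0 : ℝ))]
      exact measure_union_null hm h1
    simp at h2
  set s : ℕ → Set (ℤ → ℝ × ℤ × ℤ) := fun n => {ξ | ξ ((n : ℤ) + 1) ∈ Set.Ioi ε ×ˢ Set.univ}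
  have hsm : ∀ n, MeasurableSet (s n) := fun n =>
    (measurable_pi_apply _) (measurableSet_Ioi.prod .univ)
  have hs : iIndepSet s (processLaw p m) := by
    have hind : iIndepFun (fun (n : ℤ) (ξ : ℤ → ℝ × ℤ × ℤ) => ξ n) (processLaw p m) :=
      iIndepFun_infinitePi (X := fun _ x => x) (fun _ => measurable_id)
    rw [iIndepSet_iff_meas_biInter hsm]
    intro S
    exact (hind.precomp (g := fun n : ℕ => (n : ℤ) + 1) (fun x y h => by simpa using h)).measure_inter_preimage_eq_mul
      S (sets := fun _ => Set.Ioi ε ×ˢ Set.univ) (fun _ _ => measurableSet_Ioi.prod .univ)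
  have hsum : ∑' n, processLaw p m (s n) = ⊤ := by
    have : ∀ n, processLaw p m (s n) = m (Set.Ioi ε) := by
      intro n
      rw [processLaw_mark _ (measurableSet_Ioi.prod .univ), Measure.prod_prod, measure_univ, mul_one]
    simp only [this]
    exact ENNReal.tsum_const_eq_top_of_ne_zero hmε
  have h1 := measure_limsup_eq_one hsm hs hsum
  have h2 : ∀ᵐ ξ ∂processLaw p m, ξ ∈ Filter.limsup s Filter.atTop := by
    rw [← prob_compl_eq_zero_iff (MeasurableSet.measurableSet_limsup hsm)] at h1
    exact h1
  filter_upwards [h2] with ξ hξ hpos r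
  rw [Filter.mem_limsup_iff_frequently_mem, Nat.frequently_atTop_iff_infinite] at hξ
  obtain ⟨K, hK⟩ := exists_nat_gt (r / ε)
  obtain ⟨T, hT, hcard⟩ := hξ.exists_subset_card_eq K
  obtain ⟨B, hB⟩ := T.bddAbove
  refine ⟨(B : ℤ) + 1, ?_⟩
  have h3 := cfg_pos_sub_of_le ξ (by positivity : (0 : ℤ) ≤ (B : ℤ) + 1)
  rw [cfg_pos_zero, sub_zero] at h3
  rw [h3]
  have h4 : T.map ⟨fun n : ℕ => (n : ℤ) + 1, fun x y h => by simpa using h⟩ ⊆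
      Finset.Ioc 0 ((B : ℤ) + 1) := by
    intro x hx
    simp only [Finset.mem_map] at hx
    obtain ⟨n, hn, rfl⟩ := hx
    have : n ≤ B := hB hn
    rw [Finset.mem_Ioc]
    change 0 < (n : ℤ) + 1 ∧ (n : ℤ) + 1 ≤ (B : ℤ) + 1
    omega
  calc r < K * ε := by rwa [div_lt_iff₀ hε] at hK
    _ = ∑ n ∈ T, ε := by rw [Finset.sum_const, hcard, nsmul_eq_mul]
    _ ≤ ∑ n ∈ T, (ξ ((n : ℤ) + 1)).1 := by
      refine Finset.sum_le_sum fun n hn => ?_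
      have : ξ ((n : ℤ) + 1) ∈ Set.Ioi ε ×ˢ Set.univ := hT hn
      exact le_of_lt this.1
    _ = ∑ k ∈ T.map ⟨fun n : ℕ => (n : ℤ) + 1, fun x y h => by simpa using h⟩, (ξ k).1 := by
      rw [Finset.sum_map]
      rfl
    _ ≤ _ := Finset.sum_le_sum_of_subset_of_nonneg h4 fun k _ _ => (hpos k).le

/-- The configuration is almost surely good. -/
theorem ae_good (hm : m (Set.Iic 0) = 0) : ∀ᵐ ξ ∂processLaw p m, (cfg ξ).Good := by
  have hgap : ∀ᵐ ξ ∂processLaw p m, ∀ n, 0 < (ξ n).1 := by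
    rw [ae_all_iff]
    intro n
    have h := processLaw_mark (p := p) (m := m) n (B := Set.Iic 0 ×ˢ Set.univ)
      (measurableSet_Iic.prod .univ)
    rw [Measure.prod_prod, hm, zero_mul] at h
    refine measure_mono_null (fun ξ hξ => ?_) h
    simpa using hξ
  have hvel : ∀ᵐ ξ ∂processLaw p m, ∀ n,
      (ξ n).2.1 = -1 ∨ (ξ n).2.1 = 0 ∨ (ξ n).2.1 = 1 := by
    rw [ae_all_iff]
    intro n
    have h := processLaw_mark (p := p) (m := m) n (B := Set.univ ×ˢ ({-1, 0, 1}ᶜ ×ˢ Set.univ))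
      (MeasurableSet.univ.prod ((MeasurableSet.of_discrete).prod .univ))
    have h0 : velLaw p {-1, 0, 1}ᶜ = 0 := by simp [velLaw]
    rw [Measure.prod_prod, Measure.prod_prod, h0, zero_mul, mul_zero] at h
    refine measure_mono_null (fun ξ hξ => ?_) h
    simpa [not_or] using hξ
  have hspin : ∀ᵐ ξ ∂processLaw p m, ∀ n, (ξ n).2.2 = 1 ∨ (ξ n).2.2 = -1 := by
    rw [ae_all_iff]
    intro n
    have h := processLaw_mark (p := p) (m := m) n (B := Set.univ ×ˢ (Set.univ ×ˢ {1, -1}ᶜ))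
      (MeasurableSet.univ.prod (MeasurableSet.univ.prod (MeasurableSet.of_discrete)))
    have h0 : spinLaw {1, -1}ᶜ = 0 := by simp [spinLaw]
    rw [Measure.prod_prod, Measure.prod_prod, h0, mul_zero, mul_zero] at h
    refine measure_mono_null (fun ξ hξ => ?_) h
    simpa [not_or] using hξ
  have hR := processLaw_pos_unbounded (p := p) hm
  have hL := (measurePreserving_reflMarks (p := p) (m := m)).quasiMeasurePreserving.ae hR
  filter_upwards [hgap, hvel, hspin, hR, hL] with ξ h1 h2 h3 h4 h5
  have hmono : StrictMono (cfg ξ).pos := by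
    refine strictMono_int_of_lt_succ fun n => ?_
    have := cfg_pos_sub ξ (n + 1)
    rw [add_sub_cancel_right] at this
    linarith [h1 (n + 1)]
  refine ⟨hmono, h2, h3, fun r => ?_⟩
  obtain ⟨N, hN⟩ := h4 h1 r
  obtain ⟨N', hN'⟩ := h5 (fun n => h1 _) r
  rw [cfg_reflMarks] at hN'
  simp only [Config.refl] at hN'
  refine (Set.finite_Ioo (-N') N).subset fun k hk => ?_
  have hk' := abs_le.1 (show |(cfg ξ).pos k| ≤ r from hk)
  constructor
  · exact hmono.lt_iff_lt.1 (by linarith)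
  · exact hmono.lt_iff_lt.1 (by linarith)

end BallisticAnnihilation

/-! ### Reversal of a window, and the probabilities of blocks and races -/

namespace BallisticAnnihilation
variable {c c' : Config} {I I' : Set ℤ} {i j k a : ℤ}

/-- The configuration in which the particles `1, …, N` are put in reverse order. -/
def Config.rev (c : Config) (N : ℤ) : Config := (c.shift (N + 1)).refl

lemma Config.Good.rev (hc : c.Good) (N : ℤ) : (c.rev N).Good := (hc.shift _).refl

lemma rev_vel (c : Config) (N i : ℤ) : (c.rev N).vel i = -c.vel (N + 1 - i) := by
  simp only [Config.rev, Config.refl, Config.shift]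
  rw [show -i + (N + 1) = N + 1 - i by ring]

lemma rev_spin (c : Config) (N i : ℤ) : (c.rev N).spin i = -c.spin (N + 1 - i) := by
  simp only [Config.rev, Config.refl, Config.shift]
  rw [show -i + (N + 1) = N + 1 - i by ring]

lemma rev_pos_sub (c : Config) (N i j : ℤ) :
    (c.rev N).pos j - (c.rev N).pos i = c.pos (N + 1 - i) - c.pos (N + 1 - j) := by
  simp only [Config.rev, Config.refl, Config.shift]
  rw [show -i + (N + 1) = N + 1 - i by ring, show -j + (N + 1) = N + 1 - j by ring]
  ring

lemma mate_rev (hc : c.Good) (N x y : ℤ) : Mate (c.rev N) (Set.Ioc x y) i j ↔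
    Mate c (Set.Ioc (N - y) (N - x)) (N + 1 - i) (N + 1 - j) := by
  have h1 : Set.Ioc x y = (fun n => -n) ⁻¹' ((· + (N + 1)) ⁻¹' Set.Ioc (N - y) (N - x)) := by
    ext z
    simp only [Set.mem_Ioc, Set.mem_preimage]
    omega
  rw [h1, Config.rev, mate_refl (hc.shift _), mate_shift hc]
  rw [show -i + (N + 1) = N + 1 - i by ring, show -j + (N + 1) = N + 1 - j by ring]

lemma mate_shift_Ioc (hc : c.Good) (a x y : ℤ) : Mate (c.shift a) (Set.Ioc x y) i j ↔
    Mate c (Set.Ioc (x + a) (y + a)) (i + a) (j + a) := by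
  rw [← mate_shift hc]
  have : Set.Ioc x y = (· + a) ⁻¹' Set.Ioc (x + a) (y + a) := by
    ext z
    simp
  rw [this]

lemma noArr_shift (hc : c.Good) (a k : ℤ) : NoArr (c.shift a) k ↔ NoArr c (k + a) := by
  unfold NoArr
  constructor
  · intro h n hn
    refine h (n - a) ?_
    rw [arr_shift hc]
    simpa using hn
  · intro h n hn
    exact h _ ((arr_shift hc a).1 hn)

lemma isBlock_shift (hc : c.Good) (a k : ℤ) (n : ℕ) (σ : Shape) :
    IsBlock (c.shift a) k n σ ↔ IsBlock c (k + a) n σ := by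
  have e1 : k + 1 + a = k + a + 1 := by ring
  have e2 : k + 1 + n + a = k + a + 1 + n := by ring
  have hv : ∀ i, (c.shift a).vel i = c.vel (i + a) := fun _ => rfl
  cases σ <;> simp only [IsBlock, firstArr_shift hc, mate_shift_Ioc hc, hv, e1, e2]

lemma blockChainIn_shift (hc : c.Good) (a : ℤ) (l : List (Set (ℕ × Shape))) :
    ∀ k, BlockChainIn (c.shift a) k l ↔ BlockChainIn c (k + a) l := by
  induction l with
  | nil => exact fun k => noArr_shift hc a k
  | cons s l ih =>
    intro k
    simp only [BlockChainIn, isBlock_shift hc, ih]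
    refine exists_congr fun b => and_congr_right fun _ => and_congr_right fun _ => ?_
    rw [show k + 1 + (b.1 : ℤ) + a = k + a + 1 + b.1 by ring]

lemma SameOn.isBlock {n : ℕ} (h : SameOn c c' (Set.Ioc k (k + 1 + n))) (σ : Shape) :
    IsBlock c k n σ ↔ IsBlock c' k n σ := by
  have h1 : c.vel (k + 1) = c'.vel (k + 1) := h.vel _ ⟨by omega, by omega⟩
  have h2 : c.vel (k + 1 + n) = c'.vel (k + 1 + n) := h.vel _ ⟨by omega, le_rfl⟩
  have h3 := (h.mono (Set.Ioc_subset_Ioc_left (by omega : k ≤ k + 1))).firstArr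
  cases σ <;> simp only [IsBlock, h1, h2, h.mate, h3]

lemma SameOn.blockChainIn (l : List (Set (ℕ × Shape))) :
    ∀ k, SameOn c c' (Set.Ioi k) → (BlockChainIn c k l ↔ BlockChainIn c' k l) := by
  induction l with
  | nil => exact fun k h => h.noArr
  | cons s l ih =>
    intro k h
    simp only [BlockChainIn]
    refine exists_congr fun b => and_congr_right fun _ => and_congr ?_ ?_
    · exact (h.mono Set.Ioc_subset_Ioi_self).isBlock _
    · exact ih _ (h.mono (Set.Ioi_subset_Ioi (by omega)))

lemma sameOn_keepMarks (ξ : ℤ → ℝ × ℤ × ℤ) {W : Set ℤ} (hI : I.OrdConnected) (h : I ⊆ W) :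
    SameOn (cfg ξ) (cfg (keepMarks W ξ)) I :=
  sameOn_cfg hI fun _ hi => (keepMarks_of_mem ξ (h hi)).symm

section Probability

variable {p : ℝ} {m : Measure ℝ} [IsProbabilityMeasure m] [IsProbabilityMeasure (velLaw p)]

/-- The probability of an event on marks. -/
noncomputable def prob (p : ℝ) (m : Measure ℝ) [IsProbabilityMeasure m]
    [IsProbabilityMeasure (velLaw p)] (E : (ℤ → ℝ × ℤ × ℤ) → Prop) : ℝ :=
  (processLaw p m).real {ξ | E ξ}

lemma prob_nonneg (E : (ℤ → ℝ × ℤ × ℤ) → Prop) : 0 ≤ prob p m E := measureReal_nonneg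

lemma prob_mono {E E' : (ℤ → ℝ × ℤ × ℤ) → Prop} (h : ∀ ξ, E ξ → E' ξ) :
    prob p m E ≤ prob p m E' := measureReal_mono h

/-- The deterministic equivalences hold for good configurations, which have full probability. -/
lemma prob_congr (hm : m (Set.Iic 0) = 0) {E E' : (ℤ → ℝ × ℤ × ℤ) → Prop}
    (h : ∀ ξ, (cfg ξ).Good → (E ξ ↔ E' ξ)) : prob p m E = prob p m E' := by
  refine measureReal_congr ?_
  filter_upwards [ae_good (p := p) hm] with ξ hξ
  exact propext (h ξ hξ)

lemma prob_inter {E E' : (ℤ → ℝ × ℤ × ℤ) → Prop} {W W' : Set ℤ} (hE : Measurable E)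
    (hE' : Measurable E') (hW : ∀ ξ, E ξ ↔ E (keepMarks W ξ))
    (hW' : ∀ ξ, E' ξ ↔ E' (keepMarks W' ξ)) (hd : Disjoint W W') :
    prob p m (fun ξ => E ξ ∧ E' ξ) = prob p m E * prob p m E' := by
  unfold prob Measure.real
  rw [processLaw_inter hE hE' hW hW' hd, ENNReal.toReal_mul]

lemma prob_shift (hm : m (Set.Iic 0) = 0) {E E' : Config → Prop}
    (hE : Measurable fun ξ => E (cfg ξ)) (a : ℤ)
    (h : ∀ c : Config, c.Good → (E' c ↔ E (c.shift a))) :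
    prob p m (fun ξ => E' (cfg ξ)) = prob p m (fun ξ => E (cfg ξ)) := by
  rw [prob_congr hm (fun ξ hξ => h _ hξ)]
  have := (measurePreserving_shiftMarks (p := p) (m := m) a).measureReal_preimage
    (measurableSet_setOfPred.2 hE).nullMeasurableSet
  simp only [← cfg_shiftMarks]
  exact this

lemma prob_refl (hm : m (Set.Iic 0) = 0) {E E' : Config → Prop}
    (hE : Measurable fun ξ => E (cfg ξ)) (h : ∀ c : Config, c.Good → (E' c ↔ E c.refl)) :
    prob p m (fun ξ => E' (cfg ξ)) = prob p m (fun ξ => E (cfg ξ)) := by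
  rw [prob_congr hm (fun ξ hξ => h _ hξ)]
  have := (measurePreserving_reflMarks (p := p) (m := m)).measureReal_preimage
    (measurableSet_setOfPred.2 hE).nullMeasurableSet
  simp only [← cfg_reflMarks]
  exact this

lemma prob_rev (hm : m (Set.Iic 0) = 0) {E E' : Config → Prop}
    (hE : Measurable fun ξ => E (cfg ξ)) (N : ℤ)
    (h : ∀ c : Config, c.Good → (E' c ↔ E (c.rev N))) :
    prob p m (fun ξ => E' (cfg ξ)) = prob p m (fun ξ => E (cfg ξ)) := by
  have h1 : prob p m (fun ξ => E' (cfg ξ)) = prob p m (fun ξ => E (cfg ξ).refl) := by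
    refine prob_shift (E := fun c => E c.refl) hm ?_ (N + 1) h
    have := hE.comp measurable_reflMarks
    simpa only [Function.comp_def, cfg_reflMarks] using this
  rw [h1]
  exact prob_refl hm hE fun c _ => Iff.rfl

lemma prob_sum (hm : m (Set.Iic 0) = 0) {ι : Type*} (S : Finset ι) {E : (ℤ → ℝ × ℤ × ℤ) → Prop}
    {F : ι → (ℤ → ℝ × ℤ × ℤ) → Prop} (hF : ∀ i, Measurable (F i))
    (h : ∀ ξ, (cfg ξ).Good → (E ξ ↔ ∃ i ∈ S, F i ξ))
    (hd : ∀ ξ, (cfg ξ).Good → ∀ i ∈ S, ∀ j ∈ S, F i ξ → F j ξ → i = j) :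
    prob p m E = ∑ i ∈ S, prob p m (F i) := by
  rw [prob_congr hm h]
  unfold prob
  rw [← measureReal_biUnion_finset₀]
  · congr 1
    ext ξ
    simp
  · intro i hi j hj hij
    refine measure_mono_null (t := {ξ | ¬ (cfg ξ).Good}) ?_ (ae_good (p := p) hm)
    rintro ξ ⟨h1, h2⟩ hg
    exact hij (hd ξ hg i hi j hj h1 h2)
  · exact fun i _ => (measurableSet_setOfPred.2 (hF i)).nullMeasurableSet

lemma prob_and_not {E E' : (ℤ → ℝ × ℤ × ℤ) → Prop} (hE' : Measurable E') :
    prob p m (fun ξ => E ξ ∧ E' ξ) + prob p m (fun ξ => E ξ ∧ ¬ E' ξ) = prob p m E := by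
  unfold prob
  exact measureReal_inter_add_sdiff (s := {ξ | E ξ}) (t := {ξ | E' ξ}) (measurableSet_setOfPred.2 hE')

lemma prob_vel_zero (hp : 0 ≤ p) (n : ℤ) : prob p m (fun ξ => (cfg ξ).vel n = 0) = p := by
  unfold prob Measure.real
  rw [processLaw_vel]
  simp [velLaw, hp]

lemma prob_vel_one (hp : p ≤ 1) (n : ℤ) :
    prob p m (fun ξ => (cfg ξ).vel n = 1) = (1 - p) / 2 := by
  unfold prob Measure.real
  rw [processLaw_vel]
  have : 0 ≤ (1 - p) / 2 := by linarith
  simp [velLaw, this]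

lemma prob_vel_neg_one (hp : p ≤ 1) (n : ℤ) :
    prob p m (fun ξ => (cfg ξ).vel n = -1) = (1 - p) / 2 := by
  unfold prob Measure.real
  rw [processLaw_vel]
  have : 0 ≤ (1 - p) / 2 := by linarith
  simp [velLaw, this]

/-- The probability that `n` is the first particle to reach `0`. -/
noncomputable def firstProb (p : ℝ) (m : Measure ℝ) [IsProbabilityMeasure m]
    [IsProbabilityMeasure (velLaw p)] (n : ℕ) : ℝ := prob p m fun ξ => FirstArr (cfg ξ) 0 n

/-- The probability that `n` reaches `0`. -/
noncomputable def arrProb (p : ℝ) (m : Measure ℝ) [IsProbabilityMeasure m]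
    [IsProbabilityMeasure (velLaw p)] (n : ℕ) : ℝ := prob p m fun ξ => Arr (cfg ξ) 0 n

/-- The probability that particles `1` and `1 + n` move towards each other and annihilate. -/
noncomputable def pairProb (p : ℝ) (m : Measure ℝ) [IsProbabilityMeasure m]
    [IsProbabilityMeasure (velLaw p)] (n : ℕ) : ℝ :=
  prob p m fun ξ => IsBlock (cfg ξ) 0 n .rightLeft

lemma prob_firstArr (hm : m (Set.Iic 0) = 0) (k : ℤ) (n : ℕ) :
    prob p m (fun ξ => FirstArr (cfg ξ) k (k + n)) = firstProb p m n :=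
  prob_shift (E := fun c => FirstArr c 0 n) (E' := fun c => FirstArr c k (k + n)) hm
    (measurable_firstArr _ _) k fun c hc => by
      rw [firstArr_shift hc]
      simp [add_comm]

lemma prob_arr (hm : m (Set.Iic 0) = 0) (k : ℤ) (n : ℕ) :
    prob p m (fun ξ => Arr (cfg ξ) k (k + n)) = arrProb p m n :=
  prob_shift (E := fun c => Arr c 0 n) (E' := fun c => Arr c k (k + n)) hm
    (measurable_arr _ _) k fun c hc => by
      rw [arr_shift hc]
      simp [add_comm]

/-- What happens up to particle `k` is independent of what happens after. -/
lemma prob_inter_of_sameOn {k : ℤ} {E E' : Config → Prop} (hE : Measurable fun ξ => E (cfg ξ))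
    (hE' : Measurable fun ξ => E' (cfg ξ))
    (h : ∀ c c', SameOn c c' (Set.Iic k) → (E c ↔ E c'))
    (h' : ∀ c c', SameOn c c' (Set.Ioi k) → (E' c ↔ E' c')) :
    prob p m (fun ξ => E (cfg ξ) ∧ E' (cfg ξ)) =
      prob p m (fun ξ => E (cfg ξ)) * prob p m (fun ξ => E' (cfg ξ)) :=
  prob_inter (W := Set.Iic k) (W' := Set.Ioi k) hE hE'
    (fun ξ => h _ _ (sameOn_keepMarks ξ Set.ordConnected_Iic le_rfl))
    (fun ξ => h' _ _ (sameOn_keepMarks ξ Set.ordConnected_Ioi le_rfl)) (Set.Iic_disjoint_Ioi le_rfl)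

lemma prob_isBlock_upLeft (hm : m (Set.Iic 0) = 0) (hp : 0 ≤ p) (n : ℕ) :
    prob p m (fun ξ => IsBlock (cfg ξ) 0 n .upLeft) = p * firstProb p m n := by
  have h := prob_inter_of_sameOn (p := p) (m := m) (k := 0 + 1) (E := fun c => c.vel (0 + 1) = 0)
    (E' := fun c => FirstArr c (0 + 1) (0 + 1 + n)) (measurable_cfg_vel_eq _ _)
    (measurable_firstArr _ _) (fun c c' h => by rw [h.vel (0 + 1) (by simp)])
    fun c c' h => (h.mono Set.Ioc_subset_Ioi_self).firstArr
  rw [prob_vel_zero hp, prob_firstArr hm] at h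
  exact h

/-- Reversing the window of the block turns the shape `rightUp` into `upLeft`, and in the reversed
window being the partner of the static particle means being the first arrival at it. -/
lemma prob_isBlock_rightUp (hm : m (Set.Iic 0) = 0) (hp : 0 ≤ p) (n : ℕ) :
    prob p m (fun ξ => IsBlock (cfg ξ) 0 n .rightUp) = p * firstProb p m n := by
  rw [← prob_isBlock_upLeft hm hp]
  refine prob_rev (E := fun c => IsBlock c 0 n .upLeft) (E' := fun c => IsBlock c 0 n .rightUp) hm
    (measurable_isBlock _ _ _) (n + 1) fun c hc => ?_
  have hI := startsAfter_Ioc 0 (0 + 1 + (n : ℤ))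
  have e1 : (n : ℤ) + 1 + 1 - (0 + 1) = 0 + 1 + n := by ring
  have e2 : (n : ℤ) + 1 + 1 - (0 + 1 + n) = 0 + 1 := by ring
  have e3 : (n : ℤ) + 1 - (0 + 1 + n) = 0 := by ring
  have e4 : (n : ℤ) + 1 - 0 = 0 + 1 + n := by ring
  have hv : (c.rev (n + 1)).vel (0 + 1) = 0 ↔ c.vel (0 + 1 + n) = 0 := by
    rw [rev_vel, e1, neg_eq_zero]
  have key : IsBlock (c.rev (n + 1)) 0 n .upLeft ↔ c.vel (0 + 1 + n) = 0 ∧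
      Mate c (Set.Ioc 0 (0 + 1 + n)) (0 + 1) (0 + 1 + n) := by
    simp only [IsBlock, hv]
    refine and_congr_right fun h => ?_
    rw [← mate_static_iff (hc.rev _) hI (hv.2 h) (by simp only [Set.mem_Ioc]; omega),
      mate_rev hc, e1, e2, e3, e4]
    exact ⟨Mate.symm, Mate.symm⟩
  rw [key]
  simp only [IsBlock]
  refine ⟨fun h => h.2, fun h => ⟨?_, h⟩⟩
  obtain ⟨t, ht⟩ := h.2.meet hc
  have hlt : (0 : ℤ) + 1 < 0 + 1 + n := by
    have := ht.1
    omega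
  have := ht.vel_lt hc hlt
  have := hc.vel (0 + 1)
  omega

lemma prob_isBlock_and_firstArr (hm : m (Set.Iic 0) = 0) (n b : ℕ) (σ : Shape) :
    prob p m (fun ξ => IsBlock (cfg ξ) 0 n σ ∧ FirstArr (cfg ξ) (0 + 1 + n) (0 + 1 + n + b)) =
      prob p m (fun ξ => IsBlock (cfg ξ) 0 n σ) * firstProb p m b := by
  rw [← prob_firstArr hm (0 + 1 + n) b]
  exact prob_inter_of_sameOn (k := 0 + 1 + n) (E := fun c => IsBlock c 0 n σ)
    (E' := fun c => FirstArr c (0 + 1 + n) (0 + 1 + n + b)) (measurable_isBlock _ _ _)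
    (measurable_firstArr _ _) (fun c c' h => (h.mono fun x hx => hx.2).isBlock σ)
    fun c c' h => (h.mono Set.Ioc_subset_Ioi_self).firstArr

/-- The static particle `j` is reached by `i` from the left before it is reached by `k` from the
right. -/
def LeftWins (c : Config) (i j k : ℤ) : Prop :=
  c.pos j - c.pos i < c.pos k - c.pos j ∨ (c.pos j - c.pos i = c.pos k - c.pos j ∧ c.spin j = -1)

lemma measurable_leftWins (i j k : ℤ) : Measurable fun ξ => LeftWins (cfg ξ) i j k := by
  have h1 : Measurable fun ξ => (cfg ξ).pos j - (cfg ξ).pos i :=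
    (measurable_cfg_pos j).sub (measurable_cfg_pos i)
  have h2 : Measurable fun ξ => (cfg ξ).pos k - (cfg ξ).pos j :=
    (measurable_cfg_pos k).sub (measurable_cfg_pos j)
  exact (Measurable.lt_prop h1 h2).or ((Measurable.eq_prop h1 h2).and (measurable_cfg_spin_eq _ _))

/-- Particles `1` and `1 + a + b` both reach the static particle `1 + a`, from the left and from
the right. -/
def Race (c : Config) (a b : ℕ) : Prop :=
  IsBlock c 0 a .rightUp ∧ FirstArr c (0 + 1 + a) (0 + 1 + a + b)

lemma measurable_race (a b : ℕ) : Measurable fun ξ => Race (cfg ξ) a b :=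
  (measurable_isBlock _ _ _).and (measurable_firstArr _ _)

/-- The winner of the race is reversed by reflection. -/
lemma prob_race_not_leftWins (hm : m (Set.Iic 0) = 0) (a b : ℕ) :
    prob p m (fun ξ => Race (cfg ξ) a b ∧ ¬ LeftWins (cfg ξ) (0 + 1) (0 + 1 + a) (0 + 1 + a + b)) =
      prob p m
        (fun ξ => Race (cfg ξ) b a ∧ LeftWins (cfg ξ) (0 + 1) (0 + 1 + b) (0 + 1 + b + a)) := by
  refine prob_rev (E := fun c => Race c b a ∧ LeftWins c (0 + 1) (0 + 1 + b) (0 + 1 + b + a))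
    (E' := fun c => Race c a b ∧ ¬ LeftWins c (0 + 1) (0 + 1 + a) (0 + 1 + a + b)) hm
    ((measurable_race _ _).and (measurable_leftWins _ _ _)) (a + b + 1) fun c hc => ?_
  have hI := startsAfter_Ioc (b : ℤ) (0 + 1 + b + a)
  have hI' := startsAfter_Ioc (a : ℤ) (0 + 1 + a + b)
  have e1 : (a : ℤ) + b + 1 + 1 - (0 + 1) = 0 + 1 + a + b := by ring
  have e2 : (a : ℤ) + b + 1 + 1 - (0 + 1 + b) = 0 + 1 + a := by ring
  have e3 : (a : ℤ) + b + 1 + 1 - (0 + 1 + b + a) = 0 + 1 := by ring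
  have e4 : (a : ℤ) + b + 1 - (0 + 1 + b) = a := by ring
  have e5 : (a : ℤ) + b + 1 - 0 = 0 + 1 + a + b := by ring
  have e6 : (a : ℤ) + b + 1 - (0 + 1 + b + a) = 0 := by ring
  have e7 : (a : ℤ) + b + 1 - b = 0 + 1 + a := by ring
  have e8 : (b : ℤ) + 1 = 0 + 1 + b := by ring
  have e9 : (a : ℤ) + 1 = 0 + 1 + a := by ring
  set c' := c.rev (a + b + 1) with hc'
  have hv : c'.vel (0 + 1 + b) = 0 ↔ c.vel (0 + 1 + a) = 0 := by
    rw [hc', rev_vel, e2, neg_eq_zero]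
  have hv1 : c'.vel (0 + 1) = 1 ↔ c.vel (0 + 1 + a + b) = -1 := by
    rw [hc', rev_vel, e1]
    omega
  have key1 : c.vel (0 + 1 + a) = 0 → (Mate c' (Set.Ioc 0 (0 + 1 + b)) (0 + 1) (0 + 1 + b) ↔
      FirstArr c (0 + 1 + a) (0 + 1 + a + b)) := by
    intro h
    rw [← e9] at h
    have := mate_static_iff hc hI' h (k := 0 + 1 + a + b) (by simp only [Set.mem_Ioc]; omega)
    rw [e9] at this
    rw [← this, hc', mate_rev hc, e1, e2, e4, e5]
    exact ⟨Mate.symm, Mate.symm⟩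
  have key2 : c.vel (0 + 1 + a) = 0 → (FirstArr c' (0 + 1 + b) (0 + 1 + b + a) ↔
      Mate c (Set.Ioc 0 (0 + 1 + a)) (0 + 1) (0 + 1 + a)) := by
    intro h
    have h' := hv.2 h
    rw [← e8] at h'
    have := mate_static_iff (hc.rev _) hI h' (k := 0 + 1 + b + a) (by simp only [Set.mem_Ioc]; omega)
    rw [e8] at this
    rw [← this, mate_rev hc, e2, e3, e6, e7]
    exact ⟨Mate.symm, Mate.symm⟩
  -- Reversal exchanges the two distances to the static particle and negates its spin, so it
  -- reverses the outcome even when the distances are equal.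
  have hw : LeftWins c' (0 + 1) (0 + 1 + b) (0 + 1 + b + a) ↔
      ¬ LeftWins c (0 + 1) (0 + 1 + a) (0 + 1 + a + b) := by
    simp only [LeftWins, hc', rev_pos_sub, rev_spin, e1, e2, e3]
    have hs := hc.spin (0 + 1 + a)
    generalize c.pos (0 + 1 + a + b) - c.pos (0 + 1 + a) = A
    generalize c.pos (0 + 1 + a) - c.pos (0 + 1) = B
    rcases lt_trichotomy A B with h | h | h
    · simp [h, h.not_gt, h.ne']
    · rw [h]
      simp only [lt_irrefl, false_or, true_and]
      omega
    · simp [h, h.not_gt, h.ne']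
  simp only [Race, IsBlock]
  rw [hw, hv, hv1]
  constructor
  · rintro ⟨⟨⟨-, h2, h3⟩, h4⟩, h5⟩
    exact ⟨⟨⟨h4.1.2.1, h2, (key1 h2).2 h4⟩, (key2 h2).2 h3⟩, h5⟩
  · rintro ⟨⟨⟨h1, h2, h3⟩, h4⟩, h5⟩
    refine ⟨⟨⟨?_, h2, (key2 h2).1 h4⟩, (key1 h2).1 h3⟩, h5⟩
    have := h4.1.2.1
    rw [hc', rev_vel, e3] at this
    omega

/-- The probability that, of the two particles that reach the static particle `1 + a`, the first
one comes from the left. -/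
noncomputable def raceProb (p : ℝ) (m : Measure ℝ) [IsProbabilityMeasure m]
    [IsProbabilityMeasure (velLaw p)] (a b : ℕ) : ℝ :=
  prob p m fun ξ => Race (cfg ξ) a b ∧ LeftWins (cfg ξ) (0 + 1) (0 + 1 + a) (0 + 1 + a + b)

/-- The total probability of the races with a given number of particles. -/
lemma sum_race (hm : m (Set.Iic 0) = 0) (hp : 0 ≤ p) (N : ℕ) :
    2 * ∑ x ∈ Finset.HasAntidiagonal.antidiagonal N, raceProb p m x.1 x.2 =
      p * ∑ x ∈ Finset.HasAntidiagonal.antidiagonal N, firstProb p m x.1 * firstProb p m x.2 := by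
  -- A race is won by one side or the other, and the races won by the right are reversed into races
  -- of swapped lengths won by the left. Symmetry thus holds after summing over a fixed total
  -- length, not for each pair of lengths.
  have h1 : ∀ a b, raceProb p m a b + raceProb p m b a =
      p * (firstProb p m a * firstProb p m b) := by
    intro a b
    rw [← mul_assoc, ← prob_isBlock_rightUp hm hp, ← prob_isBlock_and_firstArr hm]
    simp only [raceProb]
    rw [← prob_race_not_leftWins hm a b]
    exact prob_and_not (E := fun ξ => Race (cfg ξ) a b) (measurable_leftWins _ _ _)
  have h2 := Finset.Nat.sum_antidiagonal_swap (n := N) (f := fun x => raceProb p m x.1 x.2)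
  simp only [Prod.fst_swap, Prod.snd_swap] at h2
  rw [two_mul]
  conv_lhs => enter [2]; rw [← h2]
  rw [← Finset.sum_add_distrib, Finset.mul_sum]
  exact Finset.sum_congr rfl fun x _ => h1 _ _

end Probability

end BallisticAnnihilation

/-! ### Recursions for arrivals and annihilations -/

namespace BallisticAnnihilation
variable {c c' : Config} {I I' : Set ℤ} {i j k a : ℤ}

lemma Mate.right_cases (hc : c.Good) (hI : StartsAfter I a) (h : Mate c I (a + 1) j)
    (hv : c.vel (a + 1) ≠ -1) : a + 1 < j ∧
      ((c.vel (a + 1) = 0 ∧ c.vel j = -1) ∨ (c.vel (a + 1) = 1 ∧ c.vel j = 0) ∨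
        (c.vel (a + 1) = 1 ∧ c.vel j = -1)) := by
  obtain ⟨t, ht⟩ := h.meet hc
  have h1 := hI.le j (h.mem_right hc)
  have h2 : a + 1 < j := lt_of_le_of_ne h1 ht.1
  have h3 := ht.vel_lt hc h2
  have h4 := hc.vel (a + 1)
  have h5 := hc.vel j
  refine ⟨h2, ?_⟩
  revert hv
  omega

/-- Later arrivals at the static particle come from farther away, so only the first one matters in
the race. -/
lemma Race.mate_iff (hc : c.Good) {a b : ℕ} (h : Race c a b) (hI : StartsAfter I 0)
    (hn : 0 + 1 + (a : ℤ) + b ∈ I) :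
    Mate c I (0 + 1) (0 + 1 + a) ↔ LeftWins c (0 + 1) (0 + 1 + a) (0 + 1 + a + b) := by
  obtain ⟨⟨h1, h2, h3⟩, h4⟩ := h
  have hj : 0 + 1 + (a : ℤ) ∈ I := (hI _ hn).2 ⟨by omega, by omega⟩
  rw [mate_right_static_iff hc hI h1 hj h2]
  refine ⟨fun h => h.2 _ hn h4.1, fun h => ⟨h3, fun k _ hk => ?_⟩⟩
  have hle := h4.2 k hk
  rcases hle.eq_or_lt with rfl | hlt
  · exact h
  · have := hc.mono hlt
    left
    rcases h with h | h
    · linarith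
    · linarith [h.1]

lemma not_firstArr_self (c : Config) (a : ℤ) : ¬ FirstArr c a a := fun h => lt_irrefl _ h.1.1

section Probability

variable {p : ℝ} {m : Measure ℝ} [IsProbabilityMeasure m] [IsProbabilityMeasure (velLaw p)]

lemma prob_false : prob p m (fun _ => False) = 0 := by simp [prob]

lemma prob_true : prob p m (fun _ => True) = 1 := by simp [prob]

lemma firstProb_zero : firstProb p m 0 = 0 := by
  have : (fun ξ => FirstArr (cfg ξ) 0 (0 : ℕ)) = fun _ => False :=
    funext fun ξ => propext (iff_false_intro (not_firstArr_self _ _))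
  rw [firstProb, this, prob_false]

lemma arrProb_zero : arrProb p m 0 = 0 := by
  have : (fun ξ => Arr (cfg ξ) 0 (0 : ℕ)) = fun _ => False :=
    funext fun ξ => propext (iff_false_intro fun h => lt_irrefl _ h.1)
  rw [arrProb, this, prob_false]

/-- The three terms are the three kinds of annihilation of the first particle. For a right-static
pair, the next arrival is also the opponent in the race, so the second factor is not independent of
the first annihilation and a race probability appears. -/
lemma prob_mate_firstArr (hm : m (Set.Iic 0) = 0) (hp : 0 ≤ p) (a b : ℕ) :
    prob p m (fun ξ => (Mate (cfg ξ) (Set.Ioi 0) (0 + 1) (0 + 1 + a) ∧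
        FirstArr (cfg ξ) (0 + 1 + a) (0 + 1 + a + b)) ∧ ¬ (cfg ξ).vel (0 + 1) = -1) =
      p * (firstProb p m a * firstProb p m b) + raceProb p m a b +
        pairProb p m a * firstProb p m b := by
  set E : (ℤ → ℝ × ℤ × ℤ) → Prop := fun ξ => (Mate (cfg ξ) (Set.Ioi 0) (0 + 1) (0 + 1 + a) ∧
        FirstArr (cfg ξ) (0 + 1 + a) (0 + 1 + a + b)) ∧ ¬ (cfg ξ).vel (0 + 1) = -1 with hE
  have hI := startsAfter_Ioi 0
  have hj : (0 + 1 + (a : ℤ)) ∈ Set.Ioi 0 := by simp only [Set.mem_Ioi]; omega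
  have hn : (0 + 1 + (a : ℤ) + b) ∈ Set.Ioi 0 := by simp only [Set.mem_Ioi]; omega
  have h1 := prob_and_not (p := p) (m := m) (E := E) (measurable_cfg_vel_eq (0 + 1) 0)
  have h2 := prob_and_not (p := p) (m := m)
    (E := fun ξ => E ξ ∧ ¬ (cfg ξ).vel (0 + 1) = 0) (measurable_cfg_vel_eq (0 + 1 + a) 0)
  have h3 := prob_isBlock_and_firstArr (p := p) hm a b .upLeft
  have h4 := prob_isBlock_and_firstArr (p := p) hm a b .rightLeft
  rw [prob_isBlock_upLeft hm hp, mul_assoc] at h3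
  rw [← h1, ← h2, ← h3, pairProb, ← h4, raceProb, add_assoc (prob p m _)]
  congr 1
  · refine prob_congr hm fun ξ hξ => ?_
    simp only [hE, IsBlock]
    constructor
    · rintro ⟨⟨⟨h, h'⟩, -⟩, hv⟩
      exact ⟨⟨hv, (mate_static_iff hξ hI hv hj).1 h⟩, h'⟩
    · rintro ⟨⟨hv, h⟩, h'⟩
      exact ⟨⟨⟨(mate_static_iff hξ hI hv hj).2 h, h'⟩, by omega⟩, hv⟩
  congr 1
  · refine prob_congr hm fun ξ hξ => ?_
    simp only [hE]
    constructor
    · rintro ⟨⟨⟨⟨h, h'⟩, hv⟩, hv'⟩, hw⟩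
      have h1 : (cfg ξ).vel (0 + 1) = 1 := by have := hξ.vel (0 + 1); omega
      have hR : Race (cfg ξ) a b :=
        ⟨⟨h1, hw, ((mate_right_static_iff hξ hI h1 hj hw).1 h).1⟩, h'⟩
      exact ⟨hR, (hR.mate_iff hξ hI hn).1 h⟩
    · rintro ⟨hR, h⟩
      have h1 := hR.1.1
      exact ⟨⟨⟨⟨(hR.mate_iff hξ hI hn).2 h, hR.2⟩, by omega⟩, by omega⟩, hR.1.2.1⟩
  · refine prob_congr hm fun ξ hξ => ?_
    simp only [hE, IsBlock]
    constructor
    · rintro ⟨⟨⟨⟨h, h'⟩, hv⟩, hv'⟩, hw⟩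
      obtain ⟨-, h1⟩ := h.right_cases hξ hI hv
      have h1 : (cfg ξ).vel (0 + 1) = 1 ∧ (cfg ξ).vel (0 + 1 + a) = -1 := by omega
      exact ⟨⟨h1.1, h1.2, (mate_right_left_iff hξ hI h1.1 hj h1.2).1 h⟩, h'⟩
    · rintro ⟨⟨h1, h2, h3⟩, h'⟩
      exact ⟨⟨⟨⟨(mate_right_left_iff hξ hI h1 hj h2).2 h3, h'⟩, by omega⟩, by omega⟩, by omega⟩

/-- The isolated term is the case in which particle `1` itself moves left. Otherwise `1` must
annihilate with some `1 + a`, and the first arrival at `0` is the first arrival at `1 + a`. -/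
lemma firstProb_succ (hm : m (Set.Iic 0) = 0) (hp : 0 ≤ p) (hp1 : p ≤ 1) (N : ℕ) :
    firstProb p m (N + 1) = (if N = 0 then (1 - p) / 2 else 0) +
      ∑ x ∈ Finset.HasAntidiagonal.antidiagonal N, (p * (firstProb p m x.1 * firstProb p m x.2) +
        raceProb p m x.1 x.2 + pairProb p m x.1 * firstProb p m x.2) := by
  have h1 := prob_and_not (p := p) (m := m) (E := fun ξ => FirstArr (cfg ξ) 0 (N + 1 : ℕ))
    (measurable_cfg_vel_eq (0 + 1) (-1))
  rw [firstProb, ← h1]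
  congr 1
  · split_ifs with h
    · rw [← prob_vel_neg_one (m := m) hp1 (0 + 1)]
      refine prob_congr hm fun ξ hξ => ?_
      exact ⟨fun h => h.2, fun hv => ⟨(firstArr_of_vel hξ hv).2 (by simp [h]), hv⟩⟩
    · rw [← prob_false (p := p) (m := m)]
      refine prob_congr hm fun ξ hξ => iff_false_intro fun hh => h ?_
      have := (firstArr_of_vel hξ hh.2).1 hh.1
      omega
  · simp_rw [← prob_mate_firstArr hm hp]
    refine prob_sum hm _ (fun x => ((measurable_mate _ _ _).and (measurable_firstArr _ _)).and
      (measurable_cfg_vel_eq _ _).not) (fun ξ hξ => ?_) (fun ξ hξ => ?_)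
    · constructor
      · rintro ⟨h, hv⟩
        obtain ⟨j, h2, h3⟩ := (firstArr_iff hξ hv).1 h
        have h4 := (h2.right_cases hξ (startsAfter_Ioi 0) hv).1
        have h5 := h3.1.1
        push_cast at h5 h3
        refine ⟨((j - 1).toNat, (N + 1 - j).toNat), ?_, ⟨?_, ?_⟩, hv⟩
        · rw [Finset.HasAntidiagonal.mem_antidiagonal]
          simp only
          omega
        · rwa [show 0 + 1 + ((j - 1).toNat : ℤ) = j by omega]
        · rwa [show 0 + 1 + ((j - 1).toNat : ℤ) = j by omega,
            show j + ((N + 1 - j).toNat : ℤ) = N + 1 by omega]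
      · rintro ⟨x, hx, ⟨h2, h3⟩, hv⟩
        rw [Finset.HasAntidiagonal.mem_antidiagonal] at hx
        refine ⟨(firstArr_iff hξ hv).2 ⟨_, h2, ?_⟩, hv⟩
        rwa [show ((N + 1 : ℕ) : ℤ) = 0 + 1 + (x.1 : ℤ) + x.2 by omega]
    · rintro x hx y hy ⟨⟨h, -⟩, -⟩ ⟨⟨h', -⟩, -⟩
      rw [Finset.HasAntidiagonal.mem_antidiagonal] at hx hy
      have := h.unique hξ h'
      ext <;> omega

/-- An arrival that is not the first one is an arrival in the process on the right of the first one,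
which is independent of the particles up to there. -/
lemma arrProb_eq (hm : m (Set.Iic 0) = 0) (n : ℕ) :
    arrProb p m n = firstProb p m n +
      ∑ x ∈ Finset.HasAntidiagonal.antidiagonal n, firstProb p m x.1 * arrProb p m x.2 := by
  have h1 := prob_and_not (p := p) (m := m) (E := fun ξ => Arr (cfg ξ) 0 n)
    (measurable_firstArr 0 n)
  rw [arrProb, ← h1]
  congr 1
  · exact prob_congr hm fun ξ hξ => ⟨fun h => h.2, fun h => ⟨h.1, h⟩⟩
  · have h2 : ∀ x : ℕ × ℕ, firstProb p m x.1 * arrProb p m x.2 =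
        prob p m (fun ξ => FirstArr (cfg ξ) 0 x.1 ∧ Arr (cfg ξ) x.1 (x.1 + x.2)) := by
      intro x
      rw [← prob_arr hm x.1 x.2]
      refine (prob_inter_of_sameOn (k := x.1) (E := fun c => FirstArr c 0 x.1)
        (E' := fun c => Arr c x.1 (x.1 + x.2)) (measurable_firstArr _ _) (measurable_arr _ _)
        (fun c c' h => ?_) fun c c' h => ?_).symm
      · exact SameOn.firstArr (h.mono fun x hx => hx.2)
      · exact SameOn.arr (h.mono Set.Ioc_subset_Ioi_self)
    simp_rw [h2]
    refine prob_sum hm _ (fun x => (measurable_firstArr _ _).and (measurable_arr _ _))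
      (fun ξ hξ => ?_) (fun ξ hξ => ?_)
    · constructor
      · rintro ⟨h, hf⟩
        rcases firstArr_or_noArr (cfg ξ) 0 with h3 | ⟨k, h3⟩
        · exact (h3 _ h).elim
        · have h4 := h3.1.1
          have h5 := h3.2 _ h
          have h6 : k < n := lt_of_le_of_ne h5 (by rintro rfl; exact hf h3)
          refine ⟨(k.toNat, (n - k).toNat), ?_, ?_, ?_⟩
          · rw [Finset.HasAntidiagonal.mem_antidiagonal]
            simp only
            omega
          · rwa [show (k.toNat : ℤ) = k by omega]
          · rw [show (k.toNat : ℤ) = k by omega, show k + ((n - k).toNat : ℤ) = n by omega]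
            exact (h3.1.arr_iff hξ h6).1 h
      · rintro ⟨x, hx, h3, h4⟩
        rw [Finset.HasAntidiagonal.mem_antidiagonal] at hx
        rw [show ((x.1 : ℤ) + x.2) = n by omega] at h4
        refine ⟨(h3.1.arr_iff hξ h4.1).2 h4, fun h5 => ?_⟩
        have := h3.unique h5
        have := h4.1
        omega
    · rintro x hx y hy ⟨h, -⟩ ⟨h', -⟩
      rw [Finset.HasAntidiagonal.mem_antidiagonal] at hx hy
      have := h.unique h'
      ext <;> omega

/-- The probability that particle `1` goes right and survives among the particles `1, …, n`. -/
lemma prob_free (hm : m (Set.Iic 0) = 0) (n : ℕ) :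
    prob p m (fun ξ => (cfg ξ).vel (0 + 1) = 1 ∧ Free (cfg ξ) (Set.Ioc 0 (n + 1)) (0 + 1)) =
      arrProb p m (n + 1) := by
  -- Reversing the particles `1, …, n + 1` turns a right-moving survivor at the left end into a
  -- left-moving survivor at the right end, that is, into an arrival at `0`.
  refine prob_rev (E := fun c => Arr c 0 (n + 1 : ℕ)) (E' := fun c => c.vel (0 + 1) = 1 ∧
    Free c (Set.Ioc 0 (n + 1)) (0 + 1)) hm (measurable_arr _ _) (n + 1) fun c hc => ?_
  simp only [Arr, rev_vel, Free]
  have e : (n : ℤ) + 1 + 1 - (n + 1) = 0 + 1 := by ring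
  have e' : (n : ℤ) + 1 - (n + 1) = 0 := by ring
  simp only [mate_rev hc, Nat.cast_add, Nat.cast_one, e, e', sub_zero]
  constructor
  · rintro ⟨h1, h2⟩
    refine ⟨by omega, by omega, fun j hj => h2 (n + 1 + 1 - j) ?_⟩
    simpa using hj
  · rintro ⟨-, h1, h2⟩
    refine ⟨by omega, fun j hj => h2 (n + 1 + 1 - j) ?_⟩
    simpa using hj

/-- The probability that particle `1` goes right and annihilates with the static particle `1 + a`
in the process restricted to the particles `1, …, N + 1`. -/
lemma prob_mate_static (hm : m (Set.Iic 0) = 0) (hp : 0 ≤ p) {N a : ℕ} (ha : a < N + 1) :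
    prob p m (fun ξ => ((cfg ξ).vel (0 + 1) = 1 ∧
        Mate (cfg ξ) (Set.Ioc 0 (N + 1)) (0 + 1) (0 + 1 + a)) ∧ (cfg ξ).vel (0 + 1 + a) = 0) =
      p * firstProb p m a - ∑ b ∈ Finset.range (N + 1 - a), raceProb p m b a := by
  have hI := startsAfter_Ioc 0 ((N : ℤ) + 1)
  have hj : (0 + 1 + (a : ℤ)) ∈ Set.Ioc 0 ((N : ℤ) + 1) := ⟨by omega, by omega⟩
  have h1 := prob_and_not (p := p) (m := m) (E := fun ξ => IsBlock (cfg ξ) 0 a .rightUp)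
    (measurable_mate (Set.Ioc 0 ((N : ℤ) + 1)) (0 + 1) (0 + 1 + a))
  rw [← prob_isBlock_rightUp hm hp, ← h1, eq_sub_iff_add_eq]
  congr 1
  · refine prob_congr hm fun ξ hξ => ?_
    constructor
    · rintro ⟨⟨h2, h3⟩, h4⟩
      exact ⟨⟨h2, h4, ((mate_right_static_iff hξ hI h2 hj h4).1 h3).1⟩, h3⟩
    · rintro ⟨⟨h2, h3, h4⟩, h5⟩
      exact ⟨⟨h2, h5⟩, h3⟩
  -- The block fails to be realized in the window exactly when the first arrival at its static end
  -- lies in the window and wins the race. The range of `b` expresses `1 + a + b ≤ N + 1`, and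
  -- reversal explains the order of the arguments of `raceProb`.
  · simp_rw [raceProb, ← prob_race_not_leftWins hm]
    refine (prob_sum hm _ (fun b => (measurable_race _ _).and (measurable_leftWins _ _ _).not)
      (fun ξ hξ => ?_) (fun ξ hξ => ?_)).symm
    · constructor
      · rintro ⟨hb, hM⟩
        obtain ⟨h3, h4, h5⟩ := id hb
        have h2 := hM
        rw [mate_right_static_iff hξ hI h3 hj h4] at h2
        push Not at h2
        obtain ⟨k, hk, hk', h6⟩ := h2 h5
        rcases firstArr_or_noArr (cfg ξ) (0 + 1 + a) with h | ⟨n, h⟩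
        · exact (h _ hk').elim
        · have h7 := h.2 _ hk'
          have h8 := h.1.1
          have h9 := hk.2
          have e : 0 + 1 + (a : ℤ) + ((n - (0 + 1 + a)).toNat : ℤ) = n := by omega
          have hR : Race (cfg ξ) a (n - (0 + 1 + a)).toNat := ⟨hb, by rwa [e]⟩
          refine ⟨(n - (0 + 1 + a)).toNat, ?_, hR, ?_⟩
          · rw [Finset.mem_range]
            omega
          · rw [← hR.mate_iff hξ hI ⟨by omega, by omega⟩]
            exact hM
      · rintro ⟨b, hb, hR, h⟩
        rw [Finset.mem_range] at hb
        refine ⟨hR.1, ?_⟩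
        rwa [hR.mate_iff hξ hI ⟨by omega, by omega⟩]
    · rintro b - b' - ⟨h, -⟩ ⟨h', -⟩
      have := h.2.unique h'.2
      omega

/-- In the window `1, …, N + 1`, a right-moving first particle survives, meets a left-moving
partner, or meets a static one. Survival becomes an arrival by reversal. Working in a finite window
avoids any assumption on the survival of moving particles in the infinite system. -/
lemma balance (hm : m (Set.Iic 0) = 0) (hp : 0 ≤ p) (hp1 : p ≤ 1) (N : ℕ) :
    (1 - p) / 2 = arrProb p m (N + 1) + ∑ n ∈ Finset.range (N + 1),
      (pairProb p m n + p * firstProb p m n -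
        ∑ x ∈ Finset.HasAntidiagonal.antidiagonal n, raceProb p m x.1 x.2) := by
  have hI := startsAfter_Ioc 0 ((N : ℤ) + 1)
  have hfree : Measurable fun ξ => Free (cfg ξ) (Set.Ioc 0 ((N : ℤ) + 1)) (0 + 1) :=
    Measurable.forall fun _ => (measurable_mate _ _ _).not
  have h1 := prob_and_not (p := p) (m := m) (E := fun ξ => (cfg ξ).vel (0 + 1) = 1) hfree
  rw [← prob_vel_one (m := m) hp1 (0 + 1), ← h1, prob_free hm]
  congr 1
  -- Both sides run over the triangle `a + b ≤ N`, by total length and by the length of the left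
  -- part respectively.
  have h2 : ∑ n ∈ Finset.range (N + 1),
        ∑ x ∈ Finset.HasAntidiagonal.antidiagonal n, raceProb p m x.1 x.2 =
      ∑ a ∈ Finset.range (N + 1), ∑ b ∈ Finset.range (N + 1 - a), raceProb p m b a := by
    rw [← Finset.sum_range_diag_flip (N + 1) fun a b => raceProb p m b a]
    refine Finset.sum_congr rfl fun n _ => ?_
    rw [← Finset.Nat.sum_antidiagonal_eq_sum_range_succ fun a b => raceProb p m b a]
    exact (Finset.Nat.sum_antidiagonal_swap (f := fun x : ℕ × ℕ => raceProb p m x.1 x.2)).symm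
  rw [Finset.sum_sub_distrib, h2, ← Finset.sum_sub_distrib]
  have h3 : ∀ a ∈ Finset.range (N + 1), pairProb p m a + p * firstProb p m a -
      ∑ b ∈ Finset.range (N + 1 - a), raceProb p m b a = prob p m (fun ξ =>
        (cfg ξ).vel (0 + 1) = 1 ∧ Mate (cfg ξ) (Set.Ioc 0 (N + 1)) (0 + 1) (0 + 1 + a)) := by
    intro a ha
    rw [Finset.mem_range] at ha
    have hj : (0 + 1 + (a : ℤ)) ∈ Set.Ioc 0 ((N : ℤ) + 1) := ⟨by omega, by omega⟩
    rw [add_sub_assoc, ← prob_mate_static hm hp ha, add_comm]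
    rw [← prob_and_not (E := fun ξ => (cfg ξ).vel (0 + 1) = 1 ∧
      Mate (cfg ξ) (Set.Ioc 0 (N + 1)) (0 + 1) (0 + 1 + a)) (measurable_cfg_vel_eq (0 + 1 + a) 0)]
    congr 1
    refine prob_congr hm fun ξ hξ => ?_
    constructor
    · rintro ⟨h4, h5, h6⟩
      exact ⟨⟨h4, (mate_right_left_iff hξ hI h4 hj h5).2 h6⟩, by omega⟩
    · rintro ⟨⟨h4, h5⟩, h6⟩
      have h7 := (h5.right_cases hξ hI (by omega)).2
      have h8 : (cfg ξ).vel (0 + 1 + a) = -1 := by omega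
      exact ⟨h4, h8, (mate_right_left_iff hξ hI h4 hj h8).1 h5⟩
  rw [Finset.sum_congr rfl h3]
  refine prob_sum hm _ (fun a => (measurable_cfg_vel_eq _ _).and (measurable_mate _ _ _))
    (fun ξ hξ => ?_) (fun ξ hξ => ?_)
  · constructor
    · rintro ⟨h4, h5⟩
      unfold Free at h5
      push Not at h5
      obtain ⟨j, hj⟩ := h5
      have h6 := hj.mem_right hξ
      have h7 := h6.1
      have h8 := h6.2
      refine ⟨(j - 1).toNat, ?_, h4, ?_⟩
      · rw [Finset.mem_range]
        omega
      · rwa [show 0 + 1 + ((j - 1).toNat : ℤ) = j by omega]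
    · rintro ⟨a, -, h4, h5⟩
      exact ⟨h4, fun h => h _ h5⟩
  · rintro a - b - ⟨-, h⟩ ⟨-, h'⟩
    have := h.unique hξ h'
    omega

end Probability

end BallisticAnnihilation

/-! ### Generating series and the probability of an arrival -/

namespace BallisticAnnihilation

section Series

open PowerSeries

/-- The values of a power series with real coefficients, where it is absolutely convergent. -/
def EvalsTo (z : ℝ) (A : PowerSeries ℝ) (a : ℝ) : Prop := HasSum (fun n => coeff n A * z ^ n) a

variable {z a b : ℝ} {A B : PowerSeries ℝ}

lemma EvalsTo.add (hA : EvalsTo z A a) (hB : EvalsTo z B b) : EvalsTo z (A + B) (a + b) := by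
  unfold EvalsTo
  simpa only [map_add, add_mul] using HasSum.add hA hB

lemma EvalsTo.sub (hA : EvalsTo z A a) (hB : EvalsTo z B b) : EvalsTo z (A - B) (a - b) := by
  unfold EvalsTo
  simpa only [map_sub, sub_mul] using HasSum.sub hA hB

lemma EvalsTo.mul (hA : EvalsTo z A a) (hB : EvalsTo z B b) : EvalsTo z (A * B) (a * b) := by
  have h1 := summable_norm_iff.2 hA.summable
  have h2 := summable_norm_iff.2 hB.summable
  have h3 : ∀ n, coeff n (A * B) * z ^ n = ∑ x ∈ Finset.HasAntidiagonal.antidiagonal n,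
      coeff x.1 A * z ^ x.1 * (coeff x.2 B * z ^ x.2) := by
    intro n
    rw [coeff_mul, Finset.sum_mul]
    refine Finset.sum_congr rfl fun x hx => ?_
    rw [← Finset.HasAntidiagonal.mem_antidiagonal.1 hx, pow_add]
    ring
  unfold EvalsTo
  simp only [h3]
  rw [← hA.tsum_eq, ← hB.tsum_eq, tsum_mul_tsum_eq_tsum_sum_antidiagonal_of_summable_norm h1 h2]
  exact (summable_norm_sum_mul_antidiagonal_of_summable_norm h1 h2).of_norm.hasSum

lemma evalsTo_C (z a : ℝ) : EvalsTo z (C a) a := by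
  unfold EvalsTo
  convert hasSum_single 0 ?_ using 1
  · simp
  · intro n hn
    simp [coeff_C, hn]

lemma evalsTo_X (z : ℝ) : EvalsTo z X z := by
  unfold EvalsTo
  convert hasSum_single 1 ?_ using 1
  · simp
  · intro n hn
    simp [coeff_X, hn]

/-- `F = X Φ(F)` has only one solution for a polynomial `Φ`. -/
lemma eq_of_eq_X_mul {p : ℝ} {F G : PowerSeries ℝ}
    (hF : 2 * F - 2 * X * F ^ 2 = X * (1 - F ^ 2) * (1 - C p + C p * F ^ 2))
    (hG : 2 * G - 2 * X * G ^ 2 = X * (1 - G ^ 2) * (1 - C p + C p * G ^ 2)) : F = G := by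
  -- The difference of the two equations factors as `(F - G)(2 - X K)`, and the second factor has
  -- constant coefficient `2`.
  set K : PowerSeries ℝ := 2 * (F + G) - (F + G) * (1 - C p + C p * F ^ 2) +
    (1 - G ^ 2) * C p * (F + G) with hK
  have h : (F - G) * (2 - X * K) = 0 := by
    rw [hK]
    linear_combination hF - hG
  rcases mul_eq_zero.1 h with h | h
  · exact sub_eq_zero.1 h
  · have h1 := congrArg constantCoeff h
    rw [map_sub, map_mul, constantCoeff_X, zero_mul, map_ofNat, map_zero] at h1
    norm_num at h1

end Series

section Probability

open PowerSeries

variable {p : ℝ} {m m' : Measure ℝ} [IsProbabilityMeasure m] [IsProbabilityMeasure m']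
  [IsProbabilityMeasure (velLaw p)]

/-- The coefficient `3p/2` collects `p` from a static first particle and `p/2` from the right-static
pairs, the latter by `sum_race`. -/
lemma series_firstProb (hm : m (Set.Iic 0) = 0) (hp : 0 ≤ p) (hp1 : p ≤ 1) :
    mk (firstProb p m) = X * (C ((1 - p) / 2) + C (3 * p / 2) * (mk (firstProb p m) *
      mk (firstProb p m)) + mk (pairProb p m) * mk (firstProb p m)) := by
  ext n
  cases n with
  | zero => simp [firstProb_zero]
  | succ N =>
    have h := firstProb_succ hm hp hp1 N
    have hs := sum_race (p := p) hm hp N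
    rw [Finset.sum_add_distrib, Finset.sum_add_distrib, ← Finset.mul_sum] at h
    simp only [coeff_succ_X_mul, map_add, coeff_C_mul]
    simp only [coeff_mul, coeff_mk, coeff_C]
    linarith

lemma series_arrProb (hm : m (Set.Iic 0) = 0) :
    mk (arrProb p m) = mk (firstProb p m) + mk (firstProb p m) * mk (arrProb p m) := by
  ext n
  simpa only [map_add, coeff_mul, coeff_mk] using arrProb_eq hm n

/-- Subtracting consecutive balance equations removes the partial sums, which is the reason for the
factor `1 - X` in front of the arrival series. -/
lemma series_balance (hm : m (Set.Iic 0) = 0) (hp : 0 ≤ p) (hp1 : p ≤ 1) :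
    X * C ((1 - p) / 2) = mk (arrProb p m) - X * mk (arrProb p m) + X * (mk (pairProb p m) +
      C p * mk (firstProb p m) - C (p / 2) * (mk (firstProb p m) * mk (firstProb p m))) := by
  ext n
  cases n with
  | zero => simp [arrProb_zero]
  | succ N =>
    have hs := sum_race (p := p) hm hp N
    simp only [coeff_succ_X_mul, map_add, map_sub, coeff_C_mul]
    simp only [coeff_mul, coeff_mk, coeff_C]
    have h := balance (p := p) hm hp hp1 N
    rw [Finset.sum_range_succ] at h
    cases N with
    | zero =>
      simp only [Finset.range_zero, Finset.sum_empty, arrProb_zero, if_true] at h ⊢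
      linarith
    | succ M =>
      have h' := balance (p := p) hm hp hp1 M
      rw [if_neg (Nat.succ_ne_zero M)]
      linarith

/-- The renewal equation gives `U(1 - F) = F`, the balance equation then expresses `H` through `F`,
and substitution in `series_firstProb` leaves an equation for `F` alone. -/
lemma series_fixed_point (hm : m (Set.Iic 0) = 0) (hp : 0 ≤ p) (hp1 : p ≤ 1) :
    2 * mk (firstProb p m) - 2 * X * mk (firstProb p m) ^ 2 =
      X * (1 - mk (firstProb p m) ^ 2) * (1 - C p + C p * mk (firstProb p m) ^ 2) := by
  have h1 := series_firstProb (p := p) hm hp hp1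
  have h2 := series_arrProb (p := p) hm
  have h3 := series_balance (p := p) hm hp hp1
  have e1 : 2 * C ((1 - p) / 2) = 1 - C p := by
    rw [← map_ofNat C 2, ← map_mul, ← map_one C, ← map_sub]
    congr 1
    ring
  have e2 : 2 * C (3 * p / 2) = 3 * C p := by
    rw [← map_ofNat C 2, ← map_ofNat C 3, ← map_mul, ← map_mul]
    congr 1
    ring
  have e3 : 2 * C (p / 2) = C p := by
    rw [← map_ofNat C 2, ← map_mul]
    congr 1
    ring
  generalize mk (firstProb p m) = F at *
  generalize mk (arrProb p m) = U at *
  generalize mk (pairProb p m) = H at *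
  generalize C ((1 - p) / 2) = c1 at *
  generalize C (3 * p / 2) = c2 at *
  generalize C (p / 2) = c3 at *
  generalize C p = c at *
  linear_combination (2 - 2 * F) * h1 - 2 * (1 - X) * F * h2 - 2 * F * (1 - F) * h3 +
    X * (1 - F ^ 2) * e1 + X * (1 - F) * F ^ 2 * e2 + X * (1 - F) * F ^ 3 * e3

/-- The law of the first arrival does not depend on the law of the interdistances. -/
lemma firstProb_congr (hm : m (Set.Iic 0) = 0) (hm' : m' (Set.Iic 0) = 0) (hp : 0 ≤ p)
    (hp1 : p ≤ 1) : firstProb p m = firstProb p m' := by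
  have h := eq_of_eq_X_mul (series_fixed_point (p := p) hm hp hp1)
    (series_fixed_point (p := p) hm' hp hp1)
  funext n
  simpa using congrArg (coeff n) h

/-- Once `F` is known, `1 - F` can be cancelled because its constant coefficient is `1`; so `U` is
known, and the balance equation determines `H`. -/
lemma pairProb_congr (hm : m (Set.Iic 0) = 0) (hm' : m' (Set.Iic 0) = 0) (hp : 0 ≤ p)
    (hp1 : p ≤ 1) : pairProb p m = pairProb p m' := by
  have h1 := series_arrProb (p := p) hm
  have h2 := series_arrProb (p := p) hm'
  have h3 := series_balance (p := p) hm hp hp1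
  have h4 := series_balance (p := p) hm' hp hp1
  rw [← firstProb_congr (p := p) hm hm' hp hp1] at h2 h4
  have h5 : (mk (arrProb p m) - mk (arrProb p m')) * (1 - mk (firstProb p m)) = 0 := by
    linear_combination h1 - h2
  have h6 : mk (arrProb p m) = mk (arrProb p m') := by
    rcases mul_eq_zero.1 h5 with h | h
    · exact sub_eq_zero.1 h
    · have h1 := congrArg (coeff 0) h
      simp [firstProb_zero] at h1
  rw [h6] at h3
  have h7 : (X : PowerSeries ℝ) * (mk (pairProb p m) - mk (pairProb p m')) = 0 := by
    linear_combination h4 - h3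
  have h8 := sub_eq_zero.1 ((mul_eq_zero.1 h7).resolve_left X_ne_zero)
  funext n
  simpa using congrArg (coeff n) h8

lemma firstProb_nonneg (n : ℕ) : 0 ≤ firstProb p m n := prob_nonneg _

lemma pairProb_nonneg (n : ℕ) : 0 ≤ pairProb p m n := prob_nonneg _

lemma hasSum_prob (hm : m (Set.Iic 0) = 0) {E : ℕ → (ℤ → ℝ × ℤ × ℤ) → Prop}
    (hE : ∀ i, Measurable (E i))
    (hd : ∀ ξ, (cfg ξ).Good → ∀ i j, E i ξ → E j ξ → i = j) :
    HasSum (fun n => prob p m (E n)) (prob p m fun ξ => ∃ n, E n ξ) := by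
  unfold prob
  have h : {ξ | ∃ n, E n ξ} = ⋃ n, {ξ | E n ξ} := by
    ext ξ
    simp
  rw [h]
  have h1 : Pairwise (Function.onFun (AEDisjoint (processLaw p m)) fun n => {ξ | E n ξ}) := by
    intro i j hij
    refine measure_mono_null (t := {ξ | ¬ (cfg ξ).Good}) ?_ (ae_good (p := p) hm)
    rintro ξ ⟨h1, h2⟩ hg
    exact hij (hd ξ hg i j h1 h2)
  have h2 := measure_iUnion₀ h1 fun n => (measurableSet_setOfPred.2 (hE n)).nullMeasurableSet
  have h3 : ∑' n, processLaw p m {ξ | E n ξ} ≠ ⊤ := h2 ▸ measure_ne_top _ _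
  unfold Measure.real
  rw [h2, ENNReal.tsum_toReal_eq fun n => measure_ne_top _ _]
  exact ENNReal.hasSum_toReal h3

lemma hasSum_firstProb (hm : m (Set.Iic 0) = 0) :
    HasSum (firstProb p m) (prob p m fun ξ => ∃ n : ℕ, FirstArr (cfg ξ) 0 n) :=
  hasSum_prob hm (fun n => measurable_firstArr 0 n) fun ξ _ i j h h' => by
    exact_mod_cast h.unique h'

lemma hasSum_pairProb (hm : m (Set.Iic 0) = 0) :
    HasSum (pairProb p m) (prob p m fun ξ => ∃ n : ℕ, IsBlock (cfg ξ) 0 n .rightLeft) := by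
  refine hasSum_prob hm (fun n => measurable_isBlock 0 n _) fun ξ hξ i j h h' => ?_
  have hI := startsAfter_Ioi 0
  have h1 := (mate_right_left_iff hξ hI h.1 (j := 0 + 1 + i)
    (by simp only [Set.mem_Ioi]; omega) h.2.1).2 h.2.2
  have h2 := (mate_right_left_iff hξ hI h.1 (j := 0 + 1 + j)
    (by simp only [Set.mem_Ioi]; omega) h'.2.1).2 h'.2.2
  have := h1.unique hξ h2
  omega

/-- The value at `z` of the generating series of the first arrival. -/
noncomputable def firstGen (p : ℝ) (m : Measure ℝ) [IsProbabilityMeasure m]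
    [IsProbabilityMeasure (velLaw p)] (z : ℝ) : ℝ := ∑' n, firstProb p m n * z ^ n

lemma firstProb_mul_pow_le {z : ℝ} (hz : z ∈ Set.Icc (0 : ℝ) 1) (n : ℕ) :
    ‖firstProb p m n * z ^ n‖ ≤ firstProb p m n := by
  rw [Real.norm_of_nonneg (mul_nonneg (firstProb_nonneg n) (pow_nonneg hz.1 n))]
  exact mul_le_of_le_one_right (firstProb_nonneg n) (pow_le_one₀ hz.1 hz.2)

lemma evalsTo_firstGen (hm : m (Set.Iic 0) = 0) {z : ℝ} (hz : z ∈ Set.Icc (0 : ℝ) 1) :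
    EvalsTo z (mk (firstProb p m)) (firstGen p m z) := by
  unfold EvalsTo firstGen
  simp only [coeff_mk]
  exact (Summable.of_norm_bounded (hasSum_firstProb hm).summable (firstProb_mul_pow_le hz)).hasSum

lemma continuousOn_firstGen (hm : m (Set.Iic 0) = 0) :
    ContinuousOn (firstGen p m) (Set.Icc 0 1) :=
  continuousOn_tsum (fun n => by fun_prop) (hasSum_firstProb hm).summable
    fun n z hz => firstProb_mul_pow_le hz n

lemma firstGen_fixed_point (hm : m (Set.Iic 0) = 0) (hp : 0 ≤ p) (hp1 : p ≤ 1) {z : ℝ}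
    (hz : z ∈ Set.Icc (0 : ℝ) 1) : 2 * firstGen p m z - 2 * z * firstGen p m z ^ 2 =
      z * (1 - firstGen p m z ^ 2) * (1 - p + p * firstGen p m z ^ 2) := by
  have hF := evalsTo_firstGen (p := p) hm hz
  have h2 := evalsTo_C z 2
  have h1 := evalsTo_C z 1
  have hX := evalsTo_X z
  have hC := evalsTo_C z p
  have e := series_fixed_point (p := p) hm hp hp1
  rw [← map_ofNat C 2, ← map_one C] at e
  simp only [sq] at e ⊢
  have hl := (h2.mul hF).sub ((h2.mul hX).mul (hF.mul hF))
  rw [e] at hl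
  exact HasSum.unique hl ((hX.mul (h1.sub (hF.mul hF))).mul ((h1.sub hC).add (hC.mul (hF.mul hF))))

lemma firstProb_le (hp1 : p ≤ 1) (n : ℕ) : firstProb p m n ≤ (1 - p) / 2 := by
  rw [← prob_vel_neg_one (m := m) hp1 n]
  exact prob_mono fun ξ h => h.1.2.1

lemma pairProb_le (hp1 : p ≤ 1) (n : ℕ) : pairProb p m n ≤ (1 - p) / 2 := by
  rw [← prob_vel_neg_one (m := m) hp1 (0 + 1 + n)]
  exact prob_mono fun ξ h => h.2.1

/-- At `z = 1` the fixed-point equation also has the root `1`, so an argument of continuity is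
needed. If `F(1) ≥ 1`, then `F` takes the value `α = 1/√p - 1 < 1` somewhere on `[0,1]`; but the
equation allows this value only at `z = 1`. -/
lemma firstGen_one_lt (hm : m (Set.Iic 0) = 0) (hp : 1 / 4 < p) (hp1 : p ≤ 1) :
    firstGen p m 1 < 1 := by
  have hp0 : 0 ≤ p := by linarith
  -- For `p = 1` the value `α` is `0` and the argument below is empty, but then there are no moving
  -- particles.
  rcases hp1.eq_or_lt with rfl | hlt
  · have h : firstGen (1 : ℝ) m 1 = 0 := by
      have h1 : ∀ n, firstProb (1 : ℝ) m n = 0 := fun n =>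
        le_antisymm ((firstProb_le le_rfl n).trans (by norm_num)) (firstProb_nonneg n)
      simp [firstGen, h1]
    rw [h]
    exact one_pos
  · set s := √p with hs
    have hss : s * s = p := Real.mul_self_sqrt hp0
    have hs1 : 1 / 2 < s := by
      rw [hs, Real.lt_sqrt (by norm_num)]
      linarith
    have hs2 : s < 1 := by
      rw [hs, Real.sqrt_lt' one_pos]
      linarith
    -- This is the nonnegative root of `p(1 + α)² = 1`; it lies in `(0, 1)` precisely because `1/4 <
    -- p < 1`.
    set α := 1 / s - 1 with hα
    have hαs : s * (1 + α) = 1 := by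
      rw [hα]
      field_simp
      ring
    have hα0 : 0 < α := by nlinarith
    have hα1 : α < 1 := by nlinarith
    by_contra! hq
    have h0 : firstGen p m 0 = 0 := by
      rw [firstGen, tsum_eq_single 0]
      · simp [firstProb_zero]
      · intro n hn
        simp [hn]
    obtain ⟨z, hz, hzα⟩ := intermediate_value_Icc zero_le_one (continuousOn_firstGen (p := p) hm)
      (show α ∈ Set.Icc (firstGen p m 0) (firstGen p m 1) by
        rw [h0]
        exact ⟨hα0.le, hα1.le.trans hq⟩)
    have h1 := firstGen_fixed_point (p := p) hm hp0 hp1 hz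
    rw [hzα] at h1
    have h2 : p * (1 + α) ^ 2 = 1 := by
      rw [← hss]
      linear_combination (s * (1 + α) + 1) * hαs
    -- Inserting `F(z) = α` and `p(1 + α)² = 1` into the fixed-point equation reduces it to this
    -- product.
    have h3 : 2 * α * (1 - z) = 0 := by
      linear_combination h1 + z * (1 - α) * (α - 1) * h2
    have h4 : z = 1 := by
      rcases mul_eq_zero.1 h3 with h | h <;> linarith
    rw [h4] at hzα
    linarith

lemma firstGen_one_sq (hm : m (Set.Iic 0) = 0) (hp : 1 / 4 < p) (hp1 : p ≤ 1) :
    p * (1 + firstGen p m 1) ^ 2 = 1 := by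
  have hp0 : 0 ≤ p := by linarith
  have h1 := firstGen_fixed_point (p := p) hm hp0 hp1 (z := 1) ⟨zero_le_one, le_rfl⟩
  have h2 := firstGen_one_lt hm hp hp1
  set q := firstGen p m 1
  -- Factorization of the fixed-point equation at `z = 1`; the double root `1` has just been
  -- excluded.
  have h3 : (1 - q) ^ 2 * (p * (1 + q) ^ 2 - 1) = 0 := by linear_combination h1
  rcases mul_eq_zero.1 h3 with h | h
  · nlinarith
  · linarith

lemma hasSum_firstProb_firstGen (hm : m (Set.Iic 0) = 0) :
    HasSum (firstProb p m) (firstGen p m 1) := by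
  simpa [EvalsTo] using evalsTo_firstGen (p := p) hm (z := 1) ⟨zero_le_one, le_rfl⟩

lemma firstGen_one (hm : m (Set.Iic 0) = 0) (hp : 1 / 4 < p) (hp1 : p ≤ 1) :
    √p * (1 + firstGen p m 1) = 1 := by
  have h := firstGen_one_sq hm hp hp1
  have h0 : 0 ≤ firstGen p m 1 := (hasSum_firstProb_firstGen hm).nonneg firstProb_nonneg
  have h' : (√p * (1 + firstGen p m 1)) ^ 2 = 1 := by
    rw [mul_pow, Real.sq_sqrt (by linarith), h]
  exact (pow_eq_one_iff_of_nonneg (by positivity) two_ne_zero).1 h'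

lemma p_mul_firstGen_one (hm : m (Set.Iic 0) = 0) (hp : 1 / 4 < p) (hp1 : p ≤ 1) :
    p * firstGen p m 1 = √p * (1 - √p) := by
  have h := firstGen_one hm hp hp1
  have h' := Real.mul_self_sqrt (by linarith : 0 ≤ p)
  linear_combination √p * h - (1 + firstGen p m 1) * h' + h'

/-- With `q = F(1)` known, the equation of `series_firstProb` at `z = 1` is linear in the total mass
`η` of `H`, with coefficient `q`. Since `q = 0` when `p = 1`, that case is treated apart. -/
lemma hasSum_pairProb_sqrt (hm : m (Set.Iic 0) = 0) (hp : 1 / 4 < p) (hp1 : p ≤ 1) :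
    HasSum (pairProb p m) ((1 - √p) ^ 2) := by
  have hp0 : 0 ≤ p := by linarith
  rcases hp1.eq_or_lt with rfl | hlt
  · have h1 : pairProb (1 : ℝ) m = fun _ => 0 := funext fun n =>
      le_antisymm ((pairProb_le le_rfl n).trans (by norm_num)) (pairProb_nonneg n)
    rw [h1]
    simp
  · have hH := hasSum_pairProb (p := p) hm
    generalize prob p m (fun ξ => ∃ n : ℕ, IsBlock (cfg ξ) 0 n .rightLeft) = η at hH
    have hF := evalsTo_firstGen (p := p) hm (z := 1) ⟨zero_le_one, le_rfl⟩
    have hH' : EvalsTo 1 (mk (pairProb p m)) η := by simpa [EvalsTo] using hH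
    have hl := hF
    rw [series_firstProb hm hp0 hp1] at hl
    have e := HasSum.unique hl ((evalsTo_X 1).mul (((evalsTo_C 1 ((1 - p) / 2)).add
      ((evalsTo_C 1 (3 * p / 2)).mul (hF.mul hF))).add (hH'.mul hF)))
    have h := firstGen_one hm hp hp1
    have h' := Real.mul_self_sqrt hp0
    have hs2 : √p < 1 := by
      rw [Real.sqrt_lt' one_pos]
      linarith
    have hs0 : 0 < √p := Real.sqrt_pos.2 (by linarith)
    set q := firstGen p m 1
    set s := √p
    have hq : q ≠ 0 := by
      intro hq
      rw [hq] at h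
      linarith
    have h3 : q * (η - (1 - s) ^ 2) = 0 := by
      have hsq : s * q = 1 - s := by linear_combination h
      refine (mul_eq_zero.1 (?_ : s * (q * (η - (1 - s) ^ 2)) = 0)).resolve_left hs0.ne'
      linear_combination -s * e - (s / 2 - 3 * s / 2 * q ^ 2) * h' +
        (1 - (1 - s) ^ 2 - 3 / 2 * s * (s * q + 1 - s)) * hsq
    have := (mul_eq_zero.1 h3).resolve_left hq
    rwa [sub_eq_zero.1 this] at hH

end Probability

end BallisticAnnihilation

/-! ### The law of a block, and chains of independent blocks -/

namespace BallisticAnnihilation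

lemma Shape.mirror_involutive : Function.Involutive Shape.mirror := fun σ => by cases σ <;> rfl

instance : Fintype Shape := ⟨⟨↑[Shape.up, .rightUp, .upLeft, .rightLeft], by simp⟩, fun σ => by
  cases σ <;> simp⟩

lemma tsum_shape (f : Shape → ENNReal) :
    ∑' σ, f σ = f .up + f .rightUp + f .upLeft + f .rightLeft := by
  rw [tsum_fintype]
  change (Multiset.map f ↑[Shape.up, .rightUp, .upLeft, .rightLeft]).sum = _
  simp [add_assoc]

/-- The probability of a shape. -/
noncomputable def shapeWeight (p : ℝ) : Shape → ENNReal
  | .up => ENNReal.ofReal p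
  | .rightUp => ENNReal.ofReal (√p * (1 - √p))
  | .upLeft => ENNReal.ofReal (√p * (1 - √p))
  | .rightLeft => ENNReal.ofReal ((1 - √p) ^ 2)

lemma sum_shapeWeight {p : ℝ} (hp : 1 / 4 < p) (hp1 : p ≤ 1) : ∑' σ, shapeWeight p σ = 1 := by
  have hp0 : 0 ≤ p := by linarith
  have h1 : √p ≤ 1 := Real.sqrt_le_one.2 hp1
  have h0 := Real.sqrt_nonneg p
  have h2 : 0 ≤ √p * (1 - √p) := mul_nonneg h0 (by linarith)
  have hs := Real.sq_sqrt hp0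
  rw [tsum_shape]
  simp only [shapeWeight]
  rw [← ENNReal.ofReal_add hp0 h2, ← ENNReal.ofReal_add (add_nonneg hp0 h2) h2,
    ← ENNReal.ofReal_add (by positivity) (by positivity), ← ENNReal.ofReal_one]
  congr 1
  linear_combination -hs

variable {p : ℝ} {m m' : Measure ℝ} [IsProbabilityMeasure m] [IsProbabilityMeasure m']
  [IsProbabilityMeasure (velLaw p)]

lemma ofReal_prob (E : (ℤ → ℝ × ℤ × ℤ) → Prop) :
    ENNReal.ofReal (prob p m E) = processLaw p m {ξ | E ξ} := by
  rw [prob, ofReal_measureReal]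

/-- The probability of a block, given that no particle comes from its right. -/
noncomputable def blockWeight (p : ℝ) (m : Measure ℝ) [IsProbabilityMeasure m]
    [IsProbabilityMeasure (velLaw p)] (b : ℕ × Shape) : ENNReal :=
  processLaw p m {ξ | IsBlock (cfg ξ) 0 b.1 b.2}

/-- The law of the blocks of the skyline. -/
noncomputable def blockLaw (p : ℝ) (m : Measure ℝ) [IsProbabilityMeasure m]
    [IsProbabilityMeasure (velLaw p)] : Measure (ℤ × Shape) :=
  Measure.sum fun b : ℕ × Shape => blockWeight p m b • Measure.dirac ((b.1 : ℤ), b.2)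

lemma blockWeight_up (hp : 0 ≤ p) (n : ℕ) :
    blockWeight p m (n, .up) = if n = 0 then ENNReal.ofReal p else 0 := by
  have h0 := ofReal_prob (p := p) (m := m) fun ξ => (cfg ξ).vel (0 + 1) = 0
  rw [prob_vel_zero hp] at h0
  unfold blockWeight
  split_ifs with h
  · rw [h0]
    simp [IsBlock, h]
  · simp [IsBlock, h]

lemma blockWeight_upLeft (hm : m (Set.Iic 0) = 0) (hp : 0 ≤ p) (n : ℕ) :
    blockWeight p m (n, .upLeft) = ENNReal.ofReal (p * firstProb p m n) := by
  rw [← prob_isBlock_upLeft hm hp, ofReal_prob]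
  rfl

lemma blockWeight_rightUp (hm : m (Set.Iic 0) = 0) (hp : 0 ≤ p) (n : ℕ) :
    blockWeight p m (n, .rightUp) = ENNReal.ofReal (p * firstProb p m n) := by
  rw [← prob_isBlock_rightUp hm hp, ofReal_prob]
  rfl

lemma blockWeight_rightLeft (n : ℕ) :
    blockWeight p m (n, .rightLeft) = ENNReal.ofReal (pairProb p m n) := by
  rw [pairProb, ofReal_prob]
  rfl

lemma blockWeight_congr (hm : m (Set.Iic 0) = 0) (hm' : m' (Set.Iic 0) = 0) (hp : 0 ≤ p)
    (hp1 : p ≤ 1) : blockWeight p m = blockWeight p m' := by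
  funext ⟨n, σ⟩
  cases σ with
  | up => rw [blockWeight_up hp, blockWeight_up hp]
  | rightUp =>
    rw [blockWeight_rightUp hm hp, blockWeight_rightUp hm' hp, firstProb_congr hm hm' hp hp1]
  | upLeft =>
    rw [blockWeight_upLeft hm hp, blockWeight_upLeft hm' hp, firstProb_congr hm hm' hp hp1]
  | rightLeft => rw [blockWeight_rightLeft, blockWeight_rightLeft, pairProb_congr hm hm' hp hp1]

lemma blockLaw_congr (hm : m (Set.Iic 0) = 0) (hm' : m' (Set.Iic 0) = 0) (hp : 0 ≤ p)
    (hp1 : p ≤ 1) : blockLaw p m = blockLaw p m' := by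
  rw [blockLaw, blockLaw, blockWeight_congr hm hm' hp hp1]

lemma blockWeight_mirror (hm : m (Set.Iic 0) = 0) (hp : 0 ≤ p) (n : ℕ) (σ : Shape) :
    blockWeight p m (n, σ.mirror) = blockWeight p m (n, σ) := by
  cases σ <;> simp only [Shape.mirror, blockWeight_upLeft hm hp, blockWeight_rightUp hm hp]

lemma tsum_blockWeight (hm : m (Set.Iic 0) = 0) (hp : 1 / 4 < p) (hp1 : p ≤ 1) (σ : Shape) :
    ∑' n, blockWeight p m (n, σ) = shapeWeight p σ := by
  have hp0 : 0 ≤ p := by linarith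
  have h1 : ∑' n, ENNReal.ofReal (p * firstProb p m n) = ENNReal.ofReal (√p * (1 - √p)) := by
    have h := (hasSum_firstProb_firstGen (p := p) hm).mul_left p
    rw [p_mul_firstGen_one hm hp hp1] at h
    rw [← h.tsum_eq, ENNReal.ofReal_tsum_of_nonneg (fun n => mul_nonneg hp0 (firstProb_nonneg n))
      h.summable]
  cases σ with
  | up =>
    simp only [blockWeight_up hp0, shapeWeight]
    rw [tsum_ite_eq]
  | rightUp => simpa only [blockWeight_rightUp hm hp0, shapeWeight] using h1
  | upLeft => simpa only [blockWeight_upLeft hm hp0, shapeWeight] using h1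
  | rightLeft =>
    have h := hasSum_pairProb_sqrt hm hp hp1
    simp only [blockWeight_rightLeft, shapeWeight]
    rw [← h.tsum_eq, ENNReal.ofReal_tsum_of_nonneg pairProb_nonneg h.summable]

lemma blockLaw_apply (A : Set (ℤ × Shape)) : blockLaw p m A =
    ∑' b : ℕ × Shape, blockWeight p m b * A.indicator 1 ((b.1 : ℤ), b.2) := by
  rw [blockLaw, Measure.sum_apply _ A.to_countable.measurableSet]
  refine tsum_congr fun b => ?_
  rw [Measure.smul_apply, Measure.dirac_apply, smul_eq_mul]

lemma blockLaw_shape (hm : m (Set.Iic 0) = 0) (hp : 1 / 4 < p) (hp1 : p ≤ 1) (C : Set Shape) :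
    blockLaw p m {z | z.2 ∈ C} = ∑' σ, shapeWeight p σ * C.indicator 1 σ := by
  rw [blockLaw_apply, ENNReal.tsum_prod', ENNReal.tsum_comm]
  refine tsum_congr fun σ => ?_
  rw [← tsum_blockWeight hm hp hp1, ← ENNReal.tsum_mul_right]
  rfl

lemma blockLaw_singleton (n : ℕ) (σ : Shape) :
    blockLaw p m ({z | z.2 = σ} ∩ {z | z.1 = n}) = blockWeight p m (n, σ) := by
  rw [blockLaw_apply, tsum_eq_single (n, σ)]
  · simp
  · rintro ⟨k, τ⟩ h
    rw [Set.indicator_of_notMem, mul_zero]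
    rintro ⟨h1, h2⟩
    simp only [Set.mem_ofPred_eq, Nat.cast_inj] at h1 h2
    exact h (by rw [h1, h2])

lemma isProbabilityMeasure_blockLaw (hm : m (Set.Iic 0) = 0) (hp : 1 / 4 < p) (hp1 : p ≤ 1) :
    IsProbabilityMeasure (blockLaw p m) := by
  constructor
  have := blockLaw_shape (p := p) hm hp hp1 Set.univ
  simp only [Set.mem_univ, Set.ofPred_true, Set.indicator_univ, Pi.one_apply, mul_one,
    sum_shapeWeight hp hp1] at this
  exact this

/-- The two asymmetric shapes have the same weights for each length, so blocks read from right to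
left have the same law as those read from left to right. -/
lemma blockLaw_mirror (hm : m (Set.Iic 0) = 0) (hp : 0 ≤ p) (A : Set (ℤ × Shape)) :
    blockLaw p m {z | (z.1, z.2.mirror) ∈ A} = blockLaw p m A := by
  rw [blockLaw_apply, blockLaw_apply, ENNReal.tsum_prod', ENNReal.tsum_prod']
  refine tsum_congr fun n => ?_
  rw [← (Function.Involutive.toPerm Shape.mirror Shape.mirror_involutive).tsum_eq
    fun σ => blockWeight p m (n, σ) * A.indicator 1 ((n : ℤ), σ)]
  refine tsum_congr fun σ => ?_
  rw [Function.Involutive.coe_toPerm, blockWeight_mirror hm hp]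
  rfl

lemma prob_noArr (hm : m (Set.Iic 0) = 0) :
    prob p m (fun ξ => NoArr (cfg ξ) 0) = 1 - firstGen p m 1 := by
  have h1 := (hasSum_firstProb (p := p) hm).unique (hasSum_firstProb_firstGen hm)
  have h2 := prob_and_not (p := p) (m := m) (E := fun _ => True) (measurable_noArr 0)
  rw [prob_true] at h2
  rw [← h1, eq_sub_iff_add_eq, ← h2]
  congr 1
  · simp
  · refine prob_congr hm fun ξ _ => ?_
    constructor
    · rintro ⟨n, hn⟩
      exact ⟨trivial, fun h => h _ hn.1⟩
    · rintro ⟨-, h⟩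
      obtain ⟨n, hn⟩ := (firstArr_or_noArr (cfg ξ) 0).resolve_left h
      refine ⟨n.toNat, ?_⟩
      rwa [Int.toNat_of_nonneg hn.1.1.le]

/-- The block sequences that correspond to a set of values of the skyline. -/
def blockSet (A : Set (ℤ × Shape)) : Set (ℕ × Shape) := {b | ((b.1 : ℤ), b.2) ∈ A}

/-- The first block is an event on its own window and the rest of the chain an event on what lies
beyond, which has the law of the original half-line by translation. Different first blocks are
disjoint events because the rest of the chain forbids arrivals at the right end (`IsBlock.unique`).
-/
lemma prob_blockChainIn_cons (hm : m (Set.Iic 0) = 0) (A : Set (ℤ × Shape))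
    (l : List (Set (ℕ × Shape))) :
    processLaw p m {ξ | BlockChainIn (cfg ξ) 0 (blockSet A :: l)} =
      blockLaw p m A * processLaw p m {ξ | BlockChainIn (cfg ξ) 0 l} := by
  set F : ℕ × Shape → Set (ℤ → ℝ × ℤ × ℤ) := fun b =>
    {ξ | b ∈ blockSet A ∧ IsBlock (cfg ξ) 0 b.1 b.2 ∧ BlockChainIn (cfg ξ) (0 + 1 + b.1) l} with hF
  have h1 : {ξ | BlockChainIn (cfg ξ) 0 (blockSet A :: l)} = ⋃ b, F b := by
    ext ξ
    simp [hF, BlockChainIn]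
  have hFm : ∀ b, MeasurableSet (F b) := fun b => measurableSet_setOfPred.2 <|
    measurable_const.and <| (measurable_isBlock _ _ _).and (measurable_blockChainIn _ _)
  have hd : Pairwise (Function.onFun (AEDisjoint (processLaw p m)) F) := by
    intro b b' hbb
    refine measure_mono_null (t := {ξ | ¬ (cfg ξ).Good}) ?_ (ae_good (p := p) hm)
    rintro ξ ⟨⟨-, h2, h3⟩, ⟨-, h4, h5⟩⟩ hg
    obtain ⟨e1, e2⟩ := h2.unique hg (h3.noArr hg) h4 (h5.noArr hg)
    exact hbb (Prod.ext e1 e2)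
  rw [h1, measure_iUnion₀ hd fun b => (hFm b).nullMeasurableSet, blockLaw_apply,
    ← ENNReal.tsum_mul_right]
  refine tsum_congr fun b => ?_
  by_cases hb : b ∈ blockSet A
  · have hb' : ((b.1 : ℤ), b.2) ∈ A := hb
    rw [Set.indicator_of_mem hb', Pi.one_apply, mul_one]
    have h2 := prob_inter_of_sameOn (p := p) (m := m) (k := 0 + 1 + b.1)
      (E := fun c => IsBlock c 0 b.1 b.2) (E' := fun c => BlockChainIn c (0 + 1 + b.1) l)
      (measurable_isBlock _ _ _) (measurable_blockChainIn _ _)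
      (fun c c' h => (h.mono fun x hx => hx.2).isBlock _) fun c c' h => h.blockChainIn l _
    have h3 := prob_shift (p := p) (m := m) (E := fun c => BlockChainIn c 0 l)
      (E' := fun c => BlockChainIn c (0 + 1 + b.1) l) hm (measurable_blockChainIn _ _)
      (0 + 1 + b.1) fun c hc => by rw [blockChainIn_shift hc, zero_add (0 + 1 + (b.1 : ℤ))]
    rw [h3] at h2
    have h4 := congrArg ENNReal.ofReal h2
    rw [ENNReal.ofReal_mul (prob_nonneg _), ofReal_prob, ofReal_prob, ofReal_prob] at h4
    simpa only [hF, hb, true_and, blockWeight] using h4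
  · have hb' : ((b.1 : ℤ), b.2) ∉ A := hb
    rw [Set.indicator_of_notMem hb', mul_zero, zero_mul]
    simp [hF, hb]

lemma prob_blockChainIn (hm : m (Set.Iic 0) = 0) (l : List (Set (ℤ × Shape))) :
    processLaw p m {ξ | BlockChainIn (cfg ξ) 0 (l.map blockSet)} =
      (l.map (blockLaw p m)).prod * ENNReal.ofReal (1 - firstGen p m 1) := by
  induction l with
  | nil =>
    rw [← prob_noArr hm, ofReal_prob]
    simp [BlockChainIn]
  | cons A l ih => rw [List.map_cons, prob_blockChainIn_cons hm, ih, List.map_cons, List.prod_cons,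
      mul_assoc]

/-- Almost surely, if no particle comes from the right, then the skyline is made of blocks. -/
lemma ae_blockChainIn (hm : m (Set.Iic 0) = 0) (hp : 1 / 4 < p) (hp1 : p ≤ 1) (N : ℕ) :
    ∀ᵐ ξ ∂processLaw p m, NoArr (cfg ξ) 0 →
      BlockChainIn (cfg ξ) 0 ((List.replicate N Set.univ).map blockSet) := by
  have := isProbabilityMeasure_blockLaw (p := p) hm hp hp1
  have h1 := prob_blockChainIn (p := p) hm (List.replicate N Set.univ)
  have h2 := ofReal_prob (p := p) (m := m) fun ξ => NoArr (cfg ξ) 0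
  rw [prob_noArr hm] at h2
  rw [List.map_replicate (f := blockLaw p m), measure_univ, List.prod_replicate, one_pow, one_mul, h2] at h1
  -- A block law of total mass one makes the existence of `N` blocks as likely as the absence of
  -- arrivals; since the first event is contained in the second, they coincide almost surely. No
  -- separate argument is needed to show that the blocks are finite.
  have h3 := ae_eq_of_ae_subset_of_measure_ge (μ := processLaw p m)
    (s := {ξ | BlockChainIn (cfg ξ) 0 ((List.replicate N Set.univ).map blockSet)})
    (t := {ξ | NoArr (cfg ξ) 0})
    (by filter_upwards [ae_good (p := p) hm] with ξ hξ h using BlockChainIn.noArr hξ h) h1.ge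
    (measurableSet_setOfPred.2 (measurable_blockChainIn _ _)).nullMeasurableSet
    (measure_ne_top _ _)
  filter_upwards [h3] with ξ hξ h
  exact hξ.mpr h

lemma SameOn.refl {c c' : Config} {I : Set ℤ} (h : SameOn c c' I) :
    SameOn c.refl c'.refl ((fun n => -n) ⁻¹' I) := by
  refine ⟨fun i hi j hj => ?_, fun i hi => ?_, fun i hi => ?_⟩
  · have := h.pos _ hi _ hj
    simp only [Config.refl]
    linarith
  · simp only [Config.refl, h.vel _ hi]
  · simp only [Config.refl, h.spin _ hi]

/-- The velocity of `0` and the particles on each side are three disjoint families. The distances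
from `0` to its two neighbours do not matter for the chains, so each side involves only the gaps
between its own particles. -/
lemma prob_static_blockChainIn (hm : m (Set.Iic 0) = 0) (hp : 0 ≤ p)
    (l l' : List (Set (ℕ × Shape))) :
    processLaw p m {ξ | ((cfg ξ).vel 0 = 0 ∧ BlockChainIn (cfg ξ) 0 l) ∧
        BlockChainIn (cfg ξ).refl 0 l'} =
      ENNReal.ofReal p * processLaw p m {ξ | BlockChainIn (cfg ξ) 0 l} *
        processLaw p m {ξ | BlockChainIn (cfg ξ) 0 l'} := by
  have hr : Measurable fun ξ => BlockChainIn (cfg ξ).refl 0 l' := by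
    have := (measurable_blockChainIn l' 0).comp measurable_reflMarks
    simpa only [Function.comp_def, cfg_reflMarks] using this
  have h1 := prob_inter_of_sameOn (p := p) (m := m) (k := -1)
    (E := fun c => BlockChainIn c.refl 0 l') (E' := fun c => c.vel 0 = 0 ∧ BlockChainIn c 0 l) hr
    ((measurable_cfg_vel_eq _ _).and (measurable_blockChainIn _ _))
    (fun c c' h => (h.refl.mono fun x hx => by
      simp only [Set.mem_preimage, Set.mem_Iic, Set.mem_Ioi] at hx ⊢
      omega).blockChainIn l' _)
    fun c c' h => and_congr (by rw [h.vel 0 (by simp)])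
      ((h.mono (Set.Ioi_subset_Ioi (by norm_num))).blockChainIn l _)
  have h2 := prob_inter_of_sameOn (p := p) (m := m) (k := 0)
    (E := fun c => c.vel 0 = 0) (E' := fun c => BlockChainIn c 0 l)
    (measurable_cfg_vel_eq _ _) (measurable_blockChainIn _ _)
    (fun c c' h => by rw [h.vel 0 (by simp)]) fun c c' h => h.blockChainIn l _
  have h3 := prob_refl (p := p) (m := m) (E := fun c => BlockChainIn c 0 l')
    (E' := fun c => BlockChainIn c.refl 0 l') hm (measurable_blockChainIn _ _) fun _ _ => Iff.rfl
  rw [h2, h3, prob_vel_zero hp] at h1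
  have h4 := congrArg ENNReal.ofReal h1
  rw [ENNReal.ofReal_mul (prob_nonneg _), ENNReal.ofReal_mul hp, ofReal_prob, ofReal_prob,
    ofReal_prob] at h4
  rw [mul_comm (ENNReal.ofReal p * _), ← h4]
  congr 1
  ext ξ
  exact and_comm

end BallisticAnnihilation

/-! ### The two-sided skyline around a surviving static particle -/

namespace BallisticAnnihilation

/-- The absolute velocity at an end of a block of a given shape. -/
def Shape.speed (σ : Shape) (e : Bool) : ℤ := if e then σ.rightSpeed else σ.leftSpeed

/-- The reflected value of the skyline. -/
def mirrorBlock (z : ℤ × Shape) : ℤ × Shape := (z.1, z.2.mirror)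

/-- The skyline around a surviving static particle, when it is made of blocks. -/
lemma skyline_mem_iff {c : Config} (hc : c.Good) (hS : StaticSurvivor c) {N : ℕ}
    (A : ℤ → Set (ℤ × Shape))
    (hr : BlockChainIn c 0 ((List.replicate N Set.univ).map blockSet))
    (hl : BlockChainIn c.refl 0 ((List.replicate N Set.univ).map blockSet)) :
    ((BlockChainIn c 0 ((List.ofFn fun i : Fin N => A (i + 1)).map blockSet) ∧
      BlockChainIn c.refl 0
        ((List.ofFn fun i : Fin N => mirrorBlock ⁻¹' A (-(i + 1))).map blockSet)) ↔
      ∀ i < N, skyline c (i + 1) ∈ A (i + 1) ∧ skyline c (-(i + 1)) ∈ A (-(i + 1))) ∧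
    ∀ i < N, ∀ e, endSpeed c (i + 1) e = (skyline c (i + 1)).2.speed e ∧
      endSpeed c (-(i + 1)) e = (skyline c (-(i + 1))).2.speed e := by
  have R : ∀ bs : List (ℕ × Shape), BlockChain c 0 bs → ∀ i (hi : i < bs.length),
      skyline c (i + 1) = ((bs[i].1 : ℤ), bs[i].2) ∧
        endSpeed c (i + 1) false = bs[i].2.leftSpeed ∧
        endSpeed c (i + 1) true = bs[i].2.rightSpeed := by
    intro bs h i hi
    refine Block.Fits.skyline_eq ?_
    have := h.rightBlock_fits hc hS bs i hi
    rwa [skylineBlock, if_pos (by omega), show ((i : ℤ) + 1).toNat = i + 1 by omega]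
  have L : ∀ bs : List (ℕ × Shape), BlockChain c.refl 0 bs → ∀ i (hi : i < bs.length),
      skyline c (-(i + 1)) = ((bs[i].1 : ℤ), bs[i].2.mirror) ∧
        endSpeed c (-(i + 1)) false = bs[i].2.mirror.leftSpeed ∧
        endSpeed c (-(i + 1)) true = bs[i].2.mirror.rightSpeed := by
    intro bs h i hi
    refine Block.Fits.skyline_eq (b := (bs[i].1, bs[i].2.mirror)) ?_
    have := h.leftBlock_fits hc (hS.refl hc) bs i hi
    rwa [skylineBlock, if_neg (by omega), show (-(-((i : ℤ) + 1))).toNat = i + 1 by omega]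
  have len : ∀ {l : List (Set (ℕ × Shape))} {bs}, List.Forall₂ (· ∈ ·) bs l →
      bs.length = l.length := fun h => h.length_eq
  obtain ⟨br, hr1, hr2⟩ := (blockChainIn_iff _ _).1 hr
  obtain ⟨bl, hl1, hl2⟩ := (blockChainIn_iff _ _).1 hl
  have er : br.length = N := by simpa using len hr1
  have el : bl.length = N := by simpa using len hl1
  refine ⟨⟨?_, fun h => ⟨?_, ?_⟩⟩, fun i hi e => ?_⟩
  · rintro ⟨h, h'⟩ i hi
    obtain ⟨bs, h1, h2⟩ := (blockChainIn_iff _ _).1 h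
    obtain ⟨bs', h1', h2'⟩ := (blockChainIn_iff _ _).1 h'
    have e1 : bs.length = N := by simpa using len h1
    have e1' : bs'.length = N := by simpa using len h1'
    rw [(R bs h2 i (by omega)).1, (L bs' h2' i (by omega)).1]
    have m1 := h1.get (i := i) (by omega) (by simpa using hi)
    have m2 := h1'.get (i := i) (by omega) (by simpa using hi)
    simp only [List.get_eq_getElem, List.getElem_map, List.getElem_ofFn] at m1 m2
    exact ⟨m1, m2⟩
  · refine (blockChainIn_iff _ _).2 ⟨br, ?_, hr2⟩
    refine List.forall₂_iff_get.2 ⟨by simpa using er, fun i h1 h2 => ?_⟩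
    have := (h i (by omega)).1
    rw [(R br hr2 i h1).1] at this
    simp only [List.get_eq_getElem, List.getElem_map, List.getElem_ofFn]
    exact this
  · refine (blockChainIn_iff _ _).2 ⟨bl, ?_, hl2⟩
    refine List.forall₂_iff_get.2 ⟨by simpa using el, fun i h1 h2 => ?_⟩
    have := (h i (by omega)).2
    rw [(L bl hl2 i h1).1] at this
    simp only [List.get_eq_getElem, List.getElem_map, List.getElem_ofFn]
    exact this
  · obtain ⟨h1, h2, h3⟩ := R br hr2 i (by omega)
    obtain ⟨h1', h2', h3'⟩ := L bl hl2 i (by omega)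
    rw [h1, h1']
    cases e
    · exact ⟨h2, h2'⟩
    · exact ⟨h3, h3'⟩

lemma prod_range_succ_neg {M : Type*} [CommMonoid M] (g : ℤ → M) (N : ℕ) :
    ∏ i ∈ Finset.range N, g (i + 1) * g (-(i + 1)) =
      ∏ k ∈ (Finset.Icc (-N : ℤ) N).erase 0, g k := by
  induction N with
  | zero => simp
  | succ N ih =>
    have h : (Finset.Icc (-(N + 1 : ℕ) : ℤ) (N + 1 : ℕ)).erase 0 =
        insert ((N : ℤ) + 1) (insert (-((N : ℤ) + 1)) ((Finset.Icc (-N : ℤ) N).erase 0)) := by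
      ext x
      simp only [Finset.mem_erase, Finset.mem_Icc, Finset.mem_insert]
      omega
    rw [Finset.prod_range_succ, ih, h, Finset.prod_insert, Finset.prod_insert, mul_comm, mul_assoc]
    · simp only [Finset.mem_erase, Finset.mem_Icc]
      omega
    · simp only [Finset.mem_erase, Finset.mem_Icc, Finset.mem_insert]
      omega

variable {p : ℝ} {m : Measure ℝ} [IsProbabilityMeasure m] [IsProbabilityMeasure (velLaw p)]

/-- Almost surely, if the static particle `0` survives then the skyline is made of blocks. -/
lemma ae_blockChainIn_of_static (hm : m (Set.Iic 0) = 0) (hp : 1 / 4 < p) (hp1 : p ≤ 1) (N : ℕ) :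
    ∀ᵐ ξ ∂processLaw p m, StaticSurvivor (cfg ξ) →
      BlockChainIn (cfg ξ) 0 ((List.replicate N Set.univ).map blockSet) ∧
      BlockChainIn (cfg ξ).refl 0 ((List.replicate N Set.univ).map blockSet) := by
  have h1 := ae_blockChainIn (p := p) hm hp hp1 N
  have h2 := (measurePreserving_reflMarks (p := p) (m := m)).quasiMeasurePreserving.ae h1
  filter_upwards [h1, h2, ae_good (p := p) hm] with ξ h1 h2 hg hS
  obtain ⟨-, h3, h4⟩ := (staticSurvivor_iff hg).1 hS
  rw [cfg_reflMarks] at h2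
  exact ⟨h1 h3, h2 h4⟩

/-- Survival is implied by the two chains, each of which forbids arrivals at `0`. The target sets on
the left are mirrored, as the left blocks are read in the reflected configuration. -/
lemma ae_skyline_iff (hm : m (Set.Iic 0) = 0) (hp : 1 / 4 < p) (hp1 : p ≤ 1) (N : ℕ)
    (A : ℤ → Set (ℤ × Shape)) :
    ∀ᵐ ξ ∂processLaw p m, (StaticSurvivor (cfg ξ) ∧ ∀ i < N, skyline (cfg ξ) (i + 1) ∈ A (i + 1) ∧
        skyline (cfg ξ) (-(i + 1)) ∈ A (-(i + 1))) ↔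
      ((cfg ξ).vel 0 = 0 ∧
        BlockChainIn (cfg ξ) 0 ((List.ofFn fun i : Fin N => A (i + 1)).map blockSet)) ∧
        BlockChainIn (cfg ξ).refl 0
          ((List.ofFn fun i : Fin N => mirrorBlock ⁻¹' A (-(i + 1))).map blockSet) := by
  filter_upwards [ae_blockChainIn_of_static (p := p) hm hp hp1 N, ae_good (p := p) hm] with ξ h hg
  constructor
  · rintro ⟨hS, h1⟩
    have h2 := ((skyline_mem_iff hg hS A (h hS).1 (h hS).2).1).2 h1
    exact ⟨⟨hS.1, h2.1⟩, h2.2⟩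
  · rintro ⟨⟨h0, h1⟩, h2⟩
    have hS := (staticSurvivor_iff hg).2 ⟨h0, h1.noArr hg, h2.noArr hg.refl⟩
    exact ⟨hS, ((skyline_mem_iff hg hS A (h hS).1 (h hS).2).1).1 ⟨h1, h2⟩⟩

/-- The probability of survival of the static particle `0`. -/
noncomputable def survivalProb (p : ℝ) (m : Measure ℝ) [IsProbabilityMeasure m]
    [IsProbabilityMeasure (velLaw p)] : ENNReal :=
  ENNReal.ofReal p * ENNReal.ofReal (1 - firstGen p m 1) * ENNReal.ofReal (1 - firstGen p m 1)

lemma survivalProb_ne_zero (hm : m (Set.Iic 0) = 0) (hp : 1 / 4 < p) (hp1 : p ≤ 1) :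
    survivalProb p m ≠ 0 := by
  have h := firstGen_one_lt hm hp hp1
  unfold survivalProb
  have h1 : ENNReal.ofReal p ≠ 0 := (ENNReal.ofReal_pos.2 (by linarith)).ne'
  have h2 : ENNReal.ofReal (1 - firstGen p m 1) ≠ 0 := (ENNReal.ofReal_pos.2 (by linarith)).ne'
  exact mul_ne_zero (mul_ne_zero h1 h2) h2

lemma prob_skyline_range (hm : m (Set.Iic 0) = 0) (hp : 1 / 4 < p) (hp1 : p ≤ 1) (N : ℕ)
    (A : ℤ → Set (ℤ × Shape)) :
    processLaw p m {ξ | StaticSurvivor (cfg ξ) ∧ ∀ i < N, skyline (cfg ξ) (i + 1) ∈ A (i + 1) ∧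
        skyline (cfg ξ) (-(i + 1)) ∈ A (-(i + 1))} =
      survivalProb p m * ∏ k ∈ (Finset.Icc (-N : ℤ) N).erase 0, blockLaw p m (A k) := by
  have hp0 : 0 ≤ p := by linarith
  have h : ∀ k, blockLaw p m (mirrorBlock ⁻¹' A k) = blockLaw p m (A k) :=
    fun k => blockLaw_mirror hm hp0 (A k)
  refine (measure_congr (Filter.eventuallyEq_set.2 (ae_skyline_iff hm hp hp1 N A))).trans
    ((prob_static_blockChainIn hm hp0 _ _).trans ?_)
  rw [prob_blockChainIn hm, prob_blockChainIn hm,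
    ← prod_range_succ_neg, Finset.prod_mul_distrib, List.map_ofFn, List.map_ofFn, List.prod_ofFn,
    List.prod_ofFn, ← Fin.prod_univ_eq_prod_range (fun i => blockLaw p m (A (i + 1))),
    ← Fin.prod_univ_eq_prod_range (fun i => blockLaw p m (A (-(i + 1))))]
  simp only [Function.comp_def, h, survivalProb]
  ring

lemma skyline_mem_Icc_iff {c : Config} {N : ℕ} (A : ℤ → Set (ℤ × Shape)) :
    (∀ i < N, skyline c (i + 1) ∈ A (i + 1) ∧ skyline c (-(i + 1)) ∈ A (-(i + 1))) ↔
      ∀ k ∈ (Finset.Icc (-N : ℤ) N).erase 0, skyline c k ∈ A k := by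
  constructor
  · intro h k hk
    simp only [Finset.mem_erase, Finset.mem_Icc] at hk
    rcases lt_or_gt_of_ne hk.1 with h0 | h0
    · have := (h (-k - 1).toNat (by omega)).2
      rwa [show (-(((-k - 1).toNat : ℤ) + 1)) = k by omega] at this
    · have := (h (k - 1).toNat (by omega)).1
      rwa [show (((k - 1).toNat : ℤ) + 1) = k by omega] at this
  · intro h i hi
    refine ⟨h _ ?_, h _ ?_⟩ <;> simp only [Finset.mem_erase, Finset.mem_Icc] <;> omega

lemma exists_subset_Icc (K : Finset {k : ℤ // k ≠ 0}) :
    ∃ N : ℕ, K.map (Function.Embedding.subtype _) ⊆ (Finset.Icc (-N : ℤ) N).erase 0 := by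
  refine ⟨K.sup fun k => k.1.natAbs, fun x hx => ?_⟩
  obtain ⟨k, hk, rfl⟩ := Finset.mem_map.1 hx
  have h := Finset.le_sup (f := fun k : {k : ℤ // k ≠ 0} => k.1.natAbs) hk
  have h0 := k.2
  simp only [Function.Embedding.subtype_apply, Finset.mem_erase, Finset.mem_Icc]
  refine ⟨h0, ?_⟩
  omega

open Classical in
/-- The blocks of the skyline around a surviving static particle are independent. -/
theorem prob_skyline (hm : m (Set.Iic 0) = 0) (hp : 1 / 4 < p) (hp1 : p ≤ 1)
    (K : Finset {k : ℤ // k ≠ 0}) (A : {k : ℤ // k ≠ 0} → Set (ℤ × Shape)) :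
    NullMeasurableSet {ξ | StaticSurvivor (cfg ξ) ∧ ∀ k ∈ K, skyline (cfg ξ) k ∈ A k}
      (processLaw p m) ∧
    processLaw p m {ξ | StaticSurvivor (cfg ξ) ∧ ∀ k ∈ K, skyline (cfg ξ) k ∈ A k} =
      survivalProb p m * ∏ k ∈ K, blockLaw p m (A k) := by
  have := isProbabilityMeasure_blockLaw (p := p) hm hp hp1
  obtain ⟨N, hN⟩ := exists_subset_Icc K
  -- The finite index set is enlarged to a symmetric interval without `0`; the added blocks are
  -- unconstrained and contribute factors equal to one.
  set A' : ℤ → Set (ℤ × Shape) := fun k => if h : ∃ h : k ≠ 0, ⟨k, h⟩ ∈ K then A ⟨k, h.1⟩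
    else Set.univ with hA'
  have h1 : ∀ k ∈ K, A' k = A k := fun k hk => dif_pos ⟨k.2, hk⟩
  have h2 : ∀ k, k ∉ K.map (Function.Embedding.subtype _) → A' k = Set.univ := by
    intro k hk
    refine dif_neg ?_
    rintro ⟨h, h'⟩
    exact hk (Finset.mem_map.2 ⟨⟨k, h⟩, h', rfl⟩)
  have h3 : ∀ ξ, (∀ i < N, skyline (cfg ξ) (i + 1) ∈ A' (i + 1) ∧
      skyline (cfg ξ) (-(i + 1)) ∈ A' (-(i + 1))) ↔ ∀ k ∈ K, skyline (cfg ξ) k ∈ A k := by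
    intro ξ
    rw [skyline_mem_Icc_iff]
    constructor
    · intro h k hk
      rw [← h1 k hk]
      exact h _ (hN (Finset.mem_map.2 ⟨k, hk, rfl⟩))
    · intro h k _
      by_cases hk' : k ∈ K.map (Function.Embedding.subtype _)
      · obtain ⟨k, hk, rfl⟩ := Finset.mem_map.1 hk'
        simp only [Function.Embedding.subtype_apply]
        rw [h1 k hk]
        exact h k hk
      · rw [h2 k hk']
        trivial
  have h4 : {ξ | StaticSurvivor (cfg ξ) ∧ ∀ k ∈ K, skyline (cfg ξ) k ∈ A k} =
      {ξ | StaticSurvivor (cfg ξ) ∧ ∀ i < N, skyline (cfg ξ) (i + 1) ∈ A' (i + 1) ∧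
        skyline (cfg ξ) (-(i + 1)) ∈ A' (-(i + 1))} := by
    ext ξ
    exact and_congr_right fun _ => (h3 ξ).symm
  rw [h4]
  constructor
  · refine NullMeasurableSet.congr (MeasurableSet.nullMeasurableSet (measurableSet_setOfPred.2 ?_))
      (Filter.eventuallyEq_set.2 (ae_skyline_iff hm hp hp1 N A')).symm
    refine ((measurable_cfg_vel_eq _ _).and (measurable_blockChainIn _ _)).and ?_
    have := (measurable_blockChainIn
      ((List.ofFn fun i : Fin N => mirrorBlock ⁻¹' A' (-(i + 1))).map blockSet) 0).comp
      measurable_reflMarks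
    simpa only [Function.comp_def, cfg_reflMarks] using this
  · rw [prob_skyline_range hm hp hp1]
    congr 1
    rw [← Finset.prod_subset hN fun k _ hk => by rw [h2 k hk, measure_univ], Finset.prod_map]
    exact Finset.prod_congr rfl fun k hk => by
      rw [Function.Embedding.subtype_apply, h1 k hk]

lemma ae_endSpeed (hm : m (Set.Iic 0) = 0) (hp : 1 / 4 < p) (hp1 : p ≤ 1) :
    ∀ᵐ ξ ∂processLaw p m, StaticSurvivor (cfg ξ) → ∀ k, k ≠ 0 → ∀ e,
      endSpeed (cfg ξ) k e = (skyline (cfg ξ) k).2.speed e := by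
  filter_upwards [ae_all_iff.2 fun N => ae_blockChainIn_of_static (p := p) hm hp hp1 N,
    ae_good (p := p) hm] with ξ h hg hS k hk e
  have h1 := (skyline_mem_iff hg hS (fun _ => Set.univ) (h (k.natAbs) hS).1 (h _ hS).2).2
  rcases lt_or_gt_of_ne hk with h0 | h0
  · have := (h1 (-k - 1).toNat (by omega) e).2
    rwa [show (-(((-k - 1).toNat : ℤ) + 1)) = k by omega] at this
  · have := (h1 (k - 1).toNat (by omega) e).1
    rwa [show (((k - 1).toNat : ℤ) + 1) = k by omega] at this

end BallisticAnnihilation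

/-! ### From the marks to an arbitrary realization -/

namespace BallisticAnnihilation

section Deterministic

variable {c : Config}

/-- A partner of a left-moving particle starts in `(0, ∞)` with nonnegative velocity, so an
annihilation would take place at a positive location, before the crossing. Thus crossing `0` amounts
to never being annihilated. -/
lemma crossesFromRight_iff (hc : c.Good) (h0 : c.pos 0 = 0) {k : ℤ} :
    CrossesFromRight c halfLine 0 k ↔ Arr c 0 k := by
  by_cases hk : 0 < k
  · rw [arr_iff_Ioi hc hk]
    have hpos : ∀ j, 0 < j → 0 < c.pos j := fun j hj => h0 ▸ hc.mono hj
    constructor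
    · rintro ⟨-, h1, -, h2⟩
      refine ⟨h1, fun j hj => ?_⟩
      have h3 := h2 j (Mate.symm hj)
      obtain ⟨t, ht⟩ := hj.meet hc
      have hjI : 0 < j := hj.mem_right hc
      rw [(collTime_eq_coe hc).2 ht.symm, EReal.coe_lt_coe_iff] at h3
      have h4 := hpos j hjI
      have h7 : (0 : ℝ) ≤ c.vel j := by
        have := hc.vel j
        have := ht.vel_ne hc
        exact_mod_cast (by omega : 0 ≤ c.vel j)
      obtain ⟨-, h5, h6⟩ := ht
      simp only [Config.loc, h1] at h6
      push_cast at h6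
      nlinarith
    · rintro ⟨h1, h2⟩
      exact ⟨hk, h1, hpos k hk, fun j hj => (h2 j (Mate.symm hj)).elim⟩
  · exact ⟨fun h => (hk h.1).elim, fun h => (hk h.1).elim⟩

lemma firstArrival_eq_iff (hc : c.Good) (h0 : c.pos 0 = 0) (n : ℕ) :
    firstArrival c = n ↔ FirstArr c 0 n := by
  have hs : {k : ℕ | 1 ≤ k ∧ CrossesFromRight c halfLine 0 (k : ℤ)} = {k : ℕ | Arr c 0 k} := by
    ext k
    simp only [Set.mem_ofPred_eq, crossesFromRight_iff hc h0]
    exact ⟨fun h => h.2, fun h => ⟨by have := h.1; omega, h⟩⟩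
  have key : ∀ n : ℕ, FirstArr c 0 n → firstArrival c = n := by
    intro n h
    unfold firstArrival
    rw [hs]
    refine le_antisymm (iInf₂_le n h.1) (le_iInf₂ fun k hk => ?_)
    exact_mod_cast h.2 _ hk
  refine ⟨fun h => ?_, key n⟩
  rcases firstArr_or_noArr c 0 with h1 | ⟨k, hk⟩
  · exfalso
    unfold firstArrival at h
    rw [hs] at h
    have : {k : ℕ | Arr c 0 k} = ∅ := Set.eq_empty_of_forall_notMem fun k hk => h1 _ hk
    rw [this] at h
    simp at h
  · have h2 := hk.1.1
    obtain ⟨k, rfl⟩ := Int.eq_ofNat_of_zero_le h2.le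
    have := key k hk
    rw [h] at this
    rwa [Nat.cast_inj.1 this]

lemma firstArrival_lt_top_iff (hc : c.Good) (h0 : c.pos 0 = 0) :
    firstArrival c < ⊤ ↔ ∃ n : ℕ, FirstArr c 0 n := by
  simp only [← firstArrival_eq_iff hc h0, lt_top_iff_ne_top, ENat.ne_top_iff_exists, eq_comm]

lemma rightLeftCollision_iff (hc : c.Good) (n : ℕ) :
    RightLeftCollision c 1 (n + 1) ↔ IsBlock c 0 n .rightLeft := by
  have hI := startsAfter_Ioi 0
  have e : (n : ℤ) + 1 = 0 + 1 + n := by ring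
  have hj : 0 + 1 + (n : ℤ) ∈ Set.Ioi 0 := by simp only [Set.mem_Ioi]; omega
  unfold RightLeftCollision
  rw [annihilates_iff, e]
  constructor
  · rintro ⟨h1, h2, -, h3⟩
    exact ⟨h1, h2, (mate_right_left_iff hc hI h1 hj h2).1 h3⟩
  · rintro ⟨h1, h2, h3⟩
    refine ⟨h1, h2, ?_, (mate_right_left_iff hc hI h1 hj h2).2 h3⟩
    by_contra hn
    have : n = 0 := by omega
    subst this
    rw [Nat.cast_zero, add_zero] at h2
    rw [zero_add] at h1 h2
    omega

lemma exists_rightLeftCollision_iff (hc : c.Good) :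
    (∃ j, RightLeftCollision c 1 j) ↔ ∃ n : ℕ, IsBlock c 0 n .rightLeft := by
  simp only [← rightLeftCollision_iff hc]
  constructor
  · rintro ⟨j, hj⟩
    have h1 := (annihilates_iff.1 hj.2.2).1
    refine ⟨(j - 1).toNat, ?_⟩
    rwa [show (((j - 1).toNat : ℤ) + 1) = j by omega]
  · rintro ⟨n, hn⟩
    exact ⟨_, hn⟩

end Deterministic

/-- The law of the absolute velocity at an end of a block. -/
noncomputable def speedLaw (p : ℝ) (B : Set ℤ) : ENNReal :=
  B.indicator 1 0 * ENNReal.ofReal √p + B.indicator 1 1 * ENNReal.ofReal (1 - √p)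

lemma speedLaw_univ {p : ℝ} (hp1 : p ≤ 1) : speedLaw p Set.univ = 1 := by
  have h1 : √p ≤ 1 := Real.sqrt_le_one.2 hp1
  simp only [speedLaw, Set.indicator_univ, Pi.one_apply, one_mul]
  rw [← ENNReal.ofReal_add (Real.sqrt_nonneg p) (by linarith)]
  simp

lemma IsFullLineProcess.eq_cfg {Ω : Type*} [MeasurableSpace Ω] {p : ℝ} {m : Measure ℝ}
    {P : Measure Ω} {X : Ω → Config} (hX : IsFullLineProcess p m P X) (ω : Ω) :
    X ω = cfg fun n => (X ω).mark n :=
  eq_cfg_of_mark (hX.pos_zero ω) fun _ => rfl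

lemma cond_apply_of_nullMeasurableSet {Ω : Type*} [MeasurableSpace Ω] {P : Measure Ω} {s : Set Ω}
    (hs : NullMeasurableSet s P) (t : Set Ω) : P[|s] t = (P s)⁻¹ * P (s ∩ t) := by
  rw [ProbabilityTheory.cond, Measure.smul_apply, Measure.restrict_apply₀' hs, Set.inter_comm,
    smul_eq_mul]

variable {p : ℝ} {m : Measure ℝ} [IsProbabilityMeasure m] [IsProbabilityMeasure (velLaw p)]

/-- The absolute velocities at both ends of a block are independent. -/
lemma blockLaw_speed (hm : m (Set.Iic 0) = 0) (hp : 1 / 4 < p) (hp1 : p ≤ 1) (B : Bool → Set ℤ) :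
    blockLaw p m {z | ∀ e, z.2.speed e ∈ B e} = ∏ e, speedLaw p (B e) := by
  have h1 : √p ≤ 1 := Real.sqrt_le_one.2 hp1
  have hs := Real.mul_self_sqrt (by linarith : 0 ≤ p)
  have h2 := blockLaw_shape (p := p) hm hp hp1 {σ | ∀ e, σ.speed e ∈ B e}
  have h3 : ∀ σ : Shape, Set.indicator {σ : Shape | ∀ e, σ.speed e ∈ B e} (1 : Shape → ENNReal) σ =
      (B false).indicator 1 (σ.speed false) * (B true).indicator 1 (σ.speed true) := by
    intro σ
    by_cases e1 : σ.speed false ∈ B false <;> by_cases e2 : σ.speed true ∈ B true <;>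
      simp [Set.indicator, e1, e2]
  -- Writing `p` as `√p · √p` makes each shape weight the product of one factor per end: `√p` for a
  -- static end and `1 - √p` for a moving one.
  have e1 : ENNReal.ofReal p = ENNReal.ofReal √p * ENNReal.ofReal √p := by
    rw [← ENNReal.ofReal_mul (Real.sqrt_nonneg p), hs]
  refine h2.trans ?_
  simp only [h3, tsum_shape]
  simp only [shapeWeight, Shape.speed, Shape.leftSpeed, Shape.rightSpeed,
    Fintype.prod_bool, speedLaw, sq, e1, ENNReal.ofReal_mul (Real.sqrt_nonneg p),
    ENNReal.ofReal_mul (by linarith : 0 ≤ 1 - √p)]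
  simp only [if_true, Bool.false_eq_true, if_false]
  ring

section Realization

variable {Ω : Type*} [MeasurableSpace Ω] {P : Measure Ω} [IsProbabilityMeasure P] {X : Ω → Config}

lemma IsFullLineProcess.measurePreserving (hX : IsFullLineProcess p m P X) :
    MeasurePreserving (fun ω n => (X ω).mark n) P (processLaw p m) where
  measurable := measurable_pi_iff.2 hX.measurable_mark
  map_eq := by
    rw [(iIndepFun_iff_map_fun_eq_infinitePi_map hX.measurable_mark).1 hX.indep]
    simp only [hX.law_mark]
    rfl

lemma IsFullLineProcess.ae (hX : IsFullLineProcess p m P X) {E : Config → Prop}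
    (h : ∀ᵐ ξ ∂processLaw p m, E (cfg ξ)) : ∀ᵐ ω ∂P, E (X ω) := by
  filter_upwards [hX.measurePreserving.quasiMeasurePreserving.ae h] with ω hω
  rwa [hX.eq_cfg ω]

lemma IsFullLineProcess.nullMeasurableSet (hX : IsFullLineProcess p m P X) {E : Config → Prop}
    (h : NullMeasurableSet {ξ | E (cfg ξ)} (processLaw p m)) :
    NullMeasurableSet {ω | E (X ω)} P := by
  have := h.preimage hX.measurePreserving.quasiMeasurePreserving
  convert this using 1
  ext ω
  simp only [Set.mem_ofPred_eq, Set.mem_preimage]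
  rw [← hX.eq_cfg ω]

lemma IsFullLineProcess.measure_eq (hX : IsFullLineProcess p m P X) {E : Config → Prop}
    (h : NullMeasurableSet {ξ | E (cfg ξ)} (processLaw p m)) :
    P {ω | E (X ω)} = processLaw p m {ξ | E (cfg ξ)} := by
  rw [← hX.measurePreserving.measure_preimage h]
  congr 1
  ext ω
  simp only [Set.mem_ofPred_eq, Set.mem_preimage]
  rw [← hX.eq_cfg ω]

lemma IsFullLineProcess.measurableSet_staticSurvivor (hX : IsFullLineProcess p m P X) :
    MeasurableSet {ω | StaticSurvivor (X ω)} := by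
  have := measurableSet_setOfPred.2 measurable_staticSurvivor
  convert hX.measurePreserving.measurable this using 1
  ext ω
  simp only [Set.mem_ofPred_eq, Set.mem_preimage]
  rw [← hX.eq_cfg ω]

lemma IsFullLineProcess.inter_skyline (hX : IsFullLineProcess p m P X) (hm : m (Set.Iic 0) = 0)
    (hp : 1 / 4 < p) (hp1 : p ≤ 1) (K : Finset {k : ℤ // k ≠ 0})
    (A : {k : ℤ // k ≠ 0} → Set (ℤ × Shape)) :
    NullMeasurableSet ({ω | StaticSurvivor (X ω)} ∩ {ω | ∀ k ∈ K, skyline (X ω) k ∈ A k}) P ∧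
    P ({ω | StaticSurvivor (X ω)} ∩ {ω | ∀ k ∈ K, skyline (X ω) k ∈ A k}) =
      survivalProb p m * ∏ k ∈ K, blockLaw p m (A k) := by
  obtain ⟨h1, h2⟩ := prob_skyline (p := p) hm hp hp1 K A
  exact ⟨hX.nullMeasurableSet (E := fun c => StaticSurvivor c ∧ ∀ k ∈ K, skyline c k ∈ A k) h1,
    (hX.measure_eq (E := fun c => StaticSurvivor c ∧ ∀ k ∈ K, skyline c k ∈ A k) h1).trans h2⟩

lemma IsFullLineProcess.measure_staticSurvivor (hX : IsFullLineProcess p m P X)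
    (hm : m (Set.Iic 0) = 0) (hp : 1 / 4 < p) (hp1 : p ≤ 1) :
    P {ω | StaticSurvivor (X ω)} = survivalProb p m := by
  simpa using (hX.inter_skyline hm hp hp1 ∅ fun _ => ∅).2

lemma IsFullLineProcess.cond_skyline (hX : IsFullLineProcess p m P X) (hm : m (Set.Iic 0) = 0)
    (hp : 1 / 4 < p) (hp1 : p ≤ 1) (K : Finset {k : ℤ // k ≠ 0})
    (A : {k : ℤ // k ≠ 0} → Set (ℤ × Shape)) :
    P[|{ω | StaticSurvivor (X ω)}] {ω | ∀ k ∈ K, skyline (X ω) k ∈ A k} =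
      ∏ k ∈ K, blockLaw p m (A k) := by
  have h := hX.measure_staticSurvivor hm hp hp1
  rw [cond_apply hX.measurableSet_staticSurvivor, (hX.inter_skyline hm hp hp1 K A).2, ← h,
    ← mul_assoc, ENNReal.inv_mul_cancel, one_mul]
  · rw [h]
    exact survivalProb_ne_zero hm hp hp1
  · exact measure_ne_top _ _

lemma IsFullLineProcess.cond_skyline_singleton (hX : IsFullLineProcess p m P X)
    (hm : m (Set.Iic 0) = 0) (hp : 1 / 4 < p) (hp1 : p ≤ 1) {k : ℤ} (hk : k ≠ 0)
    (A : Set (ℤ × Shape)) :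
    P[|{ω | StaticSurvivor (X ω)}] {ω | skyline (X ω) k ∈ A} = blockLaw p m A := by
  simpa using hX.cond_skyline hm hp hp1 {⟨k, hk⟩} fun _ => A

lemma IsFullLineProcess.iIndepFun_skyline (hX : IsFullLineProcess p m P X)
    (hm : m (Set.Iic 0) = 0) (hp : 1 / 4 < p) (hp1 : p ≤ 1) :
    iIndepFun (fun (k : {k : ℤ // k ≠ 0}) ω => skyline (X ω) k)
      P[|{ω | StaticSurvivor (X ω)}] := by
  rw [iIndepFun_iff_measure_inter_preimage_eq_mul]
  intro K A _
  have h1 := hX.cond_skyline hm hp hp1 K A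
  have h2 : ∀ k : {k : ℤ // k ≠ 0}, P[|{ω | StaticSurvivor (X ω)}]
      ((fun ω => skyline (X ω) k) ⁻¹' A k) = blockLaw p m (A k) :=
    fun k => hX.cond_skyline_singleton hm hp hp1 k.2 (A k)
  rw [Finset.prod_congr rfl fun k _ => h2 k, ← h1]
  congr 1
  ext ω
  simp

lemma IsFullLineProcess.hasLaw_skyline (hX : IsFullLineProcess p m P X)
    (hm : m (Set.Iic 0) = 0) (hp : 1 / 4 < p) (hp1 : p ≤ 1) {k : ℤ} (hk : k ≠ 0) :
    HasLaw (fun ω => skyline (X ω) k) (blockLaw p m) P[|{ω | StaticSurvivor (X ω)}] := by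
  have hS := hX.measurableSet_staticSurvivor
  -- The skyline is identified with chains of blocks only on survival and up to null sets, so null
  -- measurability under the conditional measure is what this identification yields.
  have h1 : NullMeasurable (fun ω => skyline (X ω) k) P[|{ω | StaticSurvivor (X ω)}] := by
    intro A _
    have h2 := (hX.inter_skyline hm hp hp1 {⟨k, hk⟩} fun _ => A).1
    simp only [Finset.mem_singleton, forall_eq] at h2
    refine (h2.mono_ac (cond_absolutelyContinuous)).congr ?_
    filter_upwards [ae_cond_mem hS] with ω hω
    refine propext ⟨fun h => h.2, fun h => ⟨hω, h⟩⟩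
  refine ⟨h1.aemeasurable, Measure.ext fun A hA => ?_⟩
  rw [Measure.map_apply_of_aemeasurable h1.aemeasurable hA]
  exact hX.cond_skyline_singleton hm hp hp1 hk A

open Classical in
lemma IsFullLineProcess.cond_endSpeed (hX : IsFullLineProcess p m P X) (hm : m (Set.Iic 0) = 0)
    (hp : 1 / 4 < p) (hp1 : p ≤ 1) (T : Finset ({k : ℤ // k ≠ 0} × Bool))
    (B : {k : ℤ // k ≠ 0} × Bool → Set ℤ) :
    P[|{ω | StaticSurvivor (X ω)}] {ω | ∀ a ∈ T, endSpeed (X ω) a.1 a.2 ∈ B a} =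
      ∏ a ∈ T, speedLaw p (B a) := by
  -- When only one end of a block is prescribed, the other is left free, so that the condition
  -- becomes one on whole blocks and their independence can be used.
  set B' : {k : ℤ // k ≠ 0} × Bool → Set ℤ := fun a => if a ∈ T then B a else Set.univ with hB'
  set K := T.image Prod.fst with hK
  have h1 := hX.cond_skyline hm hp hp1 K fun k => {z | ∀ e, z.2.speed e ∈ B' (k, e)}
  have h2 : ∀ᵐ ω ∂P[|{ω | StaticSurvivor (X ω)}],
      (∀ a ∈ T, endSpeed (X ω) a.1 a.2 ∈ B a) ↔
        ∀ k ∈ K, skyline (X ω) k ∈ {z : ℤ × Shape | ∀ e, z.2.speed e ∈ B' (k, e)} := by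
    have h3 : ∀ᵐ ω ∂P, StaticSurvivor (X ω) → ∀ k, k ≠ 0 → ∀ e,
        endSpeed (X ω) k e = (skyline (X ω) k).2.speed e :=
      hX.ae (E := fun c => StaticSurvivor c → ∀ k, k ≠ 0 → ∀ e,
        endSpeed c k e = (skyline c k).2.speed e) (ae_endSpeed hm hp hp1)
    filter_upwards [ae_cond_mem hX.measurableSet_staticSurvivor,
      cond_absolutelyContinuous.ae_le h3] with ω hS hω
    constructor
    · intro h k _ e
      rw [← hω hS k k.2 e, hB']
      simp only
      split_ifs with hT
      · exact h _ hT
      · trivial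
    · intro h a ha
      have := h a.1 (Finset.mem_image_of_mem _ ha) a.2
      rw [← hω hS a.1 a.1.2 a.2, hB'] at this
      simpa only [if_pos ha] using this
  refine (measure_congr (Filter.eventuallyEq_set.2 h2)).trans (h1.trans ?_)
  simp only [blockLaw_speed hm hp hp1]
  rw [← Finset.prod_product' K Finset.univ fun k e => speedLaw p (B' (k, e))]
  rw [← Finset.prod_subset (s₁ := T)]
  · exact Finset.prod_congr rfl fun a ha => by rw [hB']; simp only [if_pos ha]
  · intro a ha
    exact Finset.mem_product.2 ⟨Finset.mem_image_of_mem _ ha, Finset.mem_univ _⟩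
  · intro a _ ha
    rw [hB']
    simp only [if_neg ha, speedLaw_univ hp1]

lemma IsFullLineProcess.cond_endSpeed_singleton (hX : IsFullLineProcess p m P X)
    (hm : m (Set.Iic 0) = 0) (hp : 1 / 4 < p) (hp1 : p ≤ 1) {k : ℤ} (hk : k ≠ 0) (e : Bool)
    (B : Set ℤ) :
    P[|{ω | StaticSurvivor (X ω)}] {ω | endSpeed (X ω) k e ∈ B} = speedLaw p B := by
  simpa using hX.cond_endSpeed hm hp hp1 {(⟨k, hk⟩, e)} fun _ => B

lemma IsFullLineProcess.iIndepFun_endSpeed (hX : IsFullLineProcess p m P X)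
    (hm : m (Set.Iic 0) = 0) (hp : 1 / 4 < p) (hp1 : p ≤ 1) :
    iIndepFun (fun (a : {k : ℤ // k ≠ 0} × Bool) ω => endSpeed (X ω) a.1 a.2)
      P[|{ω | StaticSurvivor (X ω)}] := by
  rw [iIndepFun_iff_measure_inter_preimage_eq_mul]
  intro T B _
  have h1 := hX.cond_endSpeed hm hp hp1 T B
  have h2 : ∀ a : {k : ℤ // k ≠ 0} × Bool, P[|{ω | StaticSurvivor (X ω)}]
      ((fun ω => endSpeed (X ω) a.1 a.2) ⁻¹' B a) = speedLaw p (B a) :=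
    fun a => hX.cond_endSpeed_singleton hm hp hp1 a.1.2 a.2 (B a)
  rw [Finset.prod_congr rfl fun a _ => h2 a, ← h1]
  congr 1
  ext ω
  simp

end Realization

end BallisticAnnihilation

/-! ### Conditional laws of the lengths, and conclusion -/

namespace BallisticAnnihilation

variable {p : ℝ} {m : Measure ℝ} [IsProbabilityMeasure m] [IsProbabilityMeasure (velLaw p)]
variable {Ω : Type*} [MeasurableSpace Ω] {P : Measure Ω} [IsProbabilityMeasure P] {X : Ω → Config}

/-- Conditional probabilities of events that are determined by the marks up to null sets. -/
lemma IsFullLineProcess.cond_eq (hX : IsFullLineProcess p m P X) (hm : m (Set.Iic 0) = 0)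
    {E F E' F' : Config → Prop} (hE' : Measurable fun ξ => E' (cfg ξ))
    (hF' : Measurable fun ξ => F' (cfg ξ)) (hE : ∀ c : Config, c.Good → c.pos 0 = 0 → (E c ↔ E' c))
    (hF : ∀ c : Config, c.Good → c.pos 0 = 0 → (F c ↔ F' c)) (hFE : ∀ c : Config, F' c → E' c) :
    P[|{ω | E (X ω)}] {ω | F (X ω)} =
      (ENNReal.ofReal (prob p m fun ξ => E' (cfg ξ)))⁻¹ *
        ENNReal.ofReal (prob p m fun ξ => F' (cfg ξ)) := by
  have hg : ∀ᵐ ω ∂P, (X ω).Good := hX.ae (ae_good (p := p) hm)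
  have e1 : {ω | E (X ω)} =ᵐ[P] {ω | E' (X ω)} := Filter.eventuallyEq_set.2 <| by
    filter_upwards [hg] with ω hω using hE _ hω (hX.pos_zero ω)
  have e2 : ({ω | E (X ω)} ∩ {ω | F (X ω)} : Set Ω) =ᵐ[P] {ω | F' (X ω)} :=
    Filter.eventuallyEq_set.2 <| by
      filter_upwards [hg] with ω hω
      have h1 := hE _ hω (hX.pos_zero ω)
      have h2 := hF _ hω (hX.pos_zero ω)
      exact ⟨fun h => h2.1 h.2, fun h => ⟨h1.2 (hFE _ h), h2.2 h⟩⟩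
  have n1 := (measurableSet_setOfPred.2 hE').nullMeasurableSet (μ := processLaw p m)
  have n2 := (measurableSet_setOfPred.2 hF').nullMeasurableSet (μ := processLaw p m)
  rw [cond_apply_of_nullMeasurableSet ((hX.nullMeasurableSet n1).congr e1.symm), measure_congr e1,
    measure_congr e2, hX.measure_eq n1, hX.measure_eq n2, ofReal_prob, ofReal_prob]

lemma IsFullLineProcess.cond_firstArrival (hX : IsFullLineProcess p m P X)
    (hm : m (Set.Iic 0) = 0) (n : ℕ) :
    P[|{ω | firstArrival (X ω) < ⊤}] {ω | firstArrival (X ω) = n} =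
      (ENNReal.ofReal (firstGen p m 1))⁻¹ * ENNReal.ofReal (firstProb p m n) := by
  rw [(hasSum_firstProb_firstGen hm).unique (hasSum_firstProb hm)]
  exact hX.cond_eq (E := fun c => firstArrival c < ⊤) (F := fun c => firstArrival c = n)
    (E' := fun c => ∃ n : ℕ, FirstArr c 0 n) (F' := fun c => FirstArr c 0 n) hm
    (Measurable.exists fun _ => measurable_firstArr _ _) (measurable_firstArr _ _)
    (fun c hc h0 => firstArrival_lt_top_iff hc h0) (fun c hc h0 => firstArrival_eq_iff hc h0 n)
    fun c h => ⟨n, h⟩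

lemma IsFullLineProcess.cond_rightLeftCollision (hX : IsFullLineProcess p m P X)
    (hm : m (Set.Iic 0) = 0) (hp : 1 / 4 < p) (hp1 : p ≤ 1) (n : ℕ) :
    P[|{ω | ∃ j, RightLeftCollision (X ω) 1 j}] {ω | RightLeftCollision (X ω) 1 (n + 1)} =
      (ENNReal.ofReal ((1 - √p) ^ 2))⁻¹ * ENNReal.ofReal (pairProb p m n) := by
  rw [(hasSum_pairProb_sqrt hm hp hp1).unique (hasSum_pairProb hm)]
  exact hX.cond_eq (E := fun c => ∃ j, RightLeftCollision c 1 j)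
    (F := fun c => RightLeftCollision c 1 (n + 1))
    (E' := fun c => ∃ n : ℕ, IsBlock c 0 n .rightLeft) (F' := fun c => IsBlock c 0 n .rightLeft) hm
    (Measurable.exists fun _ => measurable_isBlock _ _ _) (measurable_isBlock _ _ _)
    (fun c hc _ => exists_rightLeftCollision_iff hc) (fun c hc _ => rightLeftCollision_iff hc n)
    fun c h => ⟨n, h⟩

lemma blockLaw_shape_singleton (hm : m (Set.Iic 0) = 0) (hp : 1 / 4 < p) (hp1 : p ≤ 1)
    (σ : Shape) : blockLaw p m {z | z.2 = σ} = shapeWeight p σ := by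
  have h := blockLaw_shape (p := p) hm hp hp1 {σ}
  rw [tsum_eq_single σ fun τ hτ => by simp [hτ]] at h
  simpa using h

lemma cond_blockLaw (hm : m (Set.Iic 0) = 0) (hp : 1 / 4 < p) (hp1 : p ≤ 1) (n : ℕ) (σ : Shape) :
    (blockLaw p m)[|{z | z.2 = σ}] {z | z.1 = n} =
      (shapeWeight p σ)⁻¹ * blockWeight p m (n, σ) := by
  rw [cond_apply (Set.to_countable _).measurableSet, blockLaw_shape_singleton hm hp hp1,
    blockLaw_singleton]

/-- The probability `p` of the static end of a block cancels, since the weight of the shape is `p q`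
with `q` the probability of an arrival. -/
lemma inv_mul_firstProb (hm : m (Set.Iic 0) = 0) (hp : 1 / 4 < p) (hp1 : p ≤ 1) (n : ℕ) :
    (ENNReal.ofReal (√p * (1 - √p)))⁻¹ * ENNReal.ofReal (p * firstProb p m n) =
      (ENNReal.ofReal (firstGen p m 1))⁻¹ * ENNReal.ofReal (firstProb p m n) := by
  have hp0 : 0 < p := by linarith
  have h0 : ENNReal.ofReal p ≠ 0 := (ENNReal.ofReal_pos.2 hp0).ne'
  rw [← p_mul_firstGen_one (m := m) hm hp hp1, ENNReal.ofReal_mul hp0.le,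
    ENNReal.ofReal_mul hp0.le, ENNReal.mul_inv (Or.inl h0) (Or.inl ENNReal.ofReal_ne_top),
    mul_mul_mul_comm, ENNReal.inv_mul_cancel h0 ENNReal.ofReal_ne_top, one_mul]

end BallisticAnnihilation

theorem mainTheorem5 (p : ℝ) (hp : 1 / 4 < p) (hp1 : p ≤ 1) :
    ∃ ν : Measure (ℤ × Shape), IsProbabilityMeasure ν ∧
      -- the law of `Σ`
      ν {z | z.2 = Shape.up} = ENNReal.ofReal p ∧
      ν {z | z.2 = Shape.rightUp} = ENNReal.ofReal (√p * (1 - √p)) ∧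
      ν {z | z.2 = Shape.upLeft} = ENNReal.ofReal (√p * (1 - √p)) ∧
      ν {z | z.2 = Shape.rightLeft} = ENNReal.ofReal ((1 - √p) ^ 2) ∧
      ∀ (m : Measure ℝ) [IsProbabilityMeasure m], m (Set.Iic 0) = 0 →
      ∀ (Ω : Type*) [MeasurableSpace Ω] (P : Measure Ω) [IsProbabilityMeasure P] (X : Ω → Config),
        IsFullLineProcess p m P X →
        -- the conditioning is on a (measurable up to null sets) event of positive probability
        NullMeasurableSet {ω | StaticSurvivor (X ω)} P ∧
        P {ω | StaticSurvivor (X ω)} ≠ 0 ∧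
        -- the skyline blocks are i.i.d. with law `ν`
        iIndepFun (fun (k : {k : ℤ // k ≠ 0}) ω => skyline (X ω) k)
          P[|{ω | StaticSurvivor (X ω)}] ∧
        (∀ k : ℤ, k ≠ 0 →
          HasLaw (fun ω => skyline (X ω) k) ν P[|{ω | StaticSurvivor (X ω)}]) ∧
        -- the conditional laws of `Δ` given `Σ`
        (∀ n : ℕ,
          ν[|{z | z.2 = Shape.up}] {z | z.1 = n} = (if n = 0 then 1 else 0) ∧
          ν[|{z | z.2 = Shape.upLeft}] {z | z.1 = n} =
            P[|{ω | firstArrival (X ω) < ⊤}] {ω | firstArrival (X ω) = n} ∧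
          ν[|{z | z.2 = Shape.rightUp}] {z | z.1 = n} =
            P[|{ω | firstArrival (X ω) < ⊤}] {ω | firstArrival (X ω) = n} ∧
          ν[|{z | z.2 = Shape.rightLeft}] {z | z.1 = n} =
            P[|{ω | ∃ j, RightLeftCollision (X ω) 1 j}]
              {ω | RightLeftCollision (X ω) 1 (n + 1)}) ∧
        -- the absolute velocities at the ends of the blocks are i.i.d. Bernoulli
        iIndepFun (fun (a : {k : ℤ // k ≠ 0} × Bool) ω => endSpeed (X ω) a.1 a.2)
          P[|{ω | StaticSurvivor (X ω)}] ∧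
        (∀ (k : ℤ) (e : Bool), k ≠ 0 →
          P[|{ω | StaticSurvivor (X ω)}] {ω | endSpeed (X ω) k e = 1} =
            ENNReal.ofReal (1 - √p) ∧
          P[|{ω | StaticSurvivor (X ω)}] {ω | endSpeed (X ω) k e = 0} =
            ENNReal.ofReal √p) := by
  have hp0 : 0 ≤ p := by linarith
  have := isProbabilityMeasure_velLaw hp0 hp1
  -- The law `ν` must be named before `m` is given: it is taken for unit gaps, and `blockLaw_congr`
  -- identifies it with the block law of any other `m`.
  have hd : Measure.dirac (1 : ℝ) (Set.Iic 0) = 0 := by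
    rw [Measure.dirac_apply' _ measurableSet_Iic]
    simp
  refine ⟨blockLaw p (Measure.dirac 1), isProbabilityMeasure_blockLaw hd hp hp1,
    blockLaw_shape_singleton hd hp hp1 _, blockLaw_shape_singleton hd hp hp1 _,
    blockLaw_shape_singleton hd hp hp1 _, blockLaw_shape_singleton hd hp hp1 _, ?_⟩
  intro m _ hm Ω _ P _ X hX
  rw [blockLaw_congr (m' := m) hd hm hp0 hp1]
  refine ⟨hX.measurableSet_staticSurvivor.nullMeasurableSet, ?_, hX.iIndepFun_skyline hm hp hp1,
    fun k hk => hX.hasLaw_skyline hm hp hp1 hk, fun n => ⟨?_, ?_, ?_, ?_⟩,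
    hX.iIndepFun_endSpeed hm hp hp1, fun k e hk => ⟨?_, ?_⟩⟩
  · rw [hX.measure_staticSurvivor hm hp hp1]
    exact survivalProb_ne_zero hm hp hp1
  · rw [cond_blockLaw hm hp hp1, blockWeight_up hp0, shapeWeight]
    split_ifs
    · exact ENNReal.inv_mul_cancel (ENNReal.ofReal_pos.2 (by linarith)).ne' ENNReal.ofReal_ne_top
    · exact mul_zero _
  · rw [cond_blockLaw hm hp hp1, blockWeight_upLeft hm hp0, shapeWeight, hX.cond_firstArrival hm,
      inv_mul_firstProb hm hp hp1]
  · rw [cond_blockLaw hm hp hp1, blockWeight_rightUp hm hp0, shapeWeight, hX.cond_firstArrival hm,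
      inv_mul_firstProb hm hp hp1]
  · rw [cond_blockLaw hm hp hp1, blockWeight_rightLeft, shapeWeight,
      hX.cond_rightLeftCollision hm hp hp1]
  · have h := hX.cond_endSpeed_singleton hm hp hp1 hk e {1}
    simpa [speedLaw] using h
  · have h := hX.cond_endSpeed_singleton hm hp hp1 hk e {0}
    simpa [speedLaw] using h
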